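/- Notation. $\mathbb R^3_+=\{x=(y,x_3): y\in\mathbb R^2,\ x_3>0\}$, $T^i>0$ is a fixed constant, $L^2$, $L^\infty$, $H^s$ are taken on $\mathbb R^3_+$, and $h_0(\phi)=-\frac{e^{-\phi}-1+\phi}{\phi}$ (with $h_0(0)=0$), $h_1(\phi)=e^{-\phi}-1$. Approximate solution. Let $K\ge 1$, $m\ge 3$, $T_0>0$, and let $n^{ref}$ be a $C^{m+1}$ function on $\overline{\mathbb R^3_+}$, bounded with bounded gradient and bounded from below by a positive constant. For $\varepsilon\in(0,1]$ let $$(n_a,u_a,\phi_a)(t,x)=\sum_{i=0}^K\varepsilon^i\Big((n^i,u^i,\phi^i)(t,x)+(N^i,U^i,\Phi^i)(t,y,x_3/\varepsilon)\Big)$$ be a boundary layer approximate solution of order $K$ on $[0,T_0]$ of the Euler–Poisson system $$\partial_t n+\operatorname{div}(nu)=0,\quad \partial_tu+u\cdot\nabla u+T^i\nabla\ln n=\nabla\phi,\quad \varepsilon^2\Delta\phi+e^{-\phi}=n,\qquad u_3|_{x_3=0}=0,\ \phi|_{x_3=0}=\phi_b(y).$$ This means the following. All profiles are $C^{m+1}$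 up to the boundary. $(n^0-n^{ref},u^0)\in C^0([0,T_0];H^{m+2K+3})$, $n^0$ is bounded from below by a positive constant, $\phi^0=-\ln n^0$, and $\partial_tn^0+\operatorname{div}(n^0u^0)=0$, $\partial_tu^0+u^0\cdot\nabla u^0+(T^i+1)\nabla\ln n^0=0$. For $1\le i\le K$, $(n^i,u^i,\phi^i)\in C^0([0,T_0];H^{m+3})\cap C^1([0,T_0];H^{m+2})$. The functions $N^i,U^i,\Phi^i$ of $(t,y,z)$ and their derivatives of order at most $m+1$ decay exponentially in $z\ge0$, uniformly in $(t,y)\in[0,T_0]\times\mathbb R^2$. Moreover $U^0=0$ and, with $\Gamma n^0(t,y)=n^0(t,y,0)$, $$N^0+\Gamma n^0=\Gamma n^0e^{\Phi^0/T^i},\qquad \partial_z^2\Phi^0+\Gamma n^0\big(e^{-\Phi^0}-e^{\Phi^0/T^i}\big)=0.$$ At $x_3=z=0$: $u^i_3+U^i_3=0$ for $0\le i\le K$, $\phi^0+\Phi^0=\phi_b$, and $\phi^i+\Phi^i=0$ for $1\le i\le K$. Finally the residuals of $(n_a,u_a,\phi_a)$ in the three equations are $\varepsilon^KR_n$, $\varepsilon^KR_u$,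 $\varepsilon^{K+1}R_\phi$, where for some $C$ and all small $\varepsilon$, $\sup_{[0,T_0]}\|\partial_x^\alpha R_{n,u,\phi}\|_{L^2}\le C\varepsilon^{-\alpha_3}$ for $|\alpha|\le m$. Linearized system. For $h\in\{h_0,h_1\}$, a background $(n,u,\phi)$ and sources $(r_n,r_u,r_\phi)$ consider, for $(\dot n,\dot u,\dot\phi)$, $$\begin{aligned} &\partial_t\dot n+(u_a+u)\cdot\nabla\dot n+(n_a+n)\operatorname{div}\dot u+\dot u\cdot\nabla(n_a+n)+\dot n\operatorname{div}(u_a+u)=r_n,\\ &\partial_t\dot u+(u_a+u)\cdot\nabla\dot u+\dot u\cdot\nabla u_a+T^i\Big(\frac{\nabla\dot n}{n_a+n}-\frac{\nabla n_a}{n_a}\,\frac{\dot n}{n_a+n}\Big)=\nabla\dot\phi+r_u,\\ &\varepsilon^2\Delta\dot\phi=\dot n+e^{-\phi_a}\dot\phi\,(1+h(\phi))+r_\phi,\qquad \dot u_3|_{x_3=0}=0,\quad\dot\phi|_{x_3=0}=0. \end{aligned}\tag{L}$$ Proposition. There is a function $C_1(M,A)\in[0,\infty)$, depending only on $T^i$,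 $M$ and $A$, such that the following holds for every approximate solution as above. The function $n_a$ is bounded from above uniformly in $\varepsilon\in(0,1]$, $t\in[0,T_0]$, $x\in\mathbb R^3_+$, and there is $\varepsilon_0\in(0,1]$, depending only on the approximate solution (and $T^i$), such that for every $M>0$ and every such upper bound $A$ of $n_a$ there is a constant $C_2<\infty$, depending only on the approximate solution, $T^i$, $M$ and $A$ (in particular neither $C_1$ nor $C_2$ depends on $\varepsilon$), with the following property. Let $\varepsilon\in(0,1]$ and $T\in(0,T_0]$, and suppose that $\varepsilon\le\varepsilon_0$ or $n_a\ge1/M$ on $[0,T]\times\mathbb R^3_+$. Let $h\in\{h_0,h_1\}$ and let $(n,u,\phi)$ be $C^1$ on $[0,T]\times\overline{\mathbb R^3_+}$ with $u_3|_{x_3=0}=0$ and $$n_a+n\ge\tfrac1M,\qquad e^{-\phi_a}(1+h(\phi))\ge\tfrac1M,\qquad|n|+|u|+|\phi|\le M\qquad\text{on }[0,T]\times\mathbb R^3_+ .$$ Let $(\dot n,\dot u,\dot\phi)$ be a strong solution of (L) on $[0,T]$: $\dot n,\dot u$ are $C^1$ and $\dot\phi$ is $C^2$ on $[0,T]\times\overline{\mathbb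 R^3_+}$, $\dot n,\dot u\in C^0([0,T];H^1)\cap C^1([0,T];L^2)$, $\dot\phi\in C^0([0,T];H^2)\cap C^1([0,T];H^1)$, and $r_\phi$ is $C^1$. Then for all $t\in[0,T]$ $$\begin{aligned} \big\|(\dot n,\dot u,\dot\phi,\varepsilon\nabla\dot\phi)(t)\big\|_{L^2}^2\le{}& C_1(M,A)\Big(\|(\dot n,\dot u)(0)\|_{L^2}^2+\|r_\phi(0)\|_{L^2}^2+\int_0^t\big\|(\varepsilon^{-1}r_\phi,\partial_tr_\phi,r_n,r_u)\big\|_{L^2}^2\,ds\Big)\\ &+C_2\int_0^t\Big(1+\|\nabla_{t,x}(n,u,\phi)\|_{L^\infty}+\varepsilon^{-1}\|n\|_{L^\infty}\Big)\big\|(\dot n,\dot u,\dot\phi,\varepsilon\nabla\dot\phi)\big\|_{L^2}^2\,ds, \end{aligned}$$ where all norms and integrals take values in $[0,\infty]$ (and $\infty\cdot 0=0$). -/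

import Mathlib

open MeasureTheory Set Filter Topology
open scoped ENNReal NNReal ContDiff

namespace QuasineutralEP

noncomputable section

/-! ### Half-space, fields, derivatives

Points of space are `x = (x 0, x 1, x 2)`; `y = (x 0, x 1)` is the tangential variable and `x 2` the
normal one. A field that is `C^k` up to the boundary of `[0,T] × {x 2 ≥ 0}` is represented by a `C^k`
extension to `ℝ × ℝ³`; only its values (and derivatives) over `[0,T] × {x 2 ≥ 0}` are ever used. -/

abbrev E3 := EuclideanSpace ℝ (Fin 3)

/-- A scalar field, as a function of time and space. -/
abbrev ScalarField := ℝ → E3 → ℝ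

/-- A vector field, by its three components. -/
abbrev VectorField := Fin 3 → ScalarField

def halfSpace : Set E3 := {x | 0 < x 2}

def closedHalfSpace : Set E3 := {x | 0 ≤ x 2}

/-- Lebesgue measure on the half-space. -/
def halfVol : Measure E3 := volume.restrict halfSpace

/-- Joint `C^k` regularity in `(t, x)`. -/
def IsCk (k : ℕ) (f : ScalarField) : Prop :=
  ContDiff ℝ k (fun p : ℝ × E3 => f p.1 p.2)

/-- The partial derivative `∂_i` of a function of `x`. -/
def pd (i : Fin 3) (g : E3 → ℝ) : E3 → ℝ :=
  fun x => fderiv ℝ g x (EuclideanSpace.single i 1)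

/-- The iterated partial derivative `∂^α`. -/
def pdMulti (α : Fin 3 → ℕ) (g : E3 → ℝ) : E3 → ℝ :=
  (pd 0)^[α 0] ((pd 1)^[α 1] ((pd 2)^[α 2] g))

def dt (f : ScalarField) : ScalarField := fun t x => deriv (fun s => f s x) t

def dx (i : Fin 3) (f : ScalarField) : ScalarField := fun t => pd i (f t)

def div (v : VectorField) : ScalarField := fun t x => ∑ j, dx j (v j) t x

def laplacian (f : ScalarField) : ScalarField := fun t x => ∑ j, dx j (dx j f) t x

/-- The transport term `v · ∇ f`. -/
def adv (v : VectorField) (f : ScalarField) : ScalarField :=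
  fun t x => ∑ j, v j t x * dx j f t x

/-! ### Sobolev regularity on the half-space -/

/-- `w` is the weak derivative `∂^α g` on the open half-space. -/
def HasWeakDeriv (α : Fin 3 → ℕ) (g w : E3 → ℝ) : Prop :=
  ∀ ψ : E3 → ℝ, ContDiff ℝ ∞ ψ → HasCompactSupport ψ → tsupport ψ ⊆ halfSpace →
    ∫ x, g x * pdMulti α ψ x ∂halfVol = (-1) ^ (∑ i, α i) * ∫ x, w x * ψ x ∂halfVol

/-- `f ∈ C⁰([0,T]; H^s)`: all weak space derivatives of order at most `s` lie in `L²` and depend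
continuously on time in `L²`. -/
def ContSobolev (s : ℕ) (T : ℝ) (f : ScalarField) : Prop :=
  ∀ α : Fin 3 → ℕ, ∑ i, α i ≤ s → ∃ w : ScalarField,
    (∀ t ∈ Icc 0 T, MemLp (w t) 2 halfVol ∧ HasWeakDeriv α (f t) (w t)) ∧
    ∀ t ∈ Icc 0 T, Tendsto (fun τ => eLpNorm (w τ - w t) 2 halfVol) (𝓝[Icc 0 T] t) (𝓝 0)

/-! ### Norms at a fixed time, with values in `[0, ∞]` -/

/-- `‖g‖²_{L²(ℝ³₊)}`. -/
def l2sq (g : E3 → ℝ) : ℝ≥0∞ := eLpNorm g 2 halfVol ^ 2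

/-- `‖g‖_{L^∞(ℝ³₊)}`. -/
def linf (g : E3 → ℝ) : ℝ≥0∞ := eLpNorm g ⊤ halfVol

/-- `‖∇_{t,x} f(t)‖_{L^∞}` for a scalar field. -/
def gradLinf (f : ScalarField) (t : ℝ) : ℝ≥0∞ := linf (dt f t) + ∑ j, linf (dx j f t)

/-- `‖∇_{t,x}(n,u,φ)(t)‖_{L^∞}`. -/
def gradLinfAll (n : ScalarField) (u : VectorField) (φ : ScalarField) (t : ℝ) : ℝ≥0∞ :=
  gradLinf n t + ∑ j, gradLinf (u j) t + gradLinf φ t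

/-- `‖(ṅ, u̇, φ̇, ε∇φ̇)(t)‖²_{L²}`. -/
def energySq (ε : ℝ) (n : ScalarField) (u : VectorField) (φ : ScalarField) (t : ℝ) : ℝ≥0∞ :=
  l2sq (n t) + ∑ j, l2sq (u j t) + l2sq (φ t) + ∑ j, l2sq (fun x => ε * dx j φ t x)

/-- `‖(ε⁻¹ r_φ, ∂_t r_φ, r_n, r_u)(t)‖²_{L²}`. -/
def sourceSq (ε : ℝ) (rn : ScalarField) (ru : VectorField) (rφ : ScalarField) (t : ℝ) : ℝ≥0∞ :=
  l2sq (fun x => ε⁻¹ * rφ t x) + l2sq (dt rφ t) + l2sq (rn t) + ∑ j, l2sq (ru j t)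

/-! ### The boundary layer approximate solution -/

/-- The coefficients of a two-scale expansion: interior profiles, functions of `(t, x)`, and boundary
layer profiles, functions of `(t, y, z)` with `(y, z)` stored as a point of `E3`. -/
structure Profiles where
  n : ℕ → ScalarField
  u : ℕ → VectorField
  φ : ℕ → ScalarField
  N : ℕ → ScalarField
  U : ℕ → VectorField
  Φ : ℕ → ScalarField

/-- `(y, x₃) ↦ (y, x₃ / ε)`. -/
def stretch (ε : ℝ) (x : E3) : E3 := !₂[x 0, x 1, x 2 / ε]

/-- `∑_{i ≤ K} ε^i (f^i(t,x) + F^i(t, y, x₃/ε))`. -/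
def twoScale (K : ℕ) (f F : ℕ → ScalarField) (ε : ℝ) : ScalarField :=
  fun t x => ∑ i ∈ Finset.range (K + 1), ε ^ i * (f i t x + F i t (stretch ε x))

namespace Profiles

def na (p : Profiles) (K : ℕ) (ε : ℝ) : ScalarField := twoScale K p.n p.N ε

def ua (p : Profiles) (K : ℕ) (ε : ℝ) : VectorField :=
  fun j => twoScale K (fun i => p.u i j) (fun i => p.U i j) ε

def φa (p : Profiles) (K : ℕ) (ε : ℝ) : ScalarField := twoScale K p.φ p.Φ ε

end Profiles

/-- A boundary layer profile decays exponentially in the last variable, uniformly on `[0,T] × ℝ²`,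
together with its derivatives up to order `k`. -/
def ExpDecay (k : ℕ) (T : ℝ) (F : ScalarField) : Prop :=
  ∀ j ≤ k, ∃ C γ : ℝ, 0 < γ ∧ ∀ t ∈ Icc 0 T, ∀ x ∈ closedHalfSpace,
    ‖iteratedFDeriv ℝ j (fun p : ℝ × E3 => F p.1 p.2) (t, x)‖ ≤ C * Real.exp (-γ * x 2)

/-! Left minus right hand sides of the isothermal Euler-Poisson system
`∂_t n + div (n u) = 0`, `∂_t u + u·∇u + Tᵢ ∇ ln n = ∇φ`, `ε² Δφ + e^{-φ} = n`. -/

def massResidual (n : ScalarField) (u : VectorField) : ScalarField :=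
  fun t x => dt n t x + div (fun j => n * u j) t x

def momentumResidual (Ti : ℝ) (n : ScalarField) (u : VectorField) (φ : ScalarField) : VectorField :=
  fun j t x => dt (u j) t x + adv u (u j) t x + Ti * (dx j n t x / n t x) - dx j φ t x

def poissonResidual (ε : ℝ) (n φ : ScalarField) : ScalarField :=
  fun t x => ε ^ 2 * laplacian φ t x + Real.exp (-φ t x) - n t x

/-- `R^ε = ε^k R` where, as `ε → 0`, `sup_{[0,T]} ‖∂^α R‖_{L²} ≤ C ε^{-α₃}` for `|α| ≤ m`. -/
def IsRemainder (m k : ℕ) (T : ℝ) (R : ℝ → ScalarField) : Prop :=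
  ∃ C ε₁ : ℝ, 0 < ε₁ ∧ ∀ ε ∈ Ioc 0 ε₁, ∀ t ∈ Icc 0 T, ∀ α : Fin 3 → ℕ, ∑ i, α i ≤ m →
    ∃ w : E3 → ℝ, HasWeakDeriv α (R ε t) w ∧ MemLp w 2 halfVol ∧
      eLpNorm w 2 halfVol ≤ ENNReal.ofReal (C * ε ^ k / ε ^ α 2)

/-- `p` is the collection of profiles of a boundary layer approximate solution of order `K` on `[0,T]`
of the Euler-Poisson system with ion temperature `Ti`, non-penetration condition for the velocity and
boundary potential `φb`, with leading density `n⁰` close to the reference density `nref`. -/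
structure IsApproxSolution (Ti : ℝ) (K m : ℕ) (T : ℝ) (nref φb : E3 → ℝ) (p : Profiles) : Prop where
  /-- The reference density is regular, bounded with bounded gradient, and bounded from below. -/
  nref_reg : ContDiff ℝ (m + 1 : ℕ) nref
  nref_bdd : ∃ B : ℝ, ∀ x ∈ closedHalfSpace, |nref x| ≤ B ∧ ∀ j, |pd j nref x| ≤ B
  nref_pos : ∃ c : ℝ, 0 < c ∧ ∀ x ∈ closedHalfSpace, c ≤ nref x
  /-- Classical regularity of all profiles. -/
  n_reg : ∀ i ≤ K, IsCk (m + 1) (p.n i) ∧ IsCk (m + 1) (p.N i)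
  u_reg : ∀ i ≤ K, ∀ j, IsCk (m + 1) (p.u i j) ∧ IsCk (m + 1) (p.U i j)
  φ_reg : ∀ i ≤ K, IsCk (m + 1) (p.φ i) ∧ IsCk (m + 1) (p.Φ i)
  /-- Leading order interior profile: no vacuum, Sobolev regularity, limit Euler system. -/
  n0_pos : ∃ c : ℝ, 0 < c ∧ ∀ t ∈ Icc 0 T, ∀ x ∈ closedHalfSpace, c ≤ p.n 0 t x
  n0_sob : ContSobolev (m + 2 * K + 3) T (fun t x => p.n 0 t x - nref x)
  u0_sob : ∀ j, ContSobolev (m + 2 * K + 3) T (p.u 0 j)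
  φ0_eq : ∀ t ∈ Icc 0 T, ∀ x ∈ closedHalfSpace, p.φ 0 t x = -Real.log (p.n 0 t x)
  euler_mass : ∀ t ∈ Icc 0 T, ∀ x ∈ halfSpace, massResidual (p.n 0) (p.u 0) t x = 0
  euler_momentum : ∀ t ∈ Icc 0 T, ∀ x ∈ halfSpace, ∀ j,
    dt (p.u 0 j) t x + adv (p.u 0) (p.u 0 j) t x
      + (Ti + 1) * (dx j (p.n 0) t x / p.n 0 t x) = 0
  /-- Next interior profiles: in `C⁰([0,T]; H^{m+3}) ∩ C¹([0,T]; H^{m+2})`. -/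
  n_sob : ∀ i, 1 ≤ i → i ≤ K →
    ContSobolev (m + 3) T (p.n i) ∧ ContSobolev (m + 2) T (dt (p.n i))
  u_sob : ∀ i, 1 ≤ i → i ≤ K → ∀ j,
    ContSobolev (m + 3) T (p.u i j) ∧ ContSobolev (m + 2) T (dt (p.u i j))
  φ_sob : ∀ i, 1 ≤ i → i ≤ K →
    ContSobolev (m + 3) T (p.φ i) ∧ ContSobolev (m + 2) T (dt (p.φ i))
  /-- Boundary layer profiles: exponential decay. -/
  layer_decay : ∀ i ≤ K, ExpDecay (m + 1) T (p.N i) ∧ (∀ j, ExpDecay (m + 1) T (p.U i j)) ∧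
    ExpDecay (m + 1) T (p.Φ i)
  /-- Leading boundary layer: none for the velocity, and a nonlinear layer for the potential and the
  density, with `Γn⁰` the trace of `n⁰`. -/
  U0_eq : ∀ t ∈ Icc 0 T, ∀ x ∈ closedHalfSpace, ∀ j, p.U 0 j t x = 0
  N0_eq : ∀ t ∈ Icc 0 T, ∀ x ∈ closedHalfSpace,
    p.N 0 t x + p.n 0 t !₂[x 0, x 1, 0] = p.n 0 t !₂[x 0, x 1, 0] * Real.exp (p.Φ 0 t x / Ti)
  Φ0_eq : ∀ t ∈ Icc 0 T, ∀ x ∈ halfSpace,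
    dx 2 (dx 2 (p.Φ 0)) t x
      + p.n 0 t !₂[x 0, x 1, 0] * (Real.exp (-p.Φ 0 t x) - Real.exp (p.Φ 0 t x / Ti)) = 0
  /-- Boundary conditions. -/
  bc_u : ∀ i ≤ K, ∀ t ∈ Icc 0 T, ∀ x : E3, x 2 = 0 → p.u i 2 t x + p.U i 2 t x = 0
  bc_φ0 : ∀ t ∈ Icc 0 T, ∀ x : E3, x 2 = 0 → p.φ 0 t x + p.Φ 0 t x = φb x
  bc_φ : ∀ i, 1 ≤ i → i ≤ K → ∀ t ∈ Icc 0 T, ∀ x : E3, x 2 = 0 → p.φ i t x + p.Φ i t x = 0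
  /-- The expansion solves the Euler-Poisson system up to small remainders. -/
  rem_n : IsRemainder m K T (fun ε => massResidual (p.na K ε) (p.ua K ε))
  rem_u : ∀ j, IsRemainder m K T
    (fun ε => momentumResidual Ti (p.na K ε) (p.ua K ε) (p.φa K ε) j)
  rem_φ : IsRemainder m (K + 1) T (fun ε => poissonResidual ε (p.na K ε) (p.φa K ε))

/-! ### The linearized system -/

/-- `h₀(φ) = -(e^{-φ} - 1 + φ)/φ`, with `h₀(0) = 0`, its limit at `0`. -/
def h0 (φ : ℝ) : ℝ := -((Real.exp (-φ) - 1 + φ) / φ)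

/-- `h₁(φ) = e^{-φ} - 1`. -/
def h1 (φ : ℝ) : ℝ := Real.exp (-φ) - 1

/-- The assumptions on the perturbation `(n, u, φ)` of `(na, ua, φa)` around which one linearizes. -/
structure IsAdmissible (M T : ℝ) (h : ℝ → ℝ) (na φa : ScalarField)
    (n : ScalarField) (u : VectorField) (φ : ScalarField) : Prop where
  n_reg : IsCk 1 n
  u_reg : ∀ j, IsCk 1 (u j)
  φ_reg : IsCk 1 φ
  bc_u : ∀ t ∈ Icc 0 T, ∀ x : E3, x 2 = 0 → u 2 t x = 0
  n_low : ∀ t ∈ Icc 0 T, ∀ x ∈ halfSpace, 1 / M ≤ na t x + n t x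
  φ_low : ∀ t ∈ Icc 0 T, ∀ x ∈ halfSpace, 1 / M ≤ Real.exp (-φa t x) * (1 + h (φ t x))
  bdd : ∀ t ∈ Icc 0 T, ∀ x ∈ halfSpace,
    |n t x| + Real.sqrt (∑ j, u j t x ^ 2) + |φ t x| ≤ M

/-- `(ṅ, u̇, φ̇)` is a strong solution on `[0,T]` of the system linearized around
`(na + n, ua + u, φa + φ)`, with sources `(rn, ru, rφ)` and homogeneous boundary conditions. -/
structure IsLinearizedSolution (Ti ε T : ℝ) (h : ℝ → ℝ)
    (na : ScalarField) (ua : VectorField) (φa : ScalarField)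
    (n : ScalarField) (u : VectorField) (φ : ScalarField)
    (n' : ScalarField) (u' : VectorField) (φ' : ScalarField)
    (rn : ScalarField) (ru : VectorField) (rφ : ScalarField) : Prop where
  n_reg : IsCk 1 n' ∧ ContSobolev 1 T n' ∧ ContSobolev 0 T (dt n')
  u_reg : ∀ j, IsCk 1 (u' j) ∧ ContSobolev 1 T (u' j) ∧ ContSobolev 0 T (dt (u' j))
  φ_reg : IsCk 2 φ' ∧ ContSobolev 2 T φ' ∧ ContSobolev 1 T (dt φ')
  rφ_reg : IsCk 1 rφ
  mass : ∀ t ∈ Icc 0 T, ∀ x ∈ halfSpace,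
    dt n' t x + adv (ua + u) n' t x + (na t x + n t x) * div u' t x + adv u' (na + n) t x
      + n' t x * div (ua + u) t x = rn t x
  momentum : ∀ t ∈ Icc 0 T, ∀ x ∈ halfSpace, ∀ j,
    dt (u' j) t x + adv (ua + u) (u' j) t x + adv u' (ua j) t x
      + Ti * (dx j n' t x / (na t x + n t x)
          - dx j na t x / na t x * (n' t x / (na t x + n t x)))
      = dx j φ' t x + ru j t x
  poisson : ∀ t ∈ Icc 0 T, ∀ x ∈ halfSpace,
    ε ^ 2 * laplacian φ' t x
      = n' t x + Real.exp (-φa t x) * φ' t x * (1 + h (φ t x)) + rφ t x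
  bc_u : ∀ t ∈ Icc 0 T, ∀ x : E3, x 2 = 0 → u' 2 t x = 0
  bc_φ : ∀ t ∈ Icc 0 T, ∀ x : E3, x 2 = 0 → φ' t x = 0

end

end QuasineutralEP

open QuasineutralEP

namespace QuasineutralEP

noncomputable section

/-! ### Divergence theorem on the half-space -/

/-! The estimate is a weighted energy identity, arranged so that no coefficient of size `1/ε`
survives. Write N = n_a + n, V = u_a + u, g = e^{-φ_a}(1 + h(φ)), and (ρ, v, ψ, r) for the unknowns
and the Poisson source. Multiply the momentum equation by N v, the mass equation by T^i ρ/N − ψ and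
the Poisson equation by (∂_t + V·∇)ψ. For e = N|v|²/2 + T^i ρ²/(2N) − (ρ + r)ψ − ε²|∇ψ|²/2 − gψ²/2
this gives ∂_t e = div(flux) + production (`EnergyRegular.energy_balance`). The part of e involving
ψ is stationary in ψ because of the Poisson equation, so the terms in ∂_tψ form a divergence and the
Poisson equation is never differentiated. Testing that equation with ψ turns e, up to a divergence,
into a coercive density (`EnergyRegular.posDensity_eq`).

The production is quadratic, and its dangerous coefficients contain ∂_3 of the layers, of size 1/ε.
Three mechanisms control them (`energyProduction_le_of_bounds`). In ∂_t + V·∇ applied to N or g, the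
normal velocity vanishes on the boundary, so |V_3| ≤ C d x_3, while x_3 ∂_3 of a profile in x_3/ε is
bounded by exponential decay. In ∇n_a/n_a − ∇N/N the singular gradient meets a factor n, which
produces ‖n‖_{L^∞}/ε. In v·∇u_a nothing is singular because the leading velocity layer vanishes.
Here d is the full weight 1 + ‖∇_{t,x}(n,u,φ)‖_{L^∞} + ‖n‖_{L^∞}/ε. The required bounds on the
background come from a Sobolev embedding for interior profiles, the limit equations for leading time
derivatives, and scaling for layers; for small ε the lower bound on n_a comes from the explicit
leading layer (`IsApproxSolution.n0_layer_pos`).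

Source terms are split by Young's inequality with a fixed coefficient on the source, and all large
constants are put on the energy. Thus C₁ sees only coercivity and the initial bound, hence T^i, M
and A, while C₂ absorbs the profile bounds.

Integration over the unbounded half-space uses cutoffs of radius R (`lintegral_le_of_balance`): the
fluxes are tangent to the boundary and bounded in L¹ uniformly in time, so the cutoff error is
O(1/R). No Gronwall argument is needed, as the energy integral stays on the right-hand side. -/

lemma measurableSet_halfSpace : MeasurableSet halfSpace :=
  measurableSet_lt measurable_const (by fun_prop)

lemma isOpen_halfSpace : IsOpen halfSpace :=
  isOpen_lt continuous_const (by fun_prop)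

lemma isClosed_closedHalfSpace : IsClosed closedHalfSpace :=
  isClosed_le continuous_const (by fun_prop)

lemma halfSpace_subset_closedHalfSpace : halfSpace ⊆ closedHalfSpace :=
  fun x (hx : 0 < x 2) => hx.le

instance : SigmaFinite halfVol := by
  unfold halfVol; infer_instance

/-- `(Fin 3 → ℝ) ≃L E3`. -/
abbrev toE3 : (Fin 3 → ℝ) ≃L[ℝ] E3 := (EuclideanSpace.equiv (Fin 3) ℝ).symm

lemma measurePreserving_toE3 : MeasurePreserving toE3 volume volume :=
  PiLp.volume_preserving_toLp (Fin 3)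

lemma abs_apply_le_norm (x : E3) (j : Fin 3) : |x j| ≤ ‖x‖ := by
  simpa using PiLp.norm_apply_le x j

lemma pd_eq_zero_of_eventuallyEq {f : E3 → ℝ} {x : E3} (h : f =ᶠ[𝓝 x] fun _ => 0) (j : Fin 3) :
    pd j f x = 0 := by
  simp [pd, h.fderiv_eq]

lemma pd_continuousAt {f : E3 → ℝ} {x : E3} (h : ContDiffAt ℝ 1 f x) (j : Fin 3) :
    ContinuousAt (pd j f) x := by
  have := (h.fderiv_right (m := 0) (by norm_num)).continuousAt
  exact this.clm_apply continuousAt_const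

/-- The box [-L, L]² × [0, L] has five faces at distance at least L from the origin, where the field
vanishes; on the sixth, at height 0, the normal component vanishes by assumption. The divergence
theorem on the box has no other boundary contribution. -/
theorem integral_halfSpace_div_eq_zero (F : Fin 3 → E3 → ℝ)
    (hF : ∀ j, ∀ x ∈ closedHalfSpace, ContDiffAt ℝ 1 (F j) x)
    {L : ℝ} (hL : 0 < L) (hs : ∀ j, ∀ x, L ≤ ‖x‖ → F j x = 0)
    (h0 : ∀ x : E3, x 2 = 0 → F 2 x = 0) :
    ∫ x, ∑ j, pd j (F j) x ∂halfVol = 0 := by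
  set a : Fin 3 → ℝ := ![-L, -L, 0] with ha
  set b : Fin 3 → ℝ := ![L, L, L] with hb
  have hab : a ≤ b := by
    intro i; fin_cases i <;> simp [a, b] <;> linarith
  have hpd0 : ∀ j, ∀ x, L < ‖x‖ → pd j (F j) x = 0 := by
    intro j x hx
    apply pd_eq_zero_of_eventuallyEq
    filter_upwards [(isOpen_lt continuous_const continuous_norm).mem_nhds hx] with z hz
    exact hs j z (le_of_lt hz)
  have hmem : ∀ y ∈ Icc a b, toE3 y ∈ closedHalfSpace := by
    intro y hy
    have := hy.1 2
    simpa [a, closedHalfSpace] using this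
  have hcont : ∀ j, ContinuousOn (fun y => pd j (F j) (toE3 y)) (Icc a b) := by
    intro j y hy
    exact ((pd_continuousAt (hF j _ (hmem y hy)) j).comp
      (toE3.continuous.continuousAt)).continuousWithinAt
  have key := integral_divergence_of_hasFDerivAt_off_countable a b hab
    (fun y j => F j (toE3 y))
    (fun y => ContinuousLinearMap.pi fun j => (fderiv ℝ (F j) (toE3 y)).comp
      (toE3 : (Fin 3 → ℝ) →L[ℝ] E3)) ∅ countable_empty
    (by
      refine continuousOn_pi.2 fun j y hy => ?_
      exact ((hF j _ (hmem y hy)).continuousAt.comp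
        (toE3.continuous.continuousAt)).continuousWithinAt)
    (by
      intro y hy
      refine hasFDerivAt_pi.2 fun j => ?_
      have hy' : y ∈ Icc a b := by
        refine ⟨fun i => ?_, fun i => ?_⟩
        · exact le_of_lt (hy.1 i (mem_univ i)).1
        · exact le_of_lt (hy.1 i (mem_univ i)).2
      exact (((hF j _ (hmem y hy')).differentiableAt (by norm_num)).hasFDerivAt).comp y
        (toE3 : (Fin 3 → ℝ) →L[ℝ] E3).hasFDerivAt)
    (by
      have : ContinuousOn (fun y => ∑ j, pd j (F j) (toE3 y)) (Icc a b) :=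
        continuousOn_finsetSum _ fun j _ => hcont j
      exact this.integrableOn_compact isCompact_Icc)
  have hface : ∀ (i : Fin 3) (z : Fin 2 → ℝ),
      F i (toE3 (i.insertNth (b i) z)) = 0 ∧ F i (toE3 (i.insertNth (a i) z)) = 0 := by
    intro i z
    have hbig : ∀ c : ℝ, |c| = L → F i (toE3 (i.insertNth c z)) = 0 := by
      intro c hc
      apply hs
      have := abs_apply_le_norm (toE3 (i.insertNth c z)) i
      simpa [hc] using this
    refine ⟨hbig _ ?_, ?_⟩
    · fin_cases i <;> simp [b, abs_of_pos hL]
    · fin_cases i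
      · exact hbig _ (by simp [a, abs_of_pos hL])
      · exact hbig _ (by simp [a, abs_of_pos hL])
      · exact h0 _ (by simp [a])
  have hzero : ∫ y in Icc a b, ∑ j, pd j (F j) (toE3 y) = 0 := by
    refine Eq.trans key ?_
    refine Finset.sum_eq_zero fun i _ => ?_
    simp only [(hface i _).1, (hface i _).2, integral_zero, sub_zero]
  have hmp := measurePreserving_toE3
  have hemb : MeasurableEmbedding toE3 := toE3.toHomeomorph.measurableEmbedding
  have h1 : ∫ x, ∑ j, pd j (F j) x ∂halfVol
      = ∫ y in toE3 ⁻¹' halfSpace, ∑ j, pd j (F j) (toE3 y) :=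
    (hmp.setIntegral_preimage_emb hemb _ _).symm
  rw [h1, ← hzero, ← integral_indicator (hemb.measurable measurableSet_halfSpace),
    ← integral_indicator measurableSet_Icc]
  apply integral_congr_ae
  -- The box contains its bottom face and the open half-space does not; that plane is a null set.
  have hnull : ∀ᵐ y : Fin 3 → ℝ, y 2 ≠ 0 := by
    have := Measure.ae_eval_ne (μ := fun _ : Fin 3 => (volume : Measure ℝ)) 2 0
    simpa [volume_pi] using this
  filter_upwards [hnull] with y hy
  by_cases hyI : y ∈ Icc a b
  · have h2 : y ∈ toE3 ⁻¹' halfSpace := by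
      have := hyI.1 2
      simp only [a] at this
      have h3 : 0 ≤ y 2 := by simpa using this
      exact lt_of_le_of_ne h3 (Ne.symm hy)
    rw [indicator_of_mem hyI, indicator_of_mem h2]
  · rw [indicator_of_notMem hyI]
    by_cases h2 : y ∈ toE3 ⁻¹' halfSpace
    · rw [indicator_of_mem h2]
      refine Finset.sum_eq_zero fun j _ => hpd0 j _ ?_
      by_contra hcon
      push Not at hcon
      apply hyI
      have hc : ∀ i, |y i| ≤ L := fun i => (abs_apply_le_norm (toE3 y) i).trans hcon
      have h3 : 0 ≤ y 2 := le_of_lt h2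
      refine ⟨fun i => ?_, fun i => ?_⟩
      · have := abs_le.1 (hc i)
        fin_cases i
        · simpa [a] using this.1
        · simpa [a] using this.1
        · simpa [a] using h3
      · have := abs_le.1 (hc i)
        fin_cases i <;> simpa [b] using this.2
    · rw [indicator_of_notMem h2]


/-! ### Fields of class `C¹` over `[0,T] × {x₃ ≥ 0}` and local conservation laws -/

/-- `f` is `C¹` near every point of `[0,T] × {x₃ ≥ 0}`. -/
def C1On (T : ℝ) (f : ScalarField) : Prop :=
  ∀ t ∈ Icc 0 T, ∀ x ∈ closedHalfSpace, ContDiffAt ℝ 1 (fun p : ℝ × E3 => f p.1 p.2) (t, x)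

lemma contDiffAt_slice_space {f : ScalarField} {t : ℝ} {x : E3} {k : WithTop ℕ∞}
    (h : ContDiffAt ℝ k (fun p : ℝ × E3 => f p.1 p.2) (t, x)) : ContDiffAt ℝ k (f t) x :=
  ContDiffAt.comp (g := fun p : ℝ × E3 => f p.1 p.2) (f := fun y : E3 => (t, y)) x h (by fun_prop)

lemma hasDerivAt_time {f : ScalarField} {t : ℝ} {x : E3}
    (h : DifferentiableAt ℝ (fun p : ℝ × E3 => f p.1 p.2) (t, x)) :
    HasDerivAt (fun s => f s x) (fderiv ℝ (fun p : ℝ × E3 => f p.1 p.2) (t, x) (1, 0)) t :=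
  HasFDerivAt.comp_hasDerivAt (l := fun p : ℝ × E3 => f p.1 p.2) (f := fun s : ℝ => (s, x)) t
    h.hasFDerivAt ((hasDerivAt_id t).prodMk (hasDerivAt_const t x))

lemma dt_eq_fderiv {f : ScalarField} {t : ℝ} {x : E3}
    (h : DifferentiableAt ℝ (fun p : ℝ × E3 => f p.1 p.2) (t, x)) :
    dt f t x = fderiv ℝ (fun p : ℝ × E3 => f p.1 p.2) (t, x) (1, 0) :=
  (hasDerivAt_time h).deriv

lemma dx_eq_fderiv {f : ScalarField} {t : ℝ} {x : E3}
    (h : DifferentiableAt ℝ (fun p : ℝ × E3 => f p.1 p.2) (t, x)) (j : Fin 3) :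
    dx j f t x = fderiv ℝ (fun p : ℝ × E3 => f p.1 p.2) (t, x) (0, EuclideanSpace.single j 1) := by
  have h1 : HasFDerivAt (fun y : E3 => (t, y)) (ContinuousLinearMap.inr ℝ ℝ E3) x :=
    hasFDerivAt_prodMk_right t x
  have h2 := HasFDerivAt.comp (g := fun p : ℝ × E3 => f p.1 p.2) x h.hasFDerivAt h1
  have h3 : fderiv ℝ (f t) x
      = (fderiv ℝ (fun p : ℝ × E3 => f p.1 p.2) (t, x)).comp (ContinuousLinearMap.inr ℝ ℝ E3) :=
    h2.fderiv
  simp [dx, pd, h3]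

lemma continuousAt_dt {f : ScalarField} {t : ℝ} {x : E3}
    (h : ContDiffAt ℝ 1 (fun p : ℝ × E3 => f p.1 p.2) (t, x)) :
    ContinuousAt (fun p : ℝ × E3 => dt f p.1 p.2) (t, x) := by
  have h1 := ((h.fderiv_right (m := 0) (by norm_num)).continuousAt).clm_apply
    (continuousAt_const (y := ((1 : ℝ), (0 : E3))))
  refine h1.congr ?_
  filter_upwards [h.eventually (by simp)] with q hq
  exact (dt_eq_fderiv (hq.differentiableAt (by norm_num))).symm

lemma isCompact_slab (L : ℝ) : IsCompact (closedHalfSpace ∩ Metric.closedBall (0 : E3) L) :=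
  (isCompact_closedBall _ _).inter_left isClosed_closedHalfSpace

lemma integrable_halfVol_of_continuousOn {f : E3 → ℝ} (hf : ContinuousOn f closedHalfSpace)
    {L : ℝ} (hs : ∀ x, L ≤ ‖x‖ → f x = 0) : Integrable f halfVol := by
  have h1 : IntegrableOn f (closedHalfSpace ∩ Metric.closedBall (0 : E3) L) :=
    (hf.mono inter_subset_left).integrableOn_compact (isCompact_slab L)
  refine h1.of_forall_sdiff_eq_zero measurableSet_halfSpace fun x hx => hs x ?_
  by_contra hcon
  push Not at hcon
  exact hx.2 ⟨halfSpace_subset_closedHalfSpace hx.1, by simpa using hcon.le⟩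

/-- `∫ χ e(t) - ∫ χ e(0)` is the time integral of `∫ χ ∂ₜe`. -/
theorem integral_cutoff_sub {T : ℝ} {e : ScalarField} (he : C1On T e) {χ : E3 → ℝ}
    (hχ : Continuous χ) {L : ℝ} (hs : ∀ x, L ≤ ‖x‖ → χ x = 0) {t : ℝ} (ht : t ∈ Icc 0 T) :
    ∫ x, χ x * e t x ∂halfVol - ∫ x, χ x * e 0 x ∂halfVol
      = ∫ s in 0..t, ∫ x, χ x * dt e s x ∂halfVol := by
  have hint : ∀ s ∈ Icc 0 T, Integrable (fun x => χ x * e s x) halfVol := fun s hs' =>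
    integrable_halfVol_of_continuousOn (L := L)
      (fun x hx => (hχ.continuousAt.mul
        (contDiffAt_slice_space (he s hs' x hx)).continuousAt).continuousWithinAt)
      (fun x hx => by simp [hs x hx])
  have h0 : (0 : ℝ) ∈ Icc 0 T := ⟨le_rfl, ht.1.trans ht.2⟩
  rw [← integral_sub (hint t ht) (hint 0 h0)]
  have hft : ∀ x ∈ halfSpace, χ x * e t x - χ x * e 0 x = ∫ s in 0..t, χ x * dt e s x := by
    intro x hx
    have hx' := halfSpace_subset_closedHalfSpace hx
    have hsub : uIcc 0 t ⊆ Icc 0 T := by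
      rw [uIcc_of_le ht.1]; exact Icc_subset_Icc_right ht.2
    rw [intervalIntegral.integral_const_mul,
      intervalIntegral.integral_eq_sub_of_hasDerivAt (f := fun s => e s x) (f' := fun s => dt e s x),
      mul_sub]
    · intro s hs'
      have := hasDerivAt_time ((he s (hsub hs') x hx').differentiableAt (by norm_num))
      exact this.differentiableAt.hasDerivAt
    · apply ContinuousOn.intervalIntegrable
      intro s hs'
      exact (ContinuousAt.comp (f := fun s : ℝ => (s, x))
        (continuousAt_dt (he s (hsub hs') x hx')) (by fun_prop)).continuousWithinAt
  have h1 : ∫ x, (χ x * e t x - χ x * e 0 x) ∂halfVol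
      = ∫ x, ∫ s in 0..t, χ x * dt e s x ∂volume ∂halfVol :=
    setIntegral_congr_fun measurableSet_halfSpace hft
  rw [h1]
  simp only [intervalIntegral.integral_of_le ht.1]
  rw [integral_integral_swap]
  -- Fubini is justified by continuity on a compact product; outside it the cutoff makes the
  -- integrand zero.
  have h2 : IntegrableOn (Function.uncurry fun (x : E3) (s : ℝ) => χ x * dt e s x)
      ((closedHalfSpace ∩ Metric.closedBall (0 : E3) L) ×ˢ Icc 0 T) := by
    apply ContinuousOn.integrableOn_compact ((isCompact_slab L).prod isCompact_Icc)
    rintro ⟨x, s⟩ ⟨hx, hs'⟩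
    refine ContinuousAt.continuousWithinAt ?_
    exact (hχ.continuousAt.comp continuousAt_fst).mul
      (ContinuousAt.comp (f := fun q : E3 × ℝ => (q.2, q.1)) (continuousAt_dt (he s hs' x hx.1))
        (by fun_prop))
  rw [halfVol, Measure.prod_restrict]
  refine h2.of_forall_sdiff_eq_zero (measurableSet_halfSpace.prod measurableSet_Ioc) ?_
  rintro ⟨x, s⟩ ⟨⟨hx, hs'⟩, hn⟩
  have : L ≤ ‖x‖ := by
    by_contra hcon
    push Not at hcon
    exact hn ⟨⟨halfSpace_subset_closedHalfSpace hx, by simpa using hcon.le⟩,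
      ⟨hs'.1.le, hs'.2.trans ht.2⟩⟩
  simp [hs x this]

lemma pd_mul {f g : E3 → ℝ} {x : E3} (hf : DifferentiableAt ℝ f x) (hg : DifferentiableAt ℝ g x)
    (j : Fin 3) : pd j (fun y => f y * g y) x = pd j f x * g x + f x * pd j g x := by
  simp only [pd]
  rw [fderiv_fun_mul hf hg]
  simp
  ring

/-- Integration by parts against a cutoff, for a flux tangent to the boundary. -/
theorem integral_cutoff_div {F : Fin 3 → E3 → ℝ}
    (hF : ∀ j, ∀ x ∈ closedHalfSpace, ContDiffAt ℝ 1 (F j) x) (h0 : ∀ x : E3, x 2 = 0 → F 2 x = 0)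
    {χ : E3 → ℝ} (hχ : ContDiff ℝ 1 χ) {L : ℝ} (hL : 0 < L) (hs : ∀ x, L ≤ ‖x‖ → χ x = 0) :
    ∫ x, χ x * ∑ j, pd j (F j) x ∂halfVol = -∫ x, ∑ j, pd j χ x * F j x ∂halfVol := by
  have h1 := integral_halfSpace_div_eq_zero (fun j x => χ x * F j x)
    (fun j x hx => hχ.contDiffAt.mul (hF j x hx)) hL (fun j x hx => by simp [hs x hx])
    (fun x hx => by simp [h0 x hx])
  -- The radius is enlarged to `L + 1` because a vanishing derivative is read off from vanishing on
  -- an open neighbourhood.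
  have hpχ : ∀ j, ∀ x, L + 1 ≤ ‖x‖ → pd j χ x = 0 := by
    intro j x hx
    apply pd_eq_zero_of_eventuallyEq
    filter_upwards [(isOpen_lt continuous_const continuous_norm).mem_nhds
      (show L < ‖x‖ by linarith)] with z hz
    exact hs z (le_of_lt hz)
  have e1 : ∀ x ∈ halfSpace, ∑ j, pd j (fun x => χ x * F j x) x
      = χ x * ∑ j, pd j (F j) x + ∑ j, pd j χ x * F j x := by
    intro x hx
    rw [Finset.mul_sum, ← Finset.sum_add_distrib]
    refine Finset.sum_congr rfl fun j _ => ?_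
    rw [pd_mul (hχ.differentiable (by norm_num) x)
      ((hF j x (halfSpace_subset_closedHalfSpace hx)).differentiableAt (by norm_num))]
    ring
  have h2 : ∫ x, (χ x * ∑ j, pd j (F j) x + ∑ j, pd j χ x * F j x) ∂halfVol = 0 := by
    rw [← h1]
    exact (setIntegral_congr_fun measurableSet_halfSpace e1).symm
  rw [integral_add] at h2
  · linarith
  · refine integrable_halfVol_of_continuousOn (L := L) (fun x hx => ?_)
      (fun x hx => by simp [hs x hx])
    refine ContinuousAt.continuousWithinAt (hχ.continuous.continuousAt.mul ?_)
    exact tendsto_finsetSum _ fun j _ => (pd_continuousAt (hF j x hx) j)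
  · refine integrable_halfVol_of_continuousOn (L := L + 1) (fun x hx => ?_)
      (fun x hx => Finset.sum_eq_zero fun j _ => by simp [hpχ j x hx])
    refine ContinuousAt.continuousWithinAt ?_
    exact tendsto_finsetSum _ fun j _ => (pd_continuousAt hχ.contDiffAt j).mul
      (hF j x hx).continuousAt

instance : IsLocallyFiniteMeasure halfVol := by
  unfold halfVol; infer_instance

/-! ### Regularity of derivatives -/

lemma IsCk.mono {k l : ℕ} {f : ScalarField} (h : IsCk k f) (hl : l ≤ k) : IsCk l f :=
  ContDiff.of_le h (by exact_mod_cast hl)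

lemma IsCk.differentiable {k : ℕ} {f : ScalarField} (h : IsCk (k + 1) f) :
    Differentiable ℝ (fun p : ℝ × E3 => f p.1 p.2) :=
  ContDiff.differentiable h (by simp)

lemma IsCk.dx {k : ℕ} {f : ScalarField} (h : IsCk (k + 1) f) (j : Fin 3) : IsCk k (dx j f) := by
  have h1 : ContDiff ℝ k (fderiv ℝ (fun p : ℝ × E3 => f p.1 p.2)) :=
    ContDiff.fderiv_right (n := (k + 1 : ℕ)) h (by simp)
  have h2 := h1.clm_apply (contDiff_const (c := ((0 : ℝ), (EuclideanSpace.single j 1 : E3))))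
  have h3 : (fun p : ℝ × E3 => QuasineutralEP.dx j f p.1 p.2) = _ :=
    funext fun p => dx_eq_fderiv (h.differentiable p) j
  unfold IsCk
  rw [h3]
  exact h2

lemma IsCk.dt {k : ℕ} {f : ScalarField} (h : IsCk (k + 1) f) : IsCk k (dt f) := by
  have h1 : ContDiff ℝ k (fderiv ℝ (fun p : ℝ × E3 => f p.1 p.2)) :=
    ContDiff.fderiv_right (n := (k + 1 : ℕ)) h (by simp)
  have h2 := h1.clm_apply (contDiff_const (c := ((1 : ℝ), (0 : E3))))
  have h3 : (fun p : ℝ × E3 => QuasineutralEP.dt f p.1 p.2) = _ :=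
    funext fun p => dt_eq_fderiv (h.differentiable p)
  unfold IsCk
  rw [h3]
  exact h2

lemma IsCk.slice {k : ℕ} {f : ScalarField} (h : IsCk k f) (t : ℝ) : ContDiff ℝ k (f t) :=
  ContDiff.comp (g := fun p : ℝ × E3 => f p.1 p.2) h (contDiff_prodMk_right t)

lemma IsCk.continuous {k : ℕ} {f : ScalarField} (h : IsCk k f) :
    Continuous (fun p : ℝ × E3 => f p.1 p.2) := ContDiff.continuous h

/-! ### Weak and classical derivatives -/

lemma contDiff_pd {ψ : E3 → ℝ} (h : ContDiff ℝ ∞ ψ) (i : Fin 3) : ContDiff ℝ ∞ (pd i ψ) :=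
  ((contDiff_infty_iff_fderiv.1 h).2).clm_apply contDiff_const

lemma pd_comm {ψ : E3 → ℝ} (h : ContDiff ℝ 2 ψ) (i j : Fin 3) :
    pd i (pd j ψ) = pd j (pd i ψ) := by
  have h1 : Differentiable ℝ (fderiv ℝ ψ) :=
    (h.fderiv_right (m := 1) (by norm_num)).differentiable (by norm_num)
  have h2 : ∀ (a b : Fin 3) (x : E3), pd a (pd b ψ) x
      = fderiv ℝ (fderiv ℝ ψ) x (EuclideanSpace.single a 1) (EuclideanSpace.single b 1) := by
    intro a b x
    change fderiv ℝ (fun y => fderiv ℝ ψ y (EuclideanSpace.single b 1)) x _ = _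
    rw [fderiv_clm_apply (h1 x) (by fun_prop)]
    simp
  funext x
  rw [h2, h2]
  exact (h.contDiffAt.isSymmSndFDerivAt (by simp)) _ _

lemma contDiff_pd_iterate {ψ : E3 → ℝ} (h : ContDiff ℝ ∞ ψ) (i : Fin 3) (n : ℕ) :
    ContDiff ℝ ∞ ((pd i)^[n] ψ) := by
  induction n with
  | zero => exact h
  | succ n ih => rw [Function.iterate_succ_apply']; exact contDiff_pd ih i

lemma pd_iterate_comm {ψ : E3 → ℝ} (h : ContDiff ℝ ∞ ψ) (i j : Fin 3) (n : ℕ) :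
    (pd i)^[n] (pd j ψ) = pd j ((pd i)^[n] ψ) := by
  induction n with
  | zero => rfl
  | succ n ih =>
    rw [Function.iterate_succ_apply', Function.iterate_succ_apply', ih]
    exact pd_comm (contDiff_infty.1 (contDiff_pd_iterate h i n) 2) i j

lemma contDiff_pdMulti {ψ : E3 → ℝ} (h : ContDiff ℝ ∞ ψ) (α : Fin 3 → ℕ) :
    ContDiff ℝ ∞ (pdMulti α ψ) :=
  contDiff_pd_iterate (contDiff_pd_iterate (contDiff_pd_iterate h 2 _) 1 _) 0 _

lemma pdMulti_add_single {ψ : E3 → ℝ} (h : ContDiff ℝ ∞ ψ) (α : Fin 3 → ℕ) (j : Fin 3) :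
    pdMulti (α + Pi.single j 1) ψ = pd j (pdMulti α ψ) := by
  have h2 := contDiff_pd_iterate h 2 (α 2)
  have h1 := contDiff_pd_iterate h2 1 (α 1)
  fin_cases j
  · simp [pdMulti, Function.iterate_succ_apply']
  · simp [pdMulti, Function.iterate_succ_apply']
    rw [pd_iterate_comm h1]
  · simp [pdMulti, Function.iterate_succ_apply']
    rw [pd_iterate_comm h2, pd_iterate_comm h1]

lemma tsupport_pd_subset (ψ : E3 → ℝ) (i : Fin 3) : tsupport (pd i ψ) ⊆ tsupport ψ := by
  refine (closure_mono ?_).trans (tsupport_fderiv_subset (𝕜 := ℝ) (f := ψ))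
  intro x hx h0
  exact hx (by simp [pd, h0])

lemma tsupport_pd_iterate_subset (ψ : E3 → ℝ) (i : Fin 3) (n : ℕ) :
    tsupport ((pd i)^[n] ψ) ⊆ tsupport ψ := by
  induction n with
  | zero => exact subset_rfl
  | succ n ih => rw [Function.iterate_succ_apply']; exact (tsupport_pd_subset _ i).trans ih

lemma tsupport_pdMulti_subset (ψ : E3 → ℝ) (α : Fin 3 → ℕ) :
    tsupport (pdMulti α ψ) ⊆ tsupport ψ :=
  (tsupport_pd_iterate_subset _ _ _).trans
    ((tsupport_pd_iterate_subset _ _ _).trans (tsupport_pd_iterate_subset _ _ _))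

lemma integral_halfVol_mul_of_tsupport {f ψ : E3 → ℝ} (h : tsupport ψ ⊆ halfSpace) :
    ∫ x, f x * ψ x ∂halfVol = ∫ x, f x * ψ x := by
  refine setIntegral_eq_integral_of_forall_compl_eq_zero fun x hx => ?_
  have : x ∉ tsupport ψ := fun hx' => hx (h hx')
  simp [image_eq_zero_of_notMem_tsupport this]

/-- If ψ is a test function, so is ∂^α ψ, and one classical integration by parts against it moves
∂_j onto the C¹ function g. This lets Sobolev regularity descend to classical derivatives. -/
lemma HasWeakDeriv.pd {g w : E3 → ℝ} {α : Fin 3 → ℕ} {j : Fin 3}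
    (h : HasWeakDeriv (α + Pi.single j 1) g w) (hg : ContDiff ℝ 1 g) :
    HasWeakDeriv α (pd j g) w := by
  intro ψ hψ hc hsupp
  have h1 := h ψ hψ hc hsupp
  have hη := contDiff_pdMulti hψ α
  have hηs := tsupport_pdMulti_subset ψ α
  have hηc : HasCompactSupport (pdMulti α ψ) := hc.of_isClosed_subset (isClosed_tsupport _) hηs
  have hpc : HasCompactSupport (QuasineutralEP.pd j (pdMulti α ψ)) :=
    hηc.of_isClosed_subset (isClosed_tsupport _) (tsupport_pd_subset _ j)
  have hpdg : Continuous (QuasineutralEP.pd j g) :=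
    (hg.continuous_fderiv (by norm_num)).clm_apply continuous_const
  have h2 : ∫ x, g x * QuasineutralEP.pd j (pdMulti α ψ) x
      = -∫ x, QuasineutralEP.pd j g x * pdMulti α ψ x := by
    apply integral_mul_fderiv_eq_neg_fderiv_mul_of_integrable
    · exact (hpdg.mul hη.continuous).integrable_of_hasCompactSupport hηc.mul_left
    · exact (hg.continuous.mul (contDiff_pd hη j).continuous).integrable_of_hasCompactSupport
        hpc.mul_left
    · exact (hg.continuous.mul hη.continuous).integrable_of_hasCompactSupport hηc.mul_left
    · exact fun x _ => hg.differentiable (by norm_num) x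
    · exact fun x _ => hη.differentiable (by simp) x
  rw [pdMulti_add_single hψ,
    integral_halfVol_mul_of_tsupport (((tsupport_pd_subset _ j).trans hηs).trans hsupp), h2] at h1
  rw [integral_halfVol_mul_of_tsupport (hηs.trans hsupp)]
  have h3 : ∑ i, (α + Pi.single j 1 : Fin 3 → ℕ) i = ∑ i, α i + 1 := by
    simp [Finset.sum_add_distrib]
  rw [h3, pow_succ] at h1
  linarith

/-- The fundamental lemma of the calculus of variations on the open half-space, used to identify the
abstract L² representatives with the given continuous fields. -/
lemma HasWeakDeriv.ae_eq {g w : E3 → ℝ} (h : HasWeakDeriv 0 g w) (hg : Continuous g)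
    (hw : MemLp w 2 halfVol) : g =ᵐ[halfVol] w := by
  have hgl : LocallyIntegrable g halfVol := hg.locallyIntegrable
  have hwl : LocallyIntegrable w halfVol := hw.locallyIntegrable (by norm_num)
  have := isOpen_halfSpace.ae_eq_zero_of_integral_contDiff_smul_eq_zero (f := fun x => g x - w x)
    (μ := halfVol) ((hgl.sub hwl).locallyIntegrableOn _) (by
      intro ψ hψ hc hs
      have h1 := h ψ hψ hc hs
      have h2 : pdMulti 0 ψ = ψ := rfl
      simp only [h2, Pi.zero_apply, Finset.sum_const_zero, pow_zero, one_mul] at h1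
      have i1 := hgl.integrable_smul_left_of_hasCompactSupport hψ.continuous hc
      have i2 := hwl.integrable_smul_left_of_hasCompactSupport hψ.continuous hc
      simp only [smul_eq_mul] at i1 i2
      simp only [smul_eq_mul, mul_sub]
      rw [integral_sub i1 i2]
      simp only [mul_comm (ψ _)]
      rw [h1, sub_self])
  filter_upwards [this, ae_restrict_mem measurableSet_halfSpace] with x hx hx'
  have := hx hx'
  linarith

/-! ### Sobolev regularity, continuous in time -/

lemma ContSobolev.mono {s r : ℕ} {T : ℝ} {f : ScalarField} (h : ContSobolev s T f) (hr : r ≤ s) :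
    ContSobolev r T f := fun α hα => h α (hα.trans hr)

lemma ContSobolev.dx {s k : ℕ} {T : ℝ} {f : ScalarField} (h : ContSobolev (s + 1) T f)
    (hf : IsCk (k + 1) f) (j : Fin 3) : ContSobolev s T (dx j f) := by
  intro α hα
  obtain ⟨w, h1, h2⟩ := h (α + Pi.single j 1) (by simp [Finset.sum_add_distrib, hα])
  exact ⟨w, fun t ht => ⟨(h1 t ht).1, (h1 t ht).2.pd
    ((hf.slice t).of_le (by exact_mod_cast Nat.le_add_left 1 k))⟩, h2⟩

/-- Continuity in time bounds the norm near each instant, and compactness of [0, T] makes the bound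
uniform. -/
lemma ContSobolev.exists_l2sq_le {s k : ℕ} {T : ℝ} {f : ScalarField} (h : ContSobolev s T f)
    (hf : IsCk k f) : ∃ B : ℝ≥0, ∀ t ∈ Icc 0 T, l2sq (f t) ≤ B := by
  obtain ⟨w, h1, h2⟩ := h 0 (by simp)
  have key : ∃ B : ℝ≥0, ∀ t ∈ Icc 0 T, eLpNorm (w t) 2 halfVol ≤ B := by
    refine isCompact_Icc.induction_on (p := fun S => ∃ B : ℝ≥0, ∀ t ∈ S,
      t ∈ Icc 0 T → eLpNorm (w t) 2 halfVol ≤ B) ⟨0, by simp⟩ ?_ ?_ ?_ |>.imp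
        fun B hB t ht => hB t ht ht
    · rintro s t hst ⟨B, hB⟩
      exact ⟨B, fun τ hτ => hB τ (hst hτ)⟩
    · rintro s t ⟨B, hB⟩ ⟨B', hB'⟩
      refine ⟨B + B', fun τ hτ hI => ?_⟩
      rcases hτ with hτ | hτ
      · exact (hB τ hτ hI).trans (by simp)
      · exact (hB' τ hτ hI).trans (by simp)
    · intro t ht
      refine ⟨{τ | eLpNorm (w τ - w t) 2 halfVol < 1},
        (h2 t ht).eventually (gt_mem_nhds one_pos), (1 + eLpNorm (w t) 2 halfVol).toNNReal, ?_⟩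
      intro τ hτ hI
      rw [ENNReal.coe_toNNReal (ENNReal.add_ne_top.2 ⟨by simp, (h1 t ht).1.2.ne⟩)]
      calc eLpNorm (w τ) 2 halfVol = eLpNorm ((w τ - w t) + w t) 2 halfVol := by simp
        _ ≤ eLpNorm (w τ - w t) 2 halfVol + eLpNorm (w t) 2 halfVol :=
          eLpNorm_add_le ((h1 τ hI).1.1.sub (h1 t ht).1.1) (h1 t ht).1.1 (by norm_num)
        _ ≤ _ := by gcongr; exact le_of_lt hτ
  obtain ⟨B, hB⟩ := key
  refine ⟨B ^ 2, fun t ht => ?_⟩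
  rw [l2sq, eLpNorm_congr_ae ((h1 t ht).2.ae_eq (hf.slice t).continuous (h1 t ht).1)]
  push_cast
  gcongr
  exact hB t ht

lemma l2sq_eq_lintegral (g : E3 → ℝ) : l2sq g = ∫⁻ x, ‖g x‖ₑ ^ 2 ∂halfVol := by
  rw [l2sq, eLpNorm_eq_lintegral_rpow_enorm_toReal (by norm_num) (by norm_num),
    ← ENNReal.rpow_natCast, ← ENNReal.rpow_mul]
  simp

/-! ### A Sobolev embedding -/

/-- The weight s − (a + 1) vanishes at the right endpoint and equals −1 at a, so integrating the
derivative of (s − (a + 1)) g² isolates g(a)². The interval extends only forward from a, hence a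
line started in the half-space does not leave it. -/
lemma sq_le_integral_of_hasDerivAt {g g' : ℝ → ℝ} (hg : ∀ s, HasDerivAt g (g' s) s)
    (hg' : Continuous g') (a : ℝ) :
    g a ^ 2 ≤ ∫ s in a..(a + 1), 2 * (g s ^ 2 + g' s ^ 2) := by
  have hc : Continuous g := continuous_iff_continuousAt.2 fun s => (hg s).continuousAt
  have h1 : ∀ s, HasDerivAt (fun s => (s - (a + 1)) * g s ^ 2)
      (g s ^ 2 + (s - (a + 1)) * (2 * g s * g' s)) s := by
    intro s
    exact (((hasDerivAt_id' s).sub_const (a + 1)).fun_mul ((hg s).fun_pow 2)).congr_deriv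
      (by push_cast; ring)
  have h2 := intervalIntegral.integral_eq_sub_of_hasDerivAt (a := a) (b := a + 1)
    (fun s _ => h1 s) (by apply Continuous.intervalIntegrable; fun_prop)
  have h3 : g a ^ 2 = ∫ s in a..(a + 1), (g s ^ 2 + (s - (a + 1)) * (2 * g s * g' s)) := by
    rw [h2]; ring
  rw [h3]
  apply intervalIntegral.integral_mono_on (by linarith)
  · apply Continuous.intervalIntegrable; fun_prop
  · apply Continuous.intervalIntegrable; fun_prop
  · intro s hs
    nlinarith [sq_nonneg (g s + (s - (a + 1)) * g' s), sq_nonneg (g s), sq_nonneg (g' s),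
      mul_nonneg (sub_nonneg.2 hs.1) (sub_nonneg.2 hs.2), mul_nonneg (mul_nonneg (sub_nonneg.2 hs.1)
        (by linarith [hs.2] : 0 ≤ (a + 2 - s))) (sq_nonneg (g' s)),
      sq_nonneg (g s - (s - (a + 1)) * g' s)]

lemma enorm_sq_le_lintegral_of_hasDerivAt {g g' : ℝ → ℝ} (hg : ∀ s, HasDerivAt g (g' s) s)
    (hg' : Continuous g') (a : ℝ) :
    ‖g a‖ₑ ^ 2 ≤ ∫⁻ s in Icc a (a + 1), 2 * (‖g s‖ₑ ^ 2 + ‖g' s‖ₑ ^ 2) := by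
  have hc : Continuous g := continuous_iff_continuousAt.2 fun s => (hg s).continuousAt
  have e : ∀ r : ℝ, ‖r‖ₑ ^ 2 = ENNReal.ofReal (r ^ 2) := by
    intro r
    rw [Real.enorm_eq_ofReal_abs, ← ENNReal.ofReal_pow (abs_nonneg r), sq_abs]
  have h2 : ∀ s, 2 * (‖g s‖ₑ ^ 2 + ‖g' s‖ₑ ^ 2) = ENNReal.ofReal (2 * (g s ^ 2 + g' s ^ 2)) := by
    intro s
    rw [ENNReal.ofReal_mul (by norm_num), ENNReal.ofReal_add (by positivity) (by positivity), e, e]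
    simp
  simp only [h2]
  rw [← ofReal_integral_eq_lintegral_ofReal, e]
  · apply ENNReal.ofReal_le_ofReal
    rw [integral_Icc_eq_integral_Ioc, ← intervalIntegral.integral_of_le (by linarith)]
    exact sq_le_integral_of_hasDerivAt hg hg' a
  · exact (Continuous.continuousOn (by fun_prop)).integrableOn_compact isCompact_Icc
  · exact ae_of_all _ fun s => by positivity


lemma hasDerivAt_line {f : E3 → ℝ} (hf : ContDiff ℝ 1 f) (i : Fin 3) (y : Fin 3 → ℝ) (s : ℝ) :
    HasDerivAt (fun s => f (toE3 (Function.update y i s)))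
      (pd i f (toE3 (Function.update y i s))) s := by
  have h1 : HasDerivAt (fun s => toE3 (Function.update y i s)) (toE3 (Pi.single i 1)) s :=
    (toE3 : (Fin 3 → ℝ) →L[ℝ] E3).hasFDerivAt.comp_hasDerivAt s (hasDerivAt_update y i s)
  exact (hf.differentiable (by norm_num) _).hasFDerivAt.comp_hasDerivAt s h1

/-- A family of functions together with its `i`-th partial derivatives. -/
def withPd {ι : Type} (i : Fin 3) (F : ι → E3 → ℝ) : ι × Bool → E3 → ℝ :=
  fun k => if k.2 then pd i (F k.1) else F k.1

lemma sum_enorm_sq_le {ι : Type} [Fintype ι] {F : ι → E3 → ℝ} (hF : ∀ k, ContDiff ℝ 1 (F k))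
    (i : Fin 3) (y : Fin 3 → ℝ) :
    ∑ k, ‖F k (toE3 y)‖ₑ ^ 2 ≤ ∫⁻ s in Icc (y i) (y i + 1),
      2 * ∑ k, ‖withPd i F k (toE3 (Function.update y i s))‖ₑ ^ 2 := by
  have hp : ∀ k, Continuous (pd i (F k)) := fun k =>
    ((hF k).continuous_fderiv (by norm_num)).clm_apply continuous_const
  have hu : Continuous fun s => toE3 (Function.update y i s) :=
    toE3.continuous.comp (continuous_const.update i continuous_id)
  have h1 : ∀ k, ‖F k (toE3 y)‖ₑ ^ 2 ≤ ∫⁻ s in Icc (y i) (y i + 1),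
      2 * (‖F k (toE3 (Function.update y i s))‖ₑ ^ 2
        + ‖pd i (F k) (toE3 (Function.update y i s))‖ₑ ^ 2) := by
    intro k
    have := enorm_sq_le_lintegral_of_hasDerivAt (hasDerivAt_line (hF k) i y)
      ((hp k).comp hu) (y i)
    simpa using this
  refine (Finset.sum_le_sum fun k _ => h1 k).trans (le_of_eq ?_)
  rw [← lintegral_finsetSum]
  · simp only [Fintype.sum_prod_type, withPd, Fintype.sum_bool, Finset.mul_sum, add_comm,
      if_true, Bool.false_eq_true, if_false]
  · intro k _
    have c1 := (hF k).continuous.comp hu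
    have c2 := (hp k).comp hu
    exact ((c1.measurable.enorm.pow_const 2).add (c2.measurable.enorm.pow_const 2)).const_mul 2

lemma withPd_contDiff {ι : Type} {F : ι → E3 → ℝ} {n : ℕ} (hF : ∀ k, ContDiff ℝ (n + 1 : ℕ) (F k))
    (i : Fin 3) (k : ι × Bool) : ContDiff ℝ n (withPd i F k) := by
  unfold withPd
  split_ifs
  · exact ((hF k.1).fderiv_right (m := n) (by simp)).clm_apply contDiff_const
  · exact (hF k.1).of_le (by exact_mod_cast Nat.le_succ n)

/-- All mixed derivatives of a function of order at most one in each variable. -/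
def mixedDerivs (f : E3 → ℝ) : ((Unit × Bool) × Bool) × Bool → E3 → ℝ :=
  withPd 2 (withPd 1 (withPd 0 fun _ => f))

/-- Apply the one-dimensional inequality successively in the three coordinate directions. The result
is an integral over the unit cube with lowest corner x, which stays in the closed half-space; the
factor is 2³, and each direction costs one derivative, so only mixed derivatives of order at most
one per variable occur. -/
theorem enorm_sq_le_sum_l2sq {f : E3 → ℝ} (hf : ContDiff ℝ 3 f) {x : E3}
    (hx : x ∈ closedHalfSpace) :
    ‖f x‖ₑ ^ 2 ≤ 8 * ∑ k, l2sq (mixedDerivs f k) := by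
  obtain ⟨y, rfl⟩ := toE3.surjective x
  have r0 : ∀ k : Unit, ContDiff ℝ (3 : ℕ) ((fun _ => f : Unit → E3 → ℝ) k) := fun _ => hf
  have r1 := withPd_contDiff r0 0
  have r2 := withPd_contDiff r1 1
  have r3 : ∀ k, ContDiff ℝ (0 : ℕ) (mixedDerivs f k) :=
    withPd_contDiff (fun k => (r2 k).of_le (by norm_num)) 2
  set μ : Fin 3 → Measure ℝ := fun i => volume.restrict (Icc (y i) (y i + 1)) with hμ
  set H : (Fin 3 → ℝ) → ℝ≥0∞ := fun z => ∑ k, ‖mixedDerivs f k (toE3 z)‖ₑ ^ 2 with hH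
  have hHm : Measurable H := by
    refine Finset.measurable_sum _ fun k _ => ?_
    have := (r3 k).continuous.comp toE3.continuous
    simp only [Function.comp_def] at this
    exact Continuous.measurable (by fun_prop)
  have main : ‖f (toE3 y)‖ₑ ^ 2 ≤ 8 * ∫⁻ s0, ∫⁻ s1, ∫⁻ s2,
      H (Function.update (Function.update (Function.update y 0 s0) 1 s1) 2 s2) ∂μ 2 ∂μ 1 ∂μ 0 := by
    have e0 := sum_enorm_sq_le (F := fun _ : Unit => f) (fun k => (r0 k).of_le (by norm_num)) 0 y
    have e1 := fun s0 => sum_enorm_sq_le (F := withPd 0 fun _ : Unit => f)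
      (fun k => (r1 k).of_le (by norm_num)) 1 (Function.update y 0 s0)
    have e2 := fun s0 s1 => sum_enorm_sq_le (F := withPd 1 (withPd 0 fun _ : Unit => f))
      (fun k => (r2 k).of_le (by norm_num)) 2 (Function.update (Function.update y 0 s0) 1 s1)
    simp only [Finset.univ_unique, Finset.sum_singleton] at e0
    have u1 : ∀ s0, Function.update y 0 s0 1 = y 1 := fun s0 => by simp
    have u2 : ∀ s0 s1, Function.update (Function.update y 0 s0) 1 s1 2 = y 2 := fun s0 s1 => by
      simp
    simp only [u1] at e1
    simp only [u2] at e2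
    refine e0.trans ?_
    rw [lintegral_const_mul' _ _ (by norm_num)]
    refine (mul_le_mul_right (lintegral_mono fun s0 => e1 s0) 2).trans ?_
    simp only [lintegral_const_mul' _ _ (ENNReal.ofNat_ne_top (n := 2))]
    refine (mul_le_mul_right (mul_le_mul_right (lintegral_mono fun s0 =>
      lintegral_mono fun s1 => e2 s0 s1) 2) 2).trans ?_
    simp only [lintegral_const_mul' _ _ (ENNReal.ofNat_ne_top (n := 2)), ← mul_assoc]
    norm_num
    rfl
  refine main.trans (mul_le_mul_right ?_ 8)
  have h3 : ∫⁻ s0, ∫⁻ s1, ∫⁻ s2,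
      H (Function.update (Function.update (Function.update y 0 s0) 1 s1) 2 s2) ∂μ 2 ∂μ 1 ∂μ 0
      = ∫⁻ z, H z ∂Measure.pi μ := by
    have hu : (Finset.univ : Finset (Fin 3)) = {0, 1, 2} := by decide
    rw [lintegral_eq_lmarginal_univ y, hu, lmarginal_insert _ hHm (by decide)]
    refine lintegral_congr fun s0 => ?_
    rw [lmarginal_insert _ hHm (by decide)]
    refine lintegral_congr fun s1 => ?_
    rw [lmarginal_singleton]
  rw [h3, hμ, ← Measure.restrict_pi_pi, ← volume_pi]
  have hmp := measurePreserving_toE3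
  have hemb : MeasurableEmbedding toE3 := toE3.toHomeomorph.measurableEmbedding
  have h4 : ∑ k, l2sq (mixedDerivs f k) = ∫⁻ z in toE3 ⁻¹' halfSpace, H z := by
    simp only [l2sq_eq_lintegral]
    rw [← lintegral_finsetSum]
    · exact (hmp.setLIntegral_comp_preimage_emb hemb
        (fun x => ∑ k, ‖mixedDerivs f k x‖ₑ ^ 2) halfSpace).symm
    · intro k _
      have := (r3 k).continuous
      exact Continuous.measurable (by fun_prop)
  rw [h4]
  apply lintegral_mono'
  · refine Measure.restrict_mono_ae ?_
    have hnull : ∀ᵐ z : Fin 3 → ℝ, z 2 ≠ 0 := by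
      have := Measure.ae_eval_ne (μ := fun _ : Fin 3 => (volume : Measure ℝ)) 2 0
      simpa [volume_pi] using this
    filter_upwards [hnull] with z hz hzm
    have h5 := (hzm 2 (mem_univ _)).1
    have h6 : 0 ≤ y 2 := hx
    exact lt_of_le_of_ne (h6.trans h5) (Ne.symm hz)
  · exact le_rfl

/-- `f` is bounded on `[0,T] × {x₃ ≥ 0}`. -/
def BddField (T : ℝ) (f : ScalarField) : Prop :=
  ∃ B : ℝ, ∀ t ∈ Icc 0 T, ∀ x ∈ closedHalfSpace, |f t x| ≤ B

/-- The mixed derivatives in the embedding have total order at most three, and each is bounded in L²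
uniformly over the compact time interval. -/
theorem ContSobolev.bddField {T : ℝ} {f : ScalarField} (h : ContSobolev 3 T f) (hf : IsCk 3 f) :
    BddField T f := by
  -- Adjoining the derivatives in one direction consumes one order of both classical and Sobolev
  -- regularity; three applications bring order 3 down to 0.
  have fam : ∀ {ι : Type} (n : ℕ) (F : ι → ScalarField) (i : Fin 3),
      (∀ k, IsCk (n + 1) (F k) ∧ ContSobolev (n + 1) T (F k)) →
      ∃ G : ι × Bool → ScalarField, (∀ k, IsCk n (G k) ∧ ContSobolev n T (G k)) ∧
        ∀ k t, G k t = withPd i (fun l => F l t) k := by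
    intro ι n F i hF
    refine ⟨fun k => if k.2 then QuasineutralEP.dx i (F k.1) else F k.1, ?_, ?_⟩
    · rintro ⟨k, b⟩
      cases b
      · exact ⟨(hF k).1.mono (Nat.le_succ _), (hF k).2.mono (Nat.le_succ _)⟩
      · exact ⟨(hF k).1.dx i, (hF k).2.dx (hF k).1 i⟩
    · rintro ⟨k, b⟩ t
      cases b <;> rfl
  obtain ⟨G1, g1, e1⟩ := fam 2 (fun _ : Unit => f) 0 fun _ => ⟨hf, h⟩
  obtain ⟨G2, g2, e2⟩ := fam 1 G1 1 g1
  obtain ⟨G3, g3, e3⟩ := fam 0 G2 2 g2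
  have e : ∀ k t, G3 k t = mixedDerivs (f t) k := by
    intro k t
    simp only [e3, e2, e1, mixedDerivs]
  choose B hB using fun k => (g3 k).2.exists_l2sq_le (g3 k).1
  refine ⟨Real.sqrt (8 * ∑ k, (B k : ℝ)), fun t ht x hx => ?_⟩
  have h1 := enorm_sq_le_sum_l2sq (hf.slice t) hx
  have h2 : ‖f t x‖ₑ ^ 2 ≤ ENNReal.ofNNReal (8 * ∑ k, B k) := by
    refine h1.trans ?_
    push_cast
    gcongr with k
    rw [← e]
    exact hB k t ht
  have h3 : ‖f t x‖₊ ^ 2 ≤ 8 * ∑ k, B k := by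
    rw [enorm_eq_nnnorm] at h2
    exact_mod_cast h2
  have h4 : |f t x| ^ 2 ≤ 8 * ∑ k, (B k : ℝ) := by
    have : ((‖f t x‖₊ ^ 2 : ℝ≥0) : ℝ) ≤ ((8 * ∑ k, B k : ℝ≥0) : ℝ) := by exact_mod_cast h3
    push_cast at this
    simpa using this
  exact Real.le_sqrt_of_sq_le h4

/-! ### Algebra of derivatives of `C¹` fields -/

lemma IsCk.differentiableAt {f : ScalarField} (h : IsCk 1 f) (p : ℝ × E3) :
    DifferentiableAt ℝ (fun p : ℝ × E3 => f p.1 p.2) p :=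
  IsCk.differentiable (k := 0) h p

lemma IsCk.hasDerivAt_dt {f : ScalarField} (h : IsCk 1 f) (t : ℝ) (x : E3) :
    HasDerivAt (fun s => f s x) (QuasineutralEP.dt f t x) t :=
  (hasDerivAt_time (h.differentiableAt (t, x))).differentiableAt.hasDerivAt

lemma IsCk.differentiableAt_slice {f : ScalarField} (h : IsCk 1 f) (t : ℝ) (x : E3) :
    DifferentiableAt ℝ (f t) x := (h.slice t).differentiable (by norm_num) x

lemma dt_add {f g : ScalarField} (hf : IsCk 1 f) (hg : IsCk 1 g) (t : ℝ) (x : E3) :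
    dt (fun t x => f t x + g t x) t x = dt f t x + dt g t x :=
  ((hf.hasDerivAt_dt t x).fun_add (hg.hasDerivAt_dt t x)).deriv

lemma dx_add {f g : ScalarField} (hf : IsCk 1 f) (hg : IsCk 1 g) (j : Fin 3) (t : ℝ) (x : E3) :
    dx j (fun t x => f t x + g t x) t x = dx j f t x + dx j g t x := by
  simp only [dx, pd]
  rw [fderiv_fun_add (hf.differentiableAt_slice t x) (hg.differentiableAt_slice t x)]
  rfl

lemma dt_const_mul {f : ScalarField} (hf : IsCk 1 f) (c t : ℝ) (x : E3) :
    dt (fun t x => c * f t x) t x = c * dt f t x :=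
  ((hf.hasDerivAt_dt t x).const_mul c).deriv

lemma dx_const_mul {f : ScalarField} (hf : IsCk 1 f) (c : ℝ) (j : Fin 3) (t : ℝ) (x : E3) :
    dx j (fun t x => c * f t x) t x = c * dx j f t x := by
  simp only [dx, pd]
  rw [fderiv_const_mul (hf.differentiableAt_slice t x)]
  rfl

/-- The derivative of `C¹` fields which agree on `[0,T] × {x₃ > 0}` in the interior. -/
lemma dx_congr_halfSpace {f g : E3 → ℝ} (h : ∀ x ∈ halfSpace, f x = g x) (j : Fin 3) {x : E3}
    (hx : x ∈ halfSpace) : pd j f x = pd j g x := by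
  have : f =ᶠ[𝓝 x] g := by
    filter_upwards [isOpen_halfSpace.mem_nhds hx] with y hy using h y hy
  simp [pd, this.fderiv_eq]

/-! ### The stretched normal variable -/

lemma stretch_eq (ε : ℝ) (x : E3) :
    stretch ε x = (ContinuousLinearMap.id ℝ E3
      + (ε⁻¹ - 1) • (EuclideanSpace.proj 2 : E3 →L[ℝ] ℝ).smulRight
          (EuclideanSpace.single 2 1 : E3)) x := by
  ext i
  fin_cases i <;> simp [stretch]
  ring

lemma hasFDerivAt_stretch (ε : ℝ) (x : E3) :
    HasFDerivAt (stretch ε) (ContinuousLinearMap.id ℝ E3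
      + (ε⁻¹ - 1) • (EuclideanSpace.proj 2 : E3 →L[ℝ] ℝ).smulRight
          (EuclideanSpace.single 2 1 : E3)) x := by
  rw [show stretch ε = _ from funext (stretch_eq ε)]
  exact ContinuousLinearMap.hasFDerivAt _

lemma contDiff_stretch (ε : ℝ) (k : WithTop ℕ∞) : ContDiff ℝ k (stretch ε) := by
  rw [show stretch ε = _ from funext (stretch_eq ε)]
  exact ContinuousLinearMap.contDiff _

lemma stretch_mem_closedHalfSpace {ε : ℝ} (hε : 0 < ε) {x : E3} (hx : x ∈ closedHalfSpace) :
    stretch ε x ∈ closedHalfSpace := by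
  have : (0 : ℝ) ≤ x 2 := hx
  simp [closedHalfSpace, stretch]
  positivity

lemma IsCk.stretch {k : ℕ} {F : ScalarField} (hF : IsCk k F) (ε : ℝ) :
    IsCk k (fun t x => F t (stretch ε x)) :=
  ContDiff.comp (g := fun p : ℝ × E3 => F p.1 p.2) (f := fun p : ℝ × E3 => (p.1, QuasineutralEP.stretch ε p.2)) hF
    (contDiff_fst.prodMk ((contDiff_stretch ε _).comp contDiff_snd))

lemma dx_stretch {F : ScalarField} (hF : IsCk 1 F) (ε : ℝ) (j : Fin 3) (t : ℝ) (x : E3) :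
    dx j (fun t x => F t (stretch ε x)) t x
      = (if j = 2 then ε⁻¹ else 1) * dx j F t (stretch ε x) := by
  have h := (hF.differentiableAt_slice t (stretch ε x)).hasFDerivAt.comp x (hasFDerivAt_stretch ε x)
  have h' : fderiv ℝ (fun x => F t (stretch ε x)) x = _ := h.fderiv
  simp only [dx, pd, h']
  fin_cases j <;> simp
  ring

/-! ### Bounded fields -/

/-- The limit equations yield bounds only in the open half-space, and differentiating an identity in
time needs an interior time. Continuity carries the bound to the closure. -/
lemma bddField_of_interior {T : ℝ} (hT : 0 < T) {f : ScalarField} {k : ℕ} (hf : IsCk k f) {B : ℝ}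
    (h : ∀ t ∈ Ioo 0 T, ∀ x ∈ halfSpace, |f t x| ≤ B) : BddField T f := by
  refine ⟨B, fun t ht x hx => ?_⟩
  -- The approach path moves time towards T/2 and space along the inner normal, so it is interior
  -- for every parameter in (0, 1).
  have h1 : Tendsto (fun τ : ℝ => |f (t + τ * (T / 2 - t)) (x + τ • EuclideanSpace.single 2 1)|)
      (𝓝[>] 0) (𝓝 |f t x|) := by
    have hc : Continuous (fun τ : ℝ =>
        |f (t + τ * (T / 2 - t)) (x + τ • EuclideanSpace.single 2 1)|) :=
      (hf.continuous.comp (f := fun τ : ℝ =>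
        (t + τ * (T / 2 - t), x + τ • (EuclideanSpace.single 2 1 : E3))) (by fun_prop)).abs
    have := hc.tendsto 0
    simp only [zero_mul, add_zero, zero_smul] at this
    exact this.mono_left nhdsWithin_le_nhds
  refine le_of_tendsto h1 ?_
  have h2 : Ioo (0 : ℝ) 1 ∈ 𝓝[>] (0 : ℝ) := Ioo_mem_nhdsGT one_pos
  filter_upwards [h2] with τ hτ
  apply h
  · obtain ⟨a, b⟩ := ht
    obtain ⟨c, d⟩ := hτ
    constructor <;> nlinarith
  · have : (0 : ℝ) ≤ x 2 := hx
    have h3 := hτ.1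
    simp [halfSpace]
    linarith

/-- `f` and its space derivatives are bounded on `[0,T] × {x₃ ≥ 0}`. -/
structure BddSpace (T : ℝ) (f : ScalarField) : Prop where
  reg : IsCk 1 f
  bdd : BddField T f
  dx : ∀ j, BddField T (dx j f)

lemma ContSobolev.bddSpace {T : ℝ} {f : ScalarField} (h : ContSobolev 4 T f) (hf : IsCk 4 f) :
    BddSpace T f where
  reg := hf.mono (by norm_num)
  bdd := (h.mono (by norm_num)).bddField (hf.mono (by norm_num))
  dx j := (h.dx hf j).bddField (hf.dx j)

lemma BddField.add {T : ℝ} {f g : ScalarField} (hf : BddField T f) (hg : BddField T g) :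
    BddField T (fun t x => f t x + g t x) := by
  obtain ⟨a, ha⟩ := hf
  obtain ⟨b, hb⟩ := hg
  exact ⟨a + b, fun t ht x hx => (abs_add_le _ _).trans (add_le_add (ha t ht x hx) (hb t ht x hx))⟩

lemma BddField.mul {T : ℝ} {f g : ScalarField} (hf : BddField T f) (hg : BddField T g) :
    BddField T (fun t x => f t x * g t x) := by
  obtain ⟨a, ha⟩ := hf
  obtain ⟨b, hb⟩ := hg
  refine ⟨a * b, fun t ht x hx => ?_⟩
  rw [abs_mul]
  exact mul_le_mul (ha t ht x hx) (hb t ht x hx) (abs_nonneg _) ((abs_nonneg _).trans (ha t ht x hx))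

lemma BddField.congr {T : ℝ} {f g : ScalarField} (hf : BddField T f)
    (h : ∀ t ∈ Icc 0 T, ∀ x ∈ closedHalfSpace, g t x = f t x) : BddField T g := by
  obtain ⟨a, ha⟩ := hf
  exact ⟨a, fun t ht x hx => by rw [h t ht x hx]; exact ha t ht x hx⟩

/-- `F` and its first derivatives decay exponentially. -/
structure LayerDecay (T : ℝ) (F : ScalarField) (C γ : ℝ) : Prop where
  reg : IsCk 1 F
  rate : 0 < γ
  val : ∀ t ∈ Icc 0 T, ∀ x ∈ closedHalfSpace, |F t x| ≤ C * Real.exp (-γ * x 2)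
  dt : ∀ t ∈ Icc 0 T, ∀ x ∈ closedHalfSpace, |dt F t x| ≤ C * Real.exp (-γ * x 2)
  dx : ∀ j, ∀ t ∈ Icc 0 T, ∀ x ∈ closedHalfSpace, |dx j F t x| ≤ C * Real.exp (-γ * x 2)

lemma ExpDecay.layerDecay {k : ℕ} {T : ℝ} {F : ScalarField} (h : ExpDecay (k + 1) T F)
    (hF : IsCk 1 F) : ∃ C γ, LayerDecay T F C γ := by
  obtain ⟨C₀, γ₀, hγ₀, h0⟩ := h 0 (Nat.zero_le _)
  obtain ⟨C₁, γ₁, hγ₁, h1⟩ := h 1 (by omega)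
  have up : ∀ {C γ : ℝ} {x : E3}, x ∈ closedHalfSpace → min γ₀ γ₁ ≤ γ → C ≤ max (max C₀ C₁) 0 →
      C * Real.exp (-γ * x 2) ≤ max (max C₀ C₁) 0 * Real.exp (-min γ₀ γ₁ * x 2) := by
    intro C γ x hx h1 h2
    have hx' : (0 : ℝ) ≤ x 2 := hx
    refine mul_le_mul h2 (Real.exp_le_exp.2 ?_) (Real.exp_nonneg _) (le_max_right _ _)
    nlinarith
  have hfd : ∀ t ∈ Icc 0 T, ∀ x ∈ closedHalfSpace, ∀ v : ℝ × E3, ‖v‖ ≤ 1 →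
      |fderiv ℝ (fun p : ℝ × E3 => F p.1 p.2) (t, x) v|
        ≤ max (max C₀ C₁) 0 * Real.exp (-min γ₀ γ₁ * x 2) := by
    intro t ht x hx v hv
    refine le_trans ?_ (up hx (min_le_right _ _) ((le_max_right _ _).trans (le_max_left _ _)))
    refine le_trans ?_ (h1 t ht x hx)
    rw [norm_iteratedFDeriv_one, ← Real.norm_eq_abs]
    exact (ContinuousLinearMap.le_opNorm _ _).trans (mul_le_of_le_one_right (norm_nonneg _) hv)
  refine ⟨max (max C₀ C₁) 0, min γ₀ γ₁, hF, lt_min hγ₀ hγ₁, ?_, ?_, ?_⟩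
  · intro t ht x hx
    have := h0 t ht x hx
    rw [norm_iteratedFDeriv_zero] at this
    exact this.trans (up hx (min_le_left _ _) ((le_max_left _ _).trans (le_max_left _ _)))
  · intro t ht x hx
    rw [dt_eq_fderiv (hF.differentiableAt (t, x))]
    exact hfd t ht x hx _ (by simp [Prod.norm_def])
  · intro j t ht x hx
    rw [dx_eq_fderiv (hF.differentiableAt (t, x))]
    exact hfd t ht x hx _ (by simp [Prod.norm_def])

/-! ### Bounds for fields with a boundary layer of width `ε` -/

/-- A field bounded with its derivatives, except for a normal derivative of order
`min (1/ε) (1/x₃)`. -/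
structure LayerBounds (B ε T : ℝ) (a : ScalarField) : Prop where
  reg : IsCk 1 a
  val : ∀ t ∈ Icc 0 T, ∀ x ∈ halfSpace, |a t x| ≤ B
  dt : ∀ t ∈ Icc 0 T, ∀ x ∈ halfSpace, |dt a t x| ≤ B
  dx_tang : ∀ j, j ≠ 2 → ∀ t ∈ Icc 0 T, ∀ x ∈ halfSpace, |dx j a t x| ≤ B
  dx_eps : ∀ j, ∀ t ∈ Icc 0 T, ∀ x ∈ halfSpace, ε * |dx j a t x| ≤ B
  dx_norm : ∀ t ∈ Icc 0 T, ∀ x ∈ halfSpace, x 2 * |dx 2 a t x| ≤ B * (1 + x 2)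

lemma LayerBounds.mono {B B' ε T : ℝ} {a : ScalarField} (h : LayerBounds B ε T a) (hB : B ≤ B') :
    LayerBounds B' ε T a where
  reg := h.reg
  val t ht x hx := (h.val t ht x hx).trans hB
  dt t ht x hx := (h.dt t ht x hx).trans hB
  dx_tang j hj t ht x hx := (h.dx_tang j hj t ht x hx).trans hB
  dx_eps j t ht x hx := (h.dx_eps j t ht x hx).trans hB
  dx_norm t ht x hx := (h.dx_norm t ht x hx).trans (by
    have : (0 : ℝ) < x 2 := hx
    gcongr)

lemma LayerBounds.add {B B' ε T : ℝ} (hε : 0 < ε) {a b : ScalarField} (ha : LayerBounds B ε T a)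
    (hb : LayerBounds B' ε T b) : LayerBounds (B + B') ε T (fun t x => a t x + b t x) where
  reg := ContDiff.add ha.reg hb.reg
  val t ht x hx := (abs_add_le _ _).trans (add_le_add (ha.val t ht x hx) (hb.val t ht x hx))
  dt t ht x hx := by
    rw [dt_add ha.reg hb.reg]
    exact (abs_add_le _ _).trans (add_le_add (ha.dt t ht x hx) (hb.dt t ht x hx))
  dx_tang j hj t ht x hx := by
    rw [dx_add ha.reg hb.reg]
    exact (abs_add_le _ _).trans (add_le_add (ha.dx_tang j hj t ht x hx) (hb.dx_tang j hj t ht x hx))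
  dx_eps j t ht x hx := by
    rw [dx_add ha.reg hb.reg]
    have h1 := ha.dx_eps j t ht x hx
    have h2 := hb.dx_eps j t ht x hx
    nlinarith [abs_add_le (QuasineutralEP.dx j a t x) (QuasineutralEP.dx j b t x)]
  dx_norm t ht x hx := by
    rw [dx_add ha.reg hb.reg]
    have h1 := ha.dx_norm t ht x hx
    have h2 := hb.dx_norm t ht x hx
    have h3 : (0 : ℝ) < x 2 := hx
    nlinarith [abs_add_le (QuasineutralEP.dx 2 a t x) (QuasineutralEP.dx 2 b t x)]

lemma LayerBounds.const_mul {B ε T c : ℝ} (hc : |c| ≤ 1) {a : ScalarField}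
    (ha : LayerBounds B ε T a) : LayerBounds B ε T (fun t x => c * a t x) := by
  have key : ∀ {w r R : ℝ}, 0 ≤ w → w * |r| ≤ R → w * |c * r| ≤ R := by
    intro w r R hw h
    rw [abs_mul]
    refine le_trans ?_ h
    nlinarith [abs_nonneg r, mul_nonneg hw (abs_nonneg r)]
  have key' : ∀ {r R : ℝ}, |r| ≤ R → |c * r| ≤ R := by
    intro r R h
    have := key (w := 1) (r := r) (R := R) one_pos.le (by linarith)
    linarith
  constructor
  · exact ContDiff.mul contDiff_const ha.reg
  · exact fun t ht x hx => key' (ha.val t ht x hx)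
  · intro t ht x hx
    rw [dt_const_mul ha.reg]
    exact key' (ha.dt t ht x hx)
  · intro j hj t ht x hx
    rw [dx_const_mul ha.reg]
    exact key' (ha.dx_tang j hj t ht x hx)
  · intro j t ht x hx
    rw [dx_const_mul ha.reg, abs_mul]
    have h1 := ha.dx_eps j t ht x hx
    rcases le_or_gt 0 ε with hε | hε
    · rw [← abs_mul]; exact key hε h1
    · have h2 : 0 ≤ B := (abs_nonneg _).trans (ha.val t ht x hx)
      have h3 := mul_nonneg (abs_nonneg c) (abs_nonneg (QuasineutralEP.dx j a t x))
      nlinarith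
  · intro t ht x hx
    rw [dx_const_mul ha.reg]
    have h3 : (0 : ℝ) < x 2 := hx
    exact key h3.le (ha.dx_norm t ht x hx)

lemma BddSpace.layerBounds {T : ℝ} {f : ScalarField} (h : BddSpace T f) (ht : BddField T (dt f)) :
    ∃ B, ∀ ε ∈ Ioc (0 : ℝ) 1, LayerBounds B ε T f := by
  obtain ⟨b0, h0⟩ := h.bdd
  obtain ⟨b1, h1⟩ := ht
  choose b hb using h.dx
  set B := |b0| + |b1| + ∑ j, |b j| with hB
  have hb0 : b0 ≤ B := by
    have : 0 ≤ ∑ j, |b j| := Finset.sum_nonneg fun _ _ => abs_nonneg _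
    linarith [le_abs_self b0, abs_nonneg b1]
  have hb1 : b1 ≤ B := by
    have : 0 ≤ ∑ j, |b j| := Finset.sum_nonneg fun _ _ => abs_nonneg _
    linarith [le_abs_self b1, abs_nonneg b0]
  have hbj : ∀ j, b j ≤ B := fun j => by
    have : |b j| ≤ ∑ j, |b j| :=
      Finset.single_le_sum (f := fun j => |b j|) (fun _ _ => abs_nonneg _) (Finset.mem_univ j)
    linarith [le_abs_self (b j), abs_nonneg b0, abs_nonneg b1]
  have hd : ∀ j, ∀ t ∈ Icc 0 T, ∀ x ∈ halfSpace, |QuasineutralEP.dx j f t x| ≤ B :=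
    fun j t ht x hx => (hb j t ht x (halfSpace_subset_closedHalfSpace hx)).trans (hbj j)
  refine ⟨B, fun ε hε => ⟨h.reg, ?_, ?_, ?_, ?_, ?_⟩⟩
  · exact fun t ht x hx => (h0 t ht x (halfSpace_subset_closedHalfSpace hx)).trans hb0
  · exact fun t ht x hx => (h1 t ht x (halfSpace_subset_closedHalfSpace hx)).trans hb1
  · exact fun j _ => hd j
  · intro j t ht x hx
    exact (mul_le_of_le_one_left (abs_nonneg _) hε.2).trans (hd j t ht x hx)
  · intro t ht x hx
    have h3 : (0 : ℝ) < x 2 := hx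
    have := hd 2 t ht x hx
    nlinarith [abs_nonneg (QuasineutralEP.dx 2 f t x)]

/-- This is e^y ≥ y for y = γz. It serves both to absorb the factor x₃/ε in normal derivatives and
to make layers small at a fixed distance from the boundary. -/
lemma mul_exp_neg_le {γ : ℝ} (hγ : 0 < γ) (z : ℝ) : z * Real.exp (-γ * z) ≤ γ⁻¹ := by
  rw [neg_mul]
  have h1 := Real.add_one_le_exp (γ * z)
  have h2 : Real.exp (-(γ * z)) * Real.exp (γ * z) = 1 := by rw [← Real.exp_add]; simp
  have h3 := Real.exp_pos (-(γ * z))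
  rw [← sub_nonneg]
  have : γ⁻¹ - z * Real.exp (-(γ * z))
      = γ⁻¹ * Real.exp (-(γ * z)) * (Real.exp (γ * z) - γ * z) := by
    field_simp
    linear_combination -h2
  rw [this]
  have : 0 ≤ Real.exp (γ * z) - γ * z := by linarith
  positivity

/-- With z = x₃/ε, the weighted normal derivative x₃ ∂₃ of F(t, y, z) equals z ∂_z F, which is
bounded by exponential decay without any loss in ε. -/
lemma LayerDecay.layerBounds {T C γ : ℝ} {F : ScalarField} (h : LayerDecay T F C γ) :
    ∀ ε ∈ Ioc (0 : ℝ) 1, LayerBounds (|C| + |C| * γ⁻¹) ε T (fun t x => F t (stretch ε x)) := by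
  intro ε hε
  have hγ := h.rate
  have hpos : 0 ≤ |C| * γ⁻¹ := by positivity
  have st : ∀ x ∈ halfSpace, stretch ε x ∈ closedHalfSpace := fun x hx =>
    stretch_mem_closedHalfSpace hε.1 (halfSpace_subset_closedHalfSpace hx)
  have bd : ∀ {r : ℝ} {z : E3}, z ∈ closedHalfSpace → |r| ≤ C * Real.exp (-γ * z 2) → |r| ≤ |C| := by
    intro r z hz hr
    have hz' : (0 : ℝ) ≤ z 2 := hz
    have h1 : Real.exp (-γ * z 2) ≤ 1 := Real.exp_le_one_iff.2 (by nlinarith)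
    nlinarith [le_abs_self C, Real.exp_pos (-γ * z 2), abs_nonneg C]
  refine ⟨h.reg.stretch ε, ?_, ?_, ?_, ?_, ?_⟩
  · intro t ht x hx
    linarith [bd (st x hx) (h.val t ht _ (st x hx))]
  · intro t ht x hx
    exact (bd (st x hx) (h.dt t ht _ (st x hx))).trans (by linarith)
  · intro j hj t ht x hx
    rw [dx_stretch h.reg, if_neg hj, one_mul]
    linarith [bd (st x hx) (h.dx j t ht _ (st x hx))]
  · intro j t ht x hx
    rw [dx_stretch h.reg]
    have h1 := bd (st x hx) (h.dx j t ht _ (st x hx))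
    split_ifs
    · rw [abs_mul, ← mul_assoc, abs_of_pos (inv_pos.2 hε.1), mul_inv_cancel₀ hε.1.ne']
      linarith
    · rw [one_mul]
      exact (mul_le_of_le_one_left (abs_nonneg _) hε.2).trans (by linarith)
  · intro t ht x hx
    have h3 : (0 : ℝ) < x 2 := hx
    rw [dx_stretch h.reg, if_pos rfl, abs_mul, abs_of_pos (inv_pos.2 hε.1)]
    have h1 := h.dx 2 t ht _ (st x hx)
    have h2 := mul_exp_neg_le hγ (x 2 / ε)
    have e1 : stretch ε x 2 = x 2 / ε := by simp [stretch]
    rw [e1] at h1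
    have h4 : 0 ≤ x 2 / ε := div_nonneg h3.le hε.1.le
    calc x 2 * (ε⁻¹ * |QuasineutralEP.dx 2 F t (stretch ε x)|)
        = (x 2 / ε) * |QuasineutralEP.dx 2 F t (stretch ε x)| := by ring
      _ ≤ (x 2 / ε) * (C * Real.exp (-γ * (x 2 / ε))) := by gcongr
      _ = C * ((x 2 / ε) * Real.exp (-γ * (x 2 / ε))) := by ring
      _ ≤ |C| * ((x 2 / ε) * Real.exp (-γ * (x 2 / ε))) := by
        gcongr
        exact le_abs_self C
      _ ≤ |C| * γ⁻¹ := by gcongr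
      _ ≤ (|C| + |C| * γ⁻¹) * (1 + x 2) := by nlinarith [abs_nonneg C]

/-- Uniform bounds for one term of a two-scale expansion. -/
lemma layerBounds_term {T : ℝ} {f F : ScalarField} (hf : BddSpace T f) (hft : BddField T (dt f))
    {C γ : ℝ} (hF : LayerDecay T F C γ) :
    ∃ B, ∀ ε ∈ Ioc (0 : ℝ) 1, LayerBounds B ε T (fun t x => f t x + F t (stretch ε x)) := by
  obtain ⟨B, hB⟩ := hf.layerBounds hft
  exact ⟨_, fun ε hε => (hB ε hε).add hε.1 (hF.layerBounds ε hε)⟩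

lemma layerBounds_twoScale {T : ℝ} {K : ℕ} {f F : ℕ → ScalarField}
    (h : ∀ i ≤ K, ∃ B, ∀ ε ∈ Ioc (0 : ℝ) 1,
      LayerBounds B ε T (fun t x => f i t x + F i t (stretch ε x))) :
    ∃ B, ∀ ε ∈ Ioc (0 : ℝ) 1, LayerBounds B ε T (twoScale K f F ε) := by
  induction K with
  | zero =>
    obtain ⟨B, hB⟩ := h 0 le_rfl
    refine ⟨B, fun ε hε => ?_⟩
    have : twoScale 0 f F ε = fun t x => f 0 t x + F 0 t (stretch ε x) := by
      funext t x; simp [twoScale]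
    rw [this]
    exact hB ε hε
  | succ K ih =>
    obtain ⟨B, hB⟩ := ih fun i hi => h i (by omega)
    obtain ⟨B', hB'⟩ := h (K + 1) le_rfl
    refine ⟨B + B', fun ε hε => ?_⟩
    have : twoScale (K + 1) f F ε = fun t x => twoScale K f F ε t x
        + ε ^ (K + 1) * (f (K + 1) t x + F (K + 1) t (stretch ε x)) := by
      funext t x; simp [twoScale, Finset.sum_range_succ _ (K + 1)]
    rw [this]
    refine (hB ε hε).add hε.1 ((hB' ε hε).const_mul ?_)
    rw [abs_of_nonneg (pow_nonneg hε.1.le _)]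
    exact pow_le_one₀ hε.1.le hε.2

/-! ### Positivity and uniform regularity of the approximate solution -/

/-! ### Bounds for the approximate solution -/

/-- The mean value theorem along the normal segment from x to its projection on the boundary. For a
field with zero trace it gives growth at most linear in x₃. -/
lemma abs_sub_trace_le {f : E3 → ℝ} (hf : ContDiff ℝ 1 f) {B : ℝ}
    (hB : ∀ x ∈ halfSpace, |pd 2 f x| ≤ B) {x : E3} (hx : x ∈ halfSpace) :
    |f x - f !₂[x 0, x 1, 0]| ≤ B * x 2 := by
  have hx2 : (0 : ℝ) < x 2 := hx
  have hd := hasDerivAt_line hf 2 x.ofLp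
  have e1 : toE3 (Function.update x.ofLp 2 (x 2)) = x := by
    ext i; simp
  have e0 : toE3 (Function.update x.ofLp 2 0) = !₂[x 0, x 1, 0] := by
    ext i; fin_cases i <;> simp
  obtain ⟨c, hc, h⟩ := exists_hasDerivAt_eq_slope _ _ hx2
    (fun s _ => (hd s).continuousAt.continuousWithinAt) (fun s _ => hd s)
  rw [e1, e0, sub_zero, eq_div_iff hx2.ne'] at h
  rw [← h, abs_mul, abs_of_pos hx2]
  refine mul_le_mul_of_nonneg_right (hB _ ?_) hx2.le
  have : (0 : ℝ) < c := hc.1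
  simpa [halfSpace] using this

/-- A velocity component, bounded with its space derivatives. -/
structure VelBounds (B T : ℝ) (a : ScalarField) : Prop where
  reg : IsCk 1 a
  val : ∀ t ∈ Icc 0 T, ∀ x ∈ halfSpace, |a t x| ≤ B
  dx : ∀ j, ∀ t ∈ Icc 0 T, ∀ x ∈ halfSpace, |dx j a t x| ≤ B

lemma VelBounds.mono {B B' T : ℝ} {a : ScalarField} (h : VelBounds B T a) (hB : B ≤ B') :
    VelBounds B' T a where
  reg := h.reg
  val t ht x hx := (h.val t ht x hx).trans hB
  dx j t ht x hx := (h.dx j t ht x hx).trans hB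

lemma VelBounds.add {B B' T : ℝ} {a b : ScalarField} (ha : VelBounds B T a)
    (hb : VelBounds B' T b) : VelBounds (B + B') T (fun t x => a t x + b t x) where
  reg := ContDiff.add ha.reg hb.reg
  val t ht x hx := (abs_add_le _ _).trans (add_le_add (ha.val t ht x hx) (hb.val t ht x hx))
  dx j t ht x hx := by
    rw [dx_add ha.reg hb.reg]
    exact (abs_add_le _ _).trans (add_le_add (ha.dx j t ht x hx) (hb.dx j t ht x hx))

/-- A factor `ε` compensates the normal derivative of the boundary layer. -/
lemma LayerBounds.velBounds {B ε T : ℝ} (hε : ε ∈ Ioc (0 : ℝ) 1) {a : ScalarField}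
    (h : LayerBounds B ε T a) (i : ℕ) : VelBounds B T (fun t x => ε ^ (i + 1) * a t x) := by
  have hp : ε ^ (i + 1) ≤ ε := by
    rw [pow_succ]
    exact mul_le_of_le_one_left hε.1.le (pow_le_one₀ hε.1.le hε.2)
  have hp0 : 0 ≤ ε ^ (i + 1) := pow_nonneg hε.1.le _
  refine ⟨ContDiff.mul contDiff_const h.reg, fun t ht x hx => ?_, fun j t ht x hx => ?_⟩
  · rw [abs_mul, abs_of_nonneg hp0]
    exact (mul_le_of_le_one_left (abs_nonneg _) (hp.trans hε.2)).trans (h.val t ht x hx)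
  · rw [dx_const_mul h.reg, abs_mul, abs_of_nonneg hp0]
    exact (mul_le_mul_of_nonneg_right hp (abs_nonneg _)).trans (h.dx_eps j t ht x hx)

/-- The order-zero layer vanishes, so every layer present carries a factor ε^i with i ≥ 1, and this
compensates the 1/ε from its normal derivative. Hence the full gradient is bounded, unlike for
density and potential. -/
lemma velBounds_twoScale {T : ℝ} {K : ℕ} {f F : ℕ → ScalarField}
    (h0 : BddSpace T (f 0)) (hF0 : IsCk 1 (F 0))
    (hF : ∀ t ∈ Icc 0 T, ∀ x ∈ closedHalfSpace, F 0 t x = 0)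
    (h : ∀ i, 1 ≤ i → i ≤ K → ∃ B, ∀ ε ∈ Ioc (0 : ℝ) 1,
      LayerBounds B ε T (fun t x => f i t x + F i t (stretch ε x))) :
    ∃ B, ∀ ε ∈ Ioc (0 : ℝ) 1, VelBounds B T (twoScale K f F ε) := by
  induction K with
  | zero =>
    obtain ⟨b0, hb0⟩ := h0.bdd
    choose b hb using h0.dx
    refine ⟨|b0| + ∑ j, |b j|, fun ε hε => ?_⟩
    have e : twoScale 0 f F ε = fun t x => f 0 t x + F 0 t (stretch ε x) := by
      funext t x; simp [twoScale]
    have hz : ∀ t ∈ Icc 0 T, ∀ x ∈ halfSpace, f 0 t x + F 0 t (stretch ε x) = f 0 t x := by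
      intro t ht x hx
      rw [hF t ht _ (stretch_mem_closedHalfSpace hε.1 (halfSpace_subset_closedHalfSpace hx)),
        add_zero]
    rw [e]
    refine ⟨ContDiff.add h0.reg (hF0.stretch ε), fun t ht x hx => ?_, fun j t ht x hx => ?_⟩
    · rw [hz t ht x hx]
      have h1 := hb0 t ht x (halfSpace_subset_closedHalfSpace hx)
      have : 0 ≤ ∑ j, |b j| := Finset.sum_nonneg fun _ _ => abs_nonneg _
      linarith [le_abs_self b0]
    · rw [dx, dx_congr_halfSpace (g := f 0 t) (fun x hx => hz t ht x hx) j hx]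
      have h1 := hb j t ht x (halfSpace_subset_closedHalfSpace hx)
      have : |b j| ≤ ∑ j, |b j| :=
        Finset.single_le_sum (f := fun j => |b j|) (fun _ _ => abs_nonneg _) (Finset.mem_univ j)
      exact h1.trans (by linarith [le_abs_self (b j), abs_nonneg b0])
  | succ K ih =>
    obtain ⟨B, hB⟩ := ih fun i h1 hi => h i h1 (by omega)
    obtain ⟨B', hB'⟩ := h (K + 1) (by omega) le_rfl
    refine ⟨B + B', fun ε hε => ?_⟩
    have : twoScale (K + 1) f F ε = fun t x => twoScale K f F ε t x
        + ε ^ (K + 1) * (f (K + 1) t x + F (K + 1) t (stretch ε x)) := by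
      funext t x; simp [twoScale, Finset.sum_range_succ _ (K + 1)]
    rw [this]
    exact (hB ε hε).add ((hB' ε hε).velBounds hε K)

lemma stretch_of_boundary (ε : ℝ) {x : E3} (hx : x 2 = 0) : stretch ε x = x := by
  ext i; fin_cases i <;> simp [stretch, hx]

/-! ### Bounds for the individual profiles -/

section Profiles

variable {Ti : ℝ} {K m : ℕ} {T : ℝ} {nref φb : E3 → ℝ} {p : Profiles}

lemma IsApproxSolution.bddSpace_n0 (hp : IsApproxSolution Ti K m T nref φb p) (hm : 3 ≤ m) :
    BddSpace T (p.n 0) := by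
  have hn := (hp.n_reg 0 (Nat.zero_le _)).1
  have hr : IsCk (m + 1) (fun _ x => nref x) :=
    ContDiff.comp hp.nref_reg contDiff_snd
  have hd : IsCk (m + 1) (fun t x => p.n 0 t x - nref x) := ContDiff.sub hn hr
  have h1 : BddSpace T (fun t x => p.n 0 t x - nref x) :=
    (hp.n0_sob.mono (by omega)).bddSpace (hd.mono (by omega))
  obtain ⟨B, hB⟩ := hp.nref_bdd
  -- Only the deviation from the reference density is Sobolev; the reference density contributes its
  -- own sup bounds.
  have e : p.n 0 = fun t x => (p.n 0 t x - nref x) + nref x := by funext t x; ring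
  have hr1 := hr.mono (show 1 ≤ m + 1 by omega)
  refine ⟨hn.mono (by omega), ?_, fun j => ?_⟩
  · rw [e]
    exact h1.bdd.add ⟨B, fun t _ x hx => (hB x hx).1⟩
  · refine ((h1.dx j).add ⟨B, fun t _ x hx => (hB x hx).2 j⟩).congr fun t ht x hx => ?_
    conv_lhs => rw [e]
    rw [dx_add h1.reg hr1]
    rfl

lemma IsApproxSolution.bddSpace_u0 (hp : IsApproxSolution Ti K m T nref φb p) (hm : 3 ≤ m)
    (j : Fin 3) : BddSpace T (p.u 0 j) :=
  ((hp.u0_sob j).mono (by omega)).bddSpace ((hp.u_reg 0 (Nat.zero_le _) j).1.mono (by omega))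

lemma dx_mul {f g : ScalarField} (hf : IsCk 1 f) (hg : IsCk 1 g) (j : Fin 3) (t : ℝ) (x : E3) :
    dx j (f * g) t x = dx j f t x * g t x + f t x * dx j g t x :=
  pd_mul (hf.differentiableAt_slice t x) (hg.differentiableAt_slice t x) j

lemma BddField.sum {ι : Type} {s : Finset ι} {f : ι → ScalarField} (h : ∀ i, BddField T (f i)) :
    BddField T (fun t x => ∑ i ∈ s, f i t x) := by
  choose b hb using h
  refine ⟨∑ i ∈ s, b i, fun t ht x hx => ?_⟩
  exact (Finset.abs_sum_le_sum_abs _ _).trans (Finset.sum_le_sum fun i _ => hb i t ht x hx)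

/-- No Sobolev bound is available for this time derivative; the limit continuity equation expresses
it through space derivatives already bounded. -/
lemma IsApproxSolution.bdd_dt_n0 (hp : IsApproxSolution Ti K m T nref φb p) (hT : 0 < T)
    (hm : 3 ≤ m) : BddField T (dt (p.n 0)) := by
  have hn := hp.bddSpace_n0 hm
  have hu := hp.bddSpace_u0 hm
  have h1 : BddField T (fun t x => ∑ j, (dx j (p.n 0) t x * p.u 0 j t x
      + p.n 0 t x * dx j (p.u 0 j) t x)) :=
    BddField.sum fun j => ((hn.dx j).mul (hu j).bdd).add (hn.bdd.mul ((hu j).dx j))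
  obtain ⟨B, hB⟩ := h1
  refine bddField_of_interior (B := B) hT (IsCk.dt (k := 0) hn.reg) fun t ht x hx => ?_
  have h2 := hp.euler_mass t (Ioo_subset_Icc_self ht) x hx
  have h3 := hB t (Ioo_subset_Icc_self ht) x (halfSpace_subset_closedHalfSpace hx)
  simp only [massResidual, div] at h2
  rw [Finset.sum_congr rfl fun j _ => dx_mul hn.reg (hu j).reg j t x] at h2
  rw [eq_neg_of_add_eq_zero_left h2, abs_neg]
  exact h3

/-- Since φ⁰ = −ln n⁰ with n⁰ bounded away from zero, its first derivatives are −∂n⁰/n⁰, and its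
values lie between two logarithms. -/
lemma IsApproxSolution.bdd_φ0 (hp : IsApproxSolution Ti K m T nref φb p) (hT : 0 < T)
    (hm : 3 ≤ m) : BddSpace T (p.φ 0) ∧ BddField T (dt (p.φ 0)) := by
  have hn := hp.bddSpace_n0 hm
  have hnt := hp.bdd_dt_n0 hT hm
  have hφ : IsCk 1 (p.φ 0) := (hp.φ_reg 0 (Nat.zero_le _)).1.mono (by omega)
  obtain ⟨c, hc, hcn⟩ := hp.n0_pos
  have bound : ∀ {g : ScalarField}, BddField T g → ∃ B, ∀ t ∈ Icc 0 T, ∀ x ∈ halfSpace,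
      |-(g t x / p.n 0 t x)| ≤ B := by
    rintro g ⟨B, hB⟩
    refine ⟨B / c, fun t ht x hx => ?_⟩
    have hx' := halfSpace_subset_closedHalfSpace hx
    have h1 := hcn t ht x hx'
    rw [abs_neg, abs_div, abs_of_pos (hc.trans_le h1)]
    have := hB t ht x hx'
    exact div_le_div₀ ((abs_nonneg _).trans this) this hc h1
  refine ⟨⟨hφ, ?_, fun j => ?_⟩, ?_⟩
  · obtain ⟨B, hB⟩ := hn.bdd
    refine ⟨|Real.log c| + |Real.log B|, fun t ht x hx => ?_⟩
    have h1 := hcn t ht x hx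
    have h2 := (abs_le.1 (hB t ht x hx)).2
    have h3 : Real.log c ≤ Real.log (p.n 0 t x) := Real.log_le_log hc h1
    have h4 : Real.log (p.n 0 t x) ≤ Real.log B := Real.log_le_log (hc.trans_le h1) h2
    rw [hp.φ0_eq t ht x hx, abs_neg, abs_le]
    constructor <;> linarith [neg_abs_le (Real.log c), le_abs_self (Real.log B),
      abs_nonneg (Real.log c), abs_nonneg (Real.log B)]
  · obtain ⟨B, hB⟩ := bound (hn.dx j)
    refine bddField_of_interior (B := B) hT (IsCk.dx (k := 0) hφ j) fun t ht x hx => ?_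
    have ht' := Ioo_subset_Icc_self ht
    have hx' := halfSpace_subset_closedHalfSpace hx
    have e : dx j (p.φ 0) t x = -(dx j (p.n 0) t x / p.n 0 t x) := by
      rw [dx, dx_congr_halfSpace (g := fun x => -Real.log (p.n 0 t x))
        (fun y hy => hp.φ0_eq t ht' y (halfSpace_subset_closedHalfSpace hy)) j hx]
      have h5 := ((hn.reg.differentiableAt_slice t x).hasFDerivAt.log
        (hc.trans_le (hcn t ht' x hx')).ne').neg
      have h6 : fderiv ℝ (fun x => -Real.log (p.n 0 t x)) x = _ := h5.fderiv
      rw [pd, h6]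
      simp [dx, pd, div_eq_inv_mul]
    rw [e]
    exact hB t ht' x hx
  · obtain ⟨B, hB⟩ := bound hnt
    refine bddField_of_interior (B := B) hT (IsCk.dt (k := 0) hφ) fun t ht x hx => ?_
    have ht' := Ioo_subset_Icc_self ht
    have hx' := halfSpace_subset_closedHalfSpace hx
    have e : dt (p.φ 0) t x = -(dt (p.n 0) t x / p.n 0 t x) := by
      have h5 := ((hn.reg.hasDerivAt_dt t x).log (hc.trans_le (hcn t ht' x hx')).ne').neg
      have h7 : (fun s => p.φ 0 s x) =ᶠ[𝓝 t] fun s => -Real.log (p.n 0 s x) := by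
        filter_upwards [isOpen_Ioo.mem_nhds ht] with s hs
        exact hp.φ0_eq s (Ioo_subset_Icc_self hs) x hx'
      rw [dt, h7.deriv_eq]
      exact h5.deriv
    rw [e]
    exact hB t ht' x hx

lemma ContSobolev.bdd_of_dt (hm : 3 ≤ m) {f : ScalarField} (hf : IsCk (m + 1) f)
    (h : ContSobolev (m + 3) T f ∧ ContSobolev (m + 2) T (dt f)) :
    BddSpace T f ∧ BddField T (dt f) :=
  ⟨(h.1.mono (by omega)).bddSpace (hf.mono (by omega)),
    (h.2.mono (by omega)).bddField (hf.dt.mono (by omega))⟩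

lemma IsApproxSolution.layer_N (hp : IsApproxSolution Ti K m T nref φb p) {i : ℕ} (hi : i ≤ K) :
    ∃ C γ, LayerDecay T (p.N i) C γ :=
  (hp.layer_decay i hi).1.layerDecay ((hp.n_reg i hi).2.mono (by omega))

lemma IsApproxSolution.layer_Φ (hp : IsApproxSolution Ti K m T nref φb p) {i : ℕ} (hi : i ≤ K) :
    ∃ C γ, LayerDecay T (p.Φ i) C γ :=
  (hp.layer_decay i hi).2.2.layerDecay ((hp.φ_reg i hi).2.mono (by omega))

lemma IsApproxSolution.term_n (hp : IsApproxSolution Ti K m T nref φb p) (hT : 0 < T)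
    (hm : 3 ≤ m) {i : ℕ} (hi : i ≤ K) : ∃ B, ∀ ε ∈ Ioc (0 : ℝ) 1,
      LayerBounds B ε T (fun t x => p.n i t x + p.N i t (stretch ε x)) := by
  obtain ⟨C, γ, hC⟩ := hp.layer_N hi
  rcases Nat.eq_zero_or_pos i with rfl | h1
  · exact layerBounds_term (hp.bddSpace_n0 hm) (hp.bdd_dt_n0 hT hm) hC
  · have := ContSobolev.bdd_of_dt hm (hp.n_reg i hi).1 (hp.n_sob i h1 hi)
    exact layerBounds_term this.1 this.2 hC

lemma IsApproxSolution.term_φ (hp : IsApproxSolution Ti K m T nref φb p) (hT : 0 < T)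
    (hm : 3 ≤ m) {i : ℕ} (hi : i ≤ K) : ∃ B, ∀ ε ∈ Ioc (0 : ℝ) 1,
      LayerBounds B ε T (fun t x => p.φ i t x + p.Φ i t (stretch ε x)) := by
  obtain ⟨C, γ, hC⟩ := hp.layer_Φ hi
  rcases Nat.eq_zero_or_pos i with rfl | h1
  · have := hp.bdd_φ0 hT hm
    exact layerBounds_term this.1 this.2 hC
  · have := ContSobolev.bdd_of_dt hm (hp.φ_reg i hi).1 (hp.φ_sob i h1 hi)
    exact layerBounds_term this.1 this.2 hC

lemma IsApproxSolution.velBounds (hp : IsApproxSolution Ti K m T nref φb p)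
    (hm : 3 ≤ m) (j : Fin 3) : ∃ B, ∀ ε ∈ Ioc (0 : ℝ) 1, VelBounds B T (p.ua K ε j) := by
  refine velBounds_twoScale (hp.bddSpace_u0 hm j)
    ((hp.u_reg 0 (Nat.zero_le _) j).2.mono (by omega)) (fun t ht x hx => hp.U0_eq t ht x hx j) ?_
  intro i h1 hi
  obtain ⟨C, γ, hC⟩ :=
    ((hp.layer_decay i hi).2.1 j).layerDecay ((hp.u_reg i hi j).2.mono (by omega))
  have := ContSobolev.bdd_of_dt hm (hp.u_reg i hi j).1 (hp.u_sob i h1 hi j)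
  exact layerBounds_term this.1 this.2 hC

lemma IsApproxSolution.ua_boundary (hp : IsApproxSolution Ti K m T nref φb p) (ε : ℝ) {t : ℝ}
    (ht : t ∈ Icc 0 T) {x : E3} (hx : x 2 = 0) : p.ua K ε 2 t x = 0 := by
  simp only [Profiles.ua, twoScale]
  refine Finset.sum_eq_zero fun i hi => ?_
  rw [stretch_of_boundary ε hx, hp.bc_u i (by simpa [Nat.lt_succ_iff] using hi) t ht x hx, mul_zero]

/-- The leading term of the density has a positive lower bound for small `ε`. -/
lemma IsApproxSolution.n0_layer_pos (hp : IsApproxSolution Ti K m T nref φb p) (hTi : 0 < Ti)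
    (hm : 3 ≤ m) : ∃ c > 0, ∃ ε₁ > 0, ∀ ε ∈ Ioc (0 : ℝ) ε₁, ∀ t ∈ Icc 0 T, ∀ x ∈ halfSpace,
      c ≤ p.n 0 t x + p.N 0 t (stretch ε x) := by
  obtain ⟨c, hc, hcn⟩ := hp.n0_pos
  obtain ⟨C, γ, hC⟩ := hp.layer_N (Nat.zero_le K)
  obtain ⟨C', γ', hC'⟩ := hp.layer_Φ (Nat.zero_le K)
  have hn := hp.bddSpace_n0 hm
  obtain ⟨L₀, hL₀⟩ := hn.dx 2
  set L := |L₀| + 1 with hLdef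
  have hL : 0 < L := by positivity
  -- By the layer relation, Γn⁰ + N⁰ = Γn⁰ e^{Φ⁰/T^i} is at least 2η. One η is reserved for the
  -- variation of n⁰ between x and its trace.
  set η := c * Real.exp (-|C'| / Ti) / 2 with hη
  have hη0 : 0 < η := by positivity
  have hγ := hC.rate
  -- This threshold makes (|C| + 1) · γ⁻¹ · (δL/η) equal to c/2, so that the layer is at most half
  -- the interior density once L x₃ > η.
  set δ := (c / 2) * (γ * η) / (L * (|C| + 1)) with hδ
  have hδ0 : 0 < δ := by positivity
  refine ⟨min η (c / 2), by positivity, δ, hδ0, fun ε hε t ht x hx => ?_⟩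
  have hx2 : (0 : ℝ) < x 2 := hx
  have hx' := halfSpace_subset_closedHalfSpace hx
  have hst := stretch_mem_closedHalfSpace hε.1 hx'
  have e1 : stretch ε x 2 = x 2 / ε := by simp [stretch]
  have hbd : (!₂[x 0, x 1, 0] : E3) ∈ closedHalfSpace := by simp [closedHalfSpace]
  -- Near the boundary the explicit layer is used and n⁰ is replaced by its trace at cost η. Away
  -- from it, x₃ > η/L is a fixed distance, so the layer is small compared with n⁰.
  rcases le_or_gt (L * x 2) η with hcase | hcase
  · refine (min_le_left _ _).trans ?_
    have h1 := hp.N0_eq t ht _ hst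
    have e2 : (!₂[stretch ε x 0, stretch ε x 1, 0] : E3) = !₂[x 0, x 1, 0] := by simp [stretch]
    rw [e2] at h1
    have h2 := abs_sub_trace_le (hn.reg.slice t) (B := L) (fun z hz =>
      (hL₀ t ht z (halfSpace_subset_closedHalfSpace hz)).trans
        (by linarith [le_abs_self L₀])) hx
    have h3 := (abs_le.1 h2).1
    have h4 := hcn t ht _ hbd
    have h5 : Real.exp (-|C'| / Ti) ≤ Real.exp (p.Φ 0 t (stretch ε x) / Ti) := by
      apply Real.exp_le_exp.2
      have h6 := hC'.val t ht _ hst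
      have h7 : Real.exp (-γ' * stretch ε x 2) ≤ 1 := by
        have h8 : (0 : ℝ) ≤ stretch ε x 2 := hst
        have := hC'.rate
        exact Real.exp_le_one_iff.2 (by nlinarith)
      have h9 : |p.Φ 0 t (stretch ε x)| ≤ |C'| := by
        nlinarith [le_abs_self C', Real.exp_pos (-γ' * stretch ε x 2), abs_nonneg C']
      gcongr
      exact (abs_le.1 h9).1
    have h6 : 2 * η ≤ p.n 0 t !₂[x 0, x 1, 0] * Real.exp (p.Φ 0 t (stretch ε x) / Ti) := by
      have : 2 * η = c * Real.exp (-|C'| / Ti) := by rw [hη]; ring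
      rw [this]
      exact mul_le_mul h4 h5 (Real.exp_nonneg _) (hc.le.trans h4)
    linarith
  · refine (min_le_right _ _).trans ?_
    have h1 := hC.val t ht _ hst
    rw [e1] at h1
    have h2 := mul_exp_neg_le hγ (x 2 / ε)
    have h3 := hcn t ht x hx'
    have h4 : |p.N 0 t (stretch ε x)| ≤ c / 2 := by
      refine h1.trans ?_
      have h5 : Real.exp (-γ * (x 2 / ε)) ≤ γ⁻¹ * (ε / x 2) := by
        have : Real.exp (-γ * (x 2 / ε))
            = (x 2 / ε * Real.exp (-γ * (x 2 / ε))) * (ε / x 2) := by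
          field_simp [hε.1.ne']
        rw [this]
        have := hε.1
        gcongr
      have h6 : ε / x 2 ≤ δ * L / η := by
        rw [div_le_div_iff₀ hx2 hη0]
        calc ε * η ≤ δ * (L * x 2) := mul_le_mul hε.2 hcase.le hη0.le hδ0.le
          _ = δ * L * x 2 := by ring
      calc C * Real.exp (-γ * (x 2 / ε)) ≤ (|C| + 1) * (γ⁻¹ * (δ * L / η)) := by
            refine mul_le_mul (by linarith [le_abs_self C]) (h5.trans ?_) (Real.exp_nonneg _)
              (by positivity)
            gcongr
        _ = c / 2 := by rw [hδ]; field_simp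
    linarith [(abs_le.1 h4).1]

/-- The density of the approximate solution is bounded from below for small `ε`. -/
lemma IsApproxSolution.na_pos (hp : IsApproxSolution Ti K m T nref φb p) (hTi : 0 < Ti)
    (hT : 0 < T) (hm : 3 ≤ m) : ∃ c > 0, ∃ ε₀ ∈ Ioc (0 : ℝ) 1, ∀ ε ∈ Ioc (0 : ℝ) ε₀,
      ∀ t ∈ Icc 0 T, ∀ x ∈ halfSpace, c ≤ p.na K ε t x := by
  obtain ⟨c, hc, ε₁, hε₁, h1⟩ := hp.n0_layer_pos hTi hm
  choose! b hb using fun i (hi : i ≤ K) => hp.term_n hT hm hi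
  -- All correctors of order i ≥ 1 together are at most εS; the bound on ε₀ keeps this below half of
  -- the leading lower bound.
  set S := ∑ i ∈ Finset.range K, |b (i + 1)| with hS
  have hS0 : 0 ≤ S := Finset.sum_nonneg fun _ _ => abs_nonneg _
  refine ⟨c / 2, by positivity, min (min ε₁ 1) (c / 2 / (S + 1)),
    ⟨by positivity, (min_le_left _ _).trans (min_le_right _ _)⟩, fun ε hε t ht x hx => ?_⟩
  have hεa : ε ≤ ε₁ := hε.2.trans ((min_le_left _ _).trans (min_le_left _ _))
  have hεb : ε ≤ 1 := hε.2.trans ((min_le_left _ _).trans (min_le_right _ _))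
  have hεc : ε * (S + 1) ≤ c / 2 := by
    rw [← le_div_iff₀ (by positivity)]
    exact hε.2.trans (min_le_right _ _)
  have h2 := h1 ε ⟨hε.1, hεa⟩ t ht x hx
  have h3 : |∑ i ∈ Finset.range K, ε ^ (i + 1) * (p.n (i + 1) t x
      + p.N (i + 1) t (stretch ε x))| ≤ ε * S := by
    rw [hS, Finset.mul_sum]
    refine (Finset.abs_sum_le_sum_abs _ _).trans (Finset.sum_le_sum fun i hi => ?_)
    have h4 := ((hb (i + 1) (by simpa using hi) ε ⟨hε.1, hεb⟩).velBounds ⟨hε.1, hεb⟩ 0).val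
      t ht x hx
    have h5 := (hb (i + 1) (by simpa using hi) ε ⟨hε.1, hεb⟩).val t ht x hx
    rw [abs_mul, abs_of_nonneg (pow_nonneg hε.1.le _)]
    refine mul_le_mul ?_ (h5.trans (le_abs_self _)) (abs_nonneg _) hε.1.le
    rw [pow_succ]
    exact mul_le_of_le_one_left hε.1.le (pow_le_one₀ hε.1.le hεb)
  have h4 : p.na K ε t x = ∑ i ∈ Finset.range K, ε ^ (i + 1) * (p.n (i + 1) t x
      + p.N (i + 1) t (stretch ε x)) + (p.n 0 t x + p.N 0 t (stretch ε x)) := by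
    simp only [Profiles.na, twoScale]
    rw [Finset.sum_range_succ']
    simp
  rw [h4]
  nlinarith [(abs_le.1 h3).1, hε.1]

/-- Uniform bounds for the background `(na, ua, φa)`. -/
structure BackgroundBounds (B ε T : ℝ) (na : ScalarField) (ua : VectorField) (φa : ScalarField) :
    Prop where
  dens : LayerBounds B ε T na
  pot : LayerBounds B ε T φa
  vel : ∀ j, VelBounds B T (ua j)
  vel_boundary : ∀ t ∈ Icc 0 T, ∀ x : E3, x 2 = 0 → ua 2 t x = 0

theorem IsApproxSolution.exists_bounds (hp : IsApproxSolution Ti K m T nref φb p)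
    (hT : 0 < T) (hm : 3 ≤ m) : ∃ B, 1 ≤ B ∧ ∀ ε ∈ Ioc (0 : ℝ) 1,
      BackgroundBounds B ε T (p.na K ε) (p.ua K ε) (p.φa K ε) := by
  obtain ⟨B1, h1⟩ := layerBounds_twoScale fun i hi => hp.term_n hT hm hi
  obtain ⟨B2, h2⟩ := layerBounds_twoScale fun i hi => hp.term_φ hT hm hi
  choose B3 h3 using hp.velBounds hm
  set B := 1 + |B1| + |B2| + ∑ j, |B3 j| with hB
  have hs : 0 ≤ ∑ j, |B3 j| := Finset.sum_nonneg fun _ _ => abs_nonneg _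
  have hsj : ∀ j, |B3 j| ≤ ∑ j, |B3 j| := fun j =>
    Finset.single_le_sum (f := fun j => |B3 j|) (fun _ _ => abs_nonneg _) (Finset.mem_univ j)
  refine ⟨B, by linarith [abs_nonneg B1, abs_nonneg B2], fun ε hε => ⟨?_, ?_, fun j => ?_, ?_⟩⟩
  · exact (h1 ε hε).mono (by linarith [le_abs_self B1, abs_nonneg B2])
  · exact (h2 ε hε).mono (by linarith [le_abs_self B2, abs_nonneg B1])
  · exact (h3 j ε hε).mono (by linarith [hsj j, le_abs_self (B3 j), abs_nonneg B1, abs_nonneg B2])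
  · exact fun t ht x hx => hp.ua_boundary ε ht hx

end Profiles

/-! ### Differentiation of products and quotients of fields -/

/-- `f` is `C¹` at `(t, x)` with time derivative `ft` and space derivatives `fx`. -/
structure HasD (f : ScalarField) (t : ℝ) (x : E3) (ft : ℝ) (fx : Fin 3 → ℝ) : Prop where
  reg : ContDiffAt ℝ 1 (fun p : ℝ × E3 => f p.1 p.2) (t, x)
  dt : dt f t x = ft
  dx : ∀ j, dx j f t x = fx j

namespace HasD

variable {f g : ScalarField} {t : ℝ} {x : E3} {ft gt : ℝ} {fx gx : Fin 3 → ℝ}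

lemma of_contDiffAt (h : ContDiffAt ℝ 1 (fun p : ℝ × E3 => f p.1 p.2) (t, x)) :
    HasD f t x (QuasineutralEP.dt f t x) (fun j => QuasineutralEP.dx j f t x) :=
  ⟨h, rfl, fun _ => rfl⟩

lemma of_isCk (h : IsCk 1 f) (t : ℝ) (x : E3) :
    HasD f t x (QuasineutralEP.dt f t x) (fun j => QuasineutralEP.dx j f t x) :=
  of_contDiffAt (ContDiff.contDiffAt h)

lemma of_hasFDerivAt (h : ContDiffAt ℝ 1 (fun p : ℝ × E3 => f p.1 p.2) (t, x))
    {f' : ℝ × E3 →L[ℝ] ℝ} (h' : HasFDerivAt (fun p : ℝ × E3 => f p.1 p.2) f' (t, x))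
    (ht : f' (1, 0) = ft) (hx : ∀ j, f' (0, EuclideanSpace.single j 1) = fx j) :
    HasD f t x ft fx :=
  ⟨h, by rw [dt_eq_fderiv h'.differentiableAt, h'.fderiv, ht],
    fun j => by rw [dx_eq_fderiv h'.differentiableAt, h'.fderiv, hx]⟩

lemma hasFDerivAt (h : HasD f t x ft fx) : HasFDerivAt (fun p : ℝ × E3 => f p.1 p.2)
    (fderiv ℝ (fun p : ℝ × E3 => f p.1 p.2) (t, x)) (t, x) :=
  (h.reg.differentiableAt (by norm_num)).hasFDerivAt

lemma fderiv_time (h : HasD f t x ft fx) :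
    fderiv ℝ (fun p : ℝ × E3 => f p.1 p.2) (t, x) (1, 0) = ft := by
  rw [← h.dt, dt_eq_fderiv h.hasFDerivAt.differentiableAt]

lemma fderiv_space (h : HasD f t x ft fx) (j : Fin 3) :
    fderiv ℝ (fun p : ℝ × E3 => f p.1 p.2) (t, x) (0, EuclideanSpace.single j 1) = fx j := by
  rw [← h.dx, dx_eq_fderiv h.hasFDerivAt.differentiableAt]

lemma add (hf : HasD f t x ft fx) (hg : HasD g t x gt gx) :
    HasD (fun t x => f t x + g t x) t x (ft + gt) (fun j => fx j + gx j) :=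
  of_hasFDerivAt (hf.reg.add hg.reg) (hf.hasFDerivAt.fun_add hg.hasFDerivAt)
    (by simp [hf.fderiv_time, hg.fderiv_time]) (fun j => by simp [hf.fderiv_space, hg.fderiv_space])

lemma sub (hf : HasD f t x ft fx) (hg : HasD g t x gt gx) :
    HasD (fun t x => f t x - g t x) t x (ft - gt) (fun j => fx j - gx j) :=
  of_hasFDerivAt (hf.reg.sub hg.reg) (hf.hasFDerivAt.fun_sub hg.hasFDerivAt)
    (by simp [hf.fderiv_time, hg.fderiv_time]) (fun j => by simp [hf.fderiv_space, hg.fderiv_space])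

lemma mul (hf : HasD f t x ft fx) (hg : HasD g t x gt gx) :
    HasD (fun t x => f t x * g t x) t x (ft * g t x + f t x * gt)
      (fun j => fx j * g t x + f t x * gx j) :=
  of_hasFDerivAt (hf.reg.mul hg.reg) (hf.hasFDerivAt.fun_mul hg.hasFDerivAt)
    (by simp [hf.fderiv_time, hg.fderiv_time]; ring)
    (fun j => by simp [hf.fderiv_space, hg.fderiv_space]; ring)

lemma const_mul (c : ℝ) (hf : HasD f t x ft fx) :
    HasD (fun t x => c * f t x) t x (c * ft) (fun j => c * fx j) :=
  of_hasFDerivAt (contDiffAt_const.mul hf.reg) (hf.hasFDerivAt.const_mul c)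
    (by simp [hf.fderiv_time]) (fun j => by simp [hf.fderiv_space])

lemma inv (hf : HasD f t x ft fx) (h0 : f t x ≠ 0) :
    HasD (fun t x => (f t x)⁻¹) t x (-ft * (f t x)⁻¹ ^ 2) (fun j => -fx j * (f t x)⁻¹ ^ 2) :=
  of_hasFDerivAt (hf.reg.inv h0) ((hasFDerivAt_inv h0).comp (t, x) hf.hasFDerivAt)
    (by simp [hf.fderiv_time]) (fun j => by simp [hf.fderiv_space])

end HasD

/-! ### The energy density and its flux -/

section Energy

variable (Ti ε : ℝ) (N : ScalarField) (V : VectorField) (g ρ : ScalarField) (v : VectorField)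
  (ψ r : ScalarField)

def normSq (v : VectorField) : ScalarField :=
  fun t x => v 0 t x * v 0 t x + v 1 t x * v 1 t x + v 2 t x * v 2 t x

/-- The gradient of a scalar field. -/
def grad (ψ : ScalarField) : VectorField := fun j => dx j ψ

/-- `V · ∇ψ`. -/
def advGrad : ScalarField :=
  fun t x => V 0 t x * grad ψ 0 t x + V 1 t x * grad ψ 1 t x + V 2 t x * grad ψ 2 t x

/-- An energy density for the linearized system; after an integration by parts in the Poisson
equation, it is equivalent to `posDensity`. -/
def energyDensity : ScalarField := fun t x =>
  1 / 2 * (N t x * normSq v t x) + Ti / 2 * (ρ t x * ρ t x * (N t x)⁻¹)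
    - (ρ t x + r t x) * ψ t x
    - (ε ^ 2 / 2 * normSq (grad ψ) t x + 1 / 2 * (g t x * (ψ t x * ψ t x)))

/-- The coercive form: compared with `energyDensity`, the cross term in ψ is gone and the two field
terms have changed sign. -/
def posDensity : ScalarField := fun t x =>
  1 / 2 * (N t x * normSq v t x) + Ti / 2 * (ρ t x * ρ t x * (N t x)⁻¹)
    + (ε ^ 2 / 2 * normSq (grad ψ) t x + 1 / 2 * (g t x * (ψ t x * ψ t x)))

/-- The terms in ε² V and ∇ψ are the electrostatic stress obtained from −ε² Δψ V·∇ψ; the last one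
comes from ∂_tψ. Only first derivatives of ψ appear, so the flux is C¹ for ψ of class C². -/
def energyFlux : VectorField := fun j t x =>
  -1 / 2 * (N t x * V j t x * normSq v t x) - Ti * (ρ t x * v j t x)
    - Ti / 2 * (V j t x * (ρ t x * ρ t x * (N t x)⁻¹)) + N t x * v j t x * ψ t x
    + ρ t x * V j t x * ψ t x
    - ε ^ 2 * (grad ψ j t x * advGrad V ψ t x)
    + ε ^ 2 / 2 * (V j t x * normSq (grad ψ) t x)
    + 1 / 2 * (g t x * V j t x * (ψ t x * ψ t x)) - ε ^ 2 * (dt ψ t x * grad ψ j t x)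

def poissonFlux : VectorField := fun j t x => ε ^ 2 * (ψ t x * grad ψ j t x)

variable {Ti ε N V g ρ v ψ r} {t : ℝ} {x : E3}

lemma HasD.normSq {vt : Fin 3 → ℝ} {vx : Fin 3 → Fin 3 → ℝ}
    (h : ∀ j, HasD (v j) t x (vt j) (vx j)) :
    HasD (normSq v) t x (2 * (v 0 t x * vt 0 + v 1 t x * vt 1 + v 2 t x * vt 2))
      (fun j => 2 * (v 0 t x * vx 0 j + v 1 t x * vx 1 j + v 2 t x * vx 2 j)) := by
  have h1 := (((h 0).mul (h 0)).add ((h 1).mul (h 1))).add ((h 2).mul (h 2))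
  refine ⟨h1.reg, h1.dt.trans (by ring), fun j => (h1.dx j).trans (by ring)⟩

lemma HasD.advGrad {Vt : Fin 3 → ℝ} {Vx : Fin 3 → Fin 3 → ℝ} {pt : Fin 3 → ℝ}
    {px : Fin 3 → Fin 3 → ℝ} (h : ∀ j, HasD (V j) t x (Vt j) (Vx j))
    (hp : ∀ j, HasD (grad ψ j) t x (pt j) (px j)) :
    HasD (advGrad V ψ) t x
      ((Vt 0 * grad ψ 0 t x + V 0 t x * pt 0) + (Vt 1 * grad ψ 1 t x + V 1 t x * pt 1)
        + (Vt 2 * grad ψ 2 t x + V 2 t x * pt 2))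
      (fun j => (Vx 0 j * grad ψ 0 t x + V 0 t x * px 0 j)
        + (Vx 1 j * grad ψ 1 t x + V 1 t x * px 1 j)
        + (Vx 2 j * grad ψ 2 t x + V 2 t x * px 2 j)) :=
  (((h 0).mul (hp 0)).add ((h 1).mul (hp 1))).add ((h 2).mul (hp 2))

/-- Regularity of the fields entering the energy. -/
structure EnergyRegular (N : ScalarField) (V : VectorField) (g ρ : ScalarField) (v : VectorField)
    (ψ r : ScalarField) : Prop where
  N : IsCk 1 N
  V : ∀ j, IsCk 1 (V j)
  g : IsCk 1 g
  ρ : IsCk 1 ρ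
  v : ∀ j, IsCk 1 (v j)
  ψ : IsCk 2 ψ
  r : IsCk 1 r

lemma EnergyRegular.hasD_energyDensity (h : EnergyRegular N V g ρ v ψ r) (h0 : N t x ≠ 0) :
    ContDiffAt ℝ 1 (fun p : ℝ × E3 => energyDensity Ti ε N g ρ v ψ r p.1 p.2) (t, x) ∧
    dt (energyDensity Ti ε N g ρ v ψ r) t x =
      N t x * (v 0 t x * dt (v 0) t x + v 1 t x * dt (v 1) t x + v 2 t x * dt (v 2) t x)
      + 1 / 2 * dt N t x * normSq v t x
      + Ti * ρ t x * dt ρ t x * (N t x)⁻¹ - Ti / 2 * ρ t x ^ 2 * dt N t x * (N t x)⁻¹ ^ 2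
      - (dt ρ t x + dt r t x) * ψ t x - (ρ t x + r t x) * dt ψ t x
      - ε ^ 2 * (grad ψ 0 t x * dt (grad ψ 0) t x + grad ψ 1 t x * dt (grad ψ 1) t x
          + grad ψ 2 t x * dt (grad ψ 2) t x)
      - g t x * ψ t x * dt ψ t x - 1 / 2 * dt g t x * ψ t x ^ 2 := by
  have hN := HasD.of_isCk h.N t x
  have hI := hN.inv h0
  have hg := HasD.of_isCk h.g t x
  have hρ := HasD.of_isCk h.ρ t x
  have hr := HasD.of_isCk h.r t x
  have hψ := HasD.of_isCk (h.ψ.mono (by norm_num)) t x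
  have hk := HasD.normSq fun j => HasD.of_isCk (h.v j) t x
  have hw := HasD.normSq fun j => HasD.of_isCk (f := grad ψ j) (h.ψ.dx j) t x
  have := ((((hN.mul hk).const_mul (1 / 2)).add (((hρ.mul hρ).mul hI).const_mul (Ti / 2))).sub
    ((hρ.add hr).mul hψ)).sub
    ((hw.const_mul (ε ^ 2 / 2)).add ((hg.mul (hψ.mul hψ)).const_mul (1 / 2)))
  refine ⟨this.reg, this.dt.trans ?_⟩
  ring

lemma EnergyRegular.hasD_energyFlux (h : EnergyRegular N V g ρ v ψ r) (h0 : N t x ≠ 0)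
    (i : Fin 3) :
    ContDiffAt ℝ 1 (fun p : ℝ × E3 => energyFlux Ti ε N V g ρ v ψ i p.1 p.2) (t, x) ∧
    dx i (energyFlux Ti ε N V g ρ v ψ i) t x =
      -1 / 2 * ((dx i N t x * V i t x + N t x * dx i (V i) t x) * normSq v t x)
      - N t x * V i t x *
        (v 0 t x * dx i (v 0) t x + v 1 t x * dx i (v 1) t x + v 2 t x * dx i (v 2) t x)
      - Ti * (dx i ρ t x * v i t x + ρ t x * dx i (v i) t x)
      - Ti / 2 * (dx i (V i) t x * ρ t x ^ 2 * (N t x)⁻¹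
          + 2 * V i t x * ρ t x * dx i ρ t x * (N t x)⁻¹
          - V i t x * ρ t x ^ 2 * dx i N t x * (N t x)⁻¹ ^ 2)
      + (dx i N t x * v i t x + N t x * dx i (v i) t x) * ψ t x + N t x * v i t x * grad ψ i t x
      + (dx i ρ t x * V i t x + ρ t x * dx i (V i) t x) * ψ t x + ρ t x * V i t x * grad ψ i t x
      - ε ^ 2 * (dx i (grad ψ i) t x * advGrad V ψ t x
        + grad ψ i t x * ((dx i (V 0) t x * grad ψ 0 t x + V 0 t x * dx i (grad ψ 0) t x)
          + (dx i (V 1) t x * grad ψ 1 t x + V 1 t x * dx i (grad ψ 1) t x)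
          + (dx i (V 2) t x * grad ψ 2 t x + V 2 t x * dx i (grad ψ 2) t x)))
      + ε ^ 2 / 2 * (dx i (V i) t x * normSq (grad ψ) t x)
      + ε ^ 2 * (V i t x * (grad ψ 0 t x * dx i (grad ψ 0) t x
          + grad ψ 1 t x * dx i (grad ψ 1) t x + grad ψ 2 t x * dx i (grad ψ 2) t x))
      + 1 / 2 * ((dx i g t x * V i t x + g t x * dx i (V i) t x) * ψ t x ^ 2)
      + g t x * V i t x * ψ t x * grad ψ i t x
      - ε ^ 2 * (dx i (dt ψ) t x * grad ψ i t x + dt ψ t x * dx i (grad ψ i) t x) := by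
  have hN := HasD.of_isCk h.N t x
  have hI := hN.inv h0
  have hg := HasD.of_isCk h.g t x
  have hρ := HasD.of_isCk h.ρ t x
  have hψ := HasD.of_isCk (h.ψ.mono (by norm_num)) t x
  have hψt := HasD.of_isCk (f := dt ψ) h.ψ.dt t x
  have hv := fun j => HasD.of_isCk (h.v j) t x
  have hV := fun j => HasD.of_isCk (h.V j) t x
  have hp := fun j => HasD.of_isCk (f := grad ψ j) (h.ψ.dx j) t x
  have hk := HasD.normSq hv
  have hw := HasD.normSq hp
  have hq := HasD.advGrad hV hp
  have := ((((((((((hN.mul (hV i)).mul hk).const_mul (-1 / 2)).sub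
    ((hρ.mul (hv i)).const_mul Ti)).sub
    (((hV i).mul ((hρ.mul hρ).mul hI)).const_mul (Ti / 2))).add ((hN.mul (hv i)).mul hψ)).add
    ((hρ.mul (hV i)).mul hψ)).sub (((hp i).mul hq).const_mul (ε ^ 2))).add
    (((hV i).mul hw).const_mul (ε ^ 2 / 2))).add
    (((hg.mul (hV i)).mul (hψ.mul hψ)).const_mul (1 / 2))).sub ((hψt.mul (hp i)).const_mul (ε ^ 2))
  refine ⟨this.reg, (this.dx i).trans ?_⟩
  simp only [grad]
  ring

lemma EnergyRegular.hasD_poissonFlux (h : EnergyRegular N V g ρ v ψ r) (i : Fin 3) :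
    ContDiffAt ℝ 1 (fun p : ℝ × E3 => poissonFlux ε ψ i p.1 p.2) (t, x) ∧
    dx i (poissonFlux ε ψ i) t x =
      ε ^ 2 * (grad ψ i t x * grad ψ i t x + ψ t x * dx i (grad ψ i) t x) := by
  have hψ := HasD.of_isCk (h.ψ.mono (by norm_num)) t x
  have := (hψ.mul (HasD.of_isCk (f := grad ψ i) (h.ψ.dx i) t x)).const_mul (ε ^ 2)
  exact ⟨this.reg, this.dx i⟩

/-- Symmetry of the second derivative in space-time covers both exchanges needed below: two space
derivatives, and one time with one space derivative. -/
lemma fderiv_apply_comm {ψ : ScalarField} (h : IsCk 2 ψ) (p a b : ℝ × E3) :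
    fderiv ℝ (fun q => fderiv ℝ (fun p : ℝ × E3 => ψ p.1 p.2) q b) p a
      = fderiv ℝ (fun q => fderiv ℝ (fun p : ℝ × E3 => ψ p.1 p.2) q a) p b := by
  have h' : ContDiff ℝ 2 (fun p : ℝ × E3 => ψ p.1 p.2) := h
  have h1 : Differentiable ℝ (fderiv ℝ (fun p : ℝ × E3 => ψ p.1 p.2)) :=
    (h'.fderiv_right (m := 1) (by norm_num)).differentiable (by norm_num)
  rw [fderiv_clm_apply (h1 p) (by fun_prop), fderiv_clm_apply (h1 p) (by fun_prop)]
  simpa using (h'.contDiffAt.isSymmSndFDerivAt (by simp)) a b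

lemma dx_grad_comm (h : IsCk 2 ψ) (i j : Fin 3) : dx i (grad ψ j) t x = dx j (grad ψ i) t x :=
  congrFun (pd_comm (h.slice t) i j) x

lemma dt_grad (h : IsCk 2 ψ) (i : Fin 3) : dt (grad ψ i) t x = dx i (dt ψ) t x := by
  have hd := IsCk.differentiable (k := 1) h
  rw [dt_eq_fderiv (f := grad ψ i) ((h.dx i).differentiableAt (t, x) :),
    dx_eq_fderiv ((IsCk.dt (k := 1) h).differentiableAt (t, x) :)]
  have e1 : (fun p : ℝ × E3 => grad ψ i p.1 p.2) = fun q =>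
      fderiv ℝ (fun p : ℝ × E3 => ψ p.1 p.2) q (0, EuclideanSpace.single i 1) :=
    funext fun q => dx_eq_fderiv (hd q) i
  have e2 : (fun p : ℝ × E3 => dt ψ p.1 p.2) = fun q =>
      fderiv ℝ (fun p : ℝ × E3 => ψ p.1 p.2) q (1, 0) :=
    funext fun q => dt_eq_fderiv (hd q)
  rw [e1, e2]
  exact fderiv_apply_comm h _ _ _

/-- The production of energy, with `b = ∇na / na`. -/
def energyProduction (Ti ε : ℝ) (N : ScalarField) (V : VectorField) (g ρ : ScalarField)
    (v : VectorField) (ψ r : ScalarField) (ua : VectorField) (b : VectorField) (rn : ScalarField)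
    (ru : VectorField) (t : ℝ) (x : E3) : ℝ :=
  1 / 2 * ((dt N t x + (V 0 t x * dx 0 N t x + V 1 t x * dx 1 N t x + V 2 t x * dx 2 N t x)
      + N t x * (dx 0 (V 0) t x + dx 1 (V 1) t x + dx 2 (V 2) t x)) * normSq v t x)
  - N t x * ∑ j, v j t x * ∑ k, v k t x * dx k (ua j) t x
  + Ti * (ρ t x * ∑ j, v j t x * (b j t x - dx j N t x * (N t x)⁻¹))
  + N t x * ∑ j, v j t x * ru j t x
  - Ti / 2 * (ρ t x ^ 2 * ((dt N t x + (V 0 t x * dx 0 N t x + V 1 t x * dx 1 N t x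
      + V 2 t x * dx 2 N t x)) * (N t x)⁻¹ ^ 2
      + (dx 0 (V 0) t x + dx 1 (V 1) t x + dx 2 (V 2) t x) * (N t x)⁻¹))
  + Ti * (ρ t x * rn t x * (N t x)⁻¹) - ψ t x * rn t x - dt r t x * ψ t x
  - 1 / 2 * ((dt g t x + (V 0 t x * dx 0 g t x + V 1 t x * dx 1 g t x + V 2 t x * dx 2 g t x)
      + g t x * (dx 0 (V 0) t x + dx 1 (V 1) t x + dx 2 (V 2) t x)) * ψ t x ^ 2)
  + r t x * advGrad V ψ t x
  + ε ^ 2 * (∑ j, ∑ k, grad ψ j t x * dx j (V k) t x * grad ψ k t x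
      - 1 / 2 * ((dx 0 (V 0) t x + dx 1 (V 1) t x + dx 2 (V 2) t x) * normSq (grad ψ) t x))

/-- The multipliers are N v for momentum, T^i ρ/N − ψ for mass and (∂_t + V·∇)ψ for Poisson. The
pressure terms combine into div(ρv) with remainder T^i ρ v·(∇N/N − b), and N v·∇ψ joins ψ div(Nv) in
a divergence. In the remaining −ρ V·∇ψ, the Poisson equation replaces ρ by ε²Δψ − gψ − r, giving the
stress, a derivative of ψ², and r V·∇ψ. The last term is why r is measured with the factor 1/ε: only
ε∇ψ is controlled. -/
theorem EnergyRegular.energy_balance (h : EnergyRegular N V g ρ v ψ r) (h0 : N t x ≠ 0)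
    {ua b : VectorField} {rn : ScalarField} {ru : VectorField}
    (mass : dt ρ t x + ∑ j, V j t x * dx j ρ t x + N t x * ∑ j, dx j (v j) t x
      + ∑ j, v j t x * dx j N t x + ρ t x * ∑ j, dx j (V j) t x = rn t x)
    (mom : ∀ j, dt (v j) t x + ∑ k, V k t x * dx k (v j) t x + ∑ k, v k t x * dx k (ua j) t x
      + Ti * (dx j ρ t x * (N t x)⁻¹ - b j t x * (ρ t x * (N t x)⁻¹)) = grad ψ j t x + ru j t x)
    (poisson : ε ^ 2 * ∑ j, dx j (grad ψ j) t x = ρ t x + g t x * ψ t x + r t x) :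
    dt (energyDensity Ti ε N g ρ v ψ r) t x
      = ∑ j, dx j (energyFlux Ti ε N V g ρ v ψ j) t x
        + energyProduction Ti ε N V g ρ v ψ r ua b rn ru t x := by
  have hI : N t x * (N t x)⁻¹ = 1 := mul_inv_cancel₀ h0
  have m0 := mom 0
  have m1 := mom 1
  have m2 := mom 2
  rw [(h.hasD_energyDensity h0).2]
  simp only [Fin.sum_univ_three] at *
  rw [(h.hasD_energyFlux h0 0).2, (h.hasD_energyFlux h0 1).2, (h.hasD_energyFlux h0 2).2]
  simp only [energyProduction, Fin.sum_univ_three, dt_grad h.ψ]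
  rw [dx_grad_comm h.ψ 1 0, dx_grad_comm h.ψ 2 0, dx_grad_comm h.ψ 2 1]
  simp only [normSq, advGrad]
  -- The inverse becomes a free variable I subject only to N I = 1; this relation is used for
  -- products of the momentum multiplier, or of N div v, with I.
  generalize (N t x)⁻¹ = I at *
  linear_combination (N t x * v 0 t x) * m0 + (N t x * v 1 t x) * m1 + (N t x * v 2 t x) * m2
    + (Ti * ρ t x * I - ψ t x) * mass
    + (dt ψ t x + (V 0 t x * grad ψ 0 t x + V 1 t x * grad ψ 1 t x + V 2 t x * grad ψ 2 t x))
        * poisson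
    + (-(Ti * ρ t x * (dx 0 (v 0) t x + dx 1 (v 1) t x + dx 2 (v 2) t x))
      - Ti * (v 0 t x * dx 0 ρ t x + v 1 t x * dx 1 ρ t x + v 2 t x * dx 2 ρ t x)
      + Ti * ρ t x * (v 0 t x * b 0 t x + v 1 t x * b 1 t x + v 2 t x * b 2 t x)) * hI

/-- Multiply the Poisson equation by ψ: −(ρ + r)ψ equals ε²|∇ψ|² + gψ² minus the divergence of
ε²ψ∇ψ. This reverses the signs of the two field terms. -/
theorem EnergyRegular.posDensity_eq (h : EnergyRegular N V g ρ v ψ r)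
    (poisson : ε ^ 2 * ∑ j, dx j (grad ψ j) t x = ρ t x + g t x * ψ t x + r t x) :
    posDensity Ti ε N g ρ v ψ t x
      = energyDensity Ti ε N g ρ v ψ r t x + ∑ j, dx j (poissonFlux ε ψ j) t x := by
  simp only [Fin.sum_univ_three] at *
  rw [(h.hasD_poissonFlux 0).2, (h.hasD_poissonFlux 1).2, (h.hasD_poissonFlux 2).2]
  simp only [posDensity, energyDensity, normSq]
  linear_combination -ψ t x * poisson

end Energy

/-! ### Bounds for the production of energy -/

/-- The square of `(ρ, v, ψ, ε∇ψ)`. -/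
def energySqDensity (ε : ℝ) (ρ : ScalarField) (v : VectorField) (ψ : ScalarField) : ScalarField :=
  fun t x => ρ t x ^ 2 + ∑ j, v j t x ^ 2 + ψ t x ^ 2 + ∑ j, (ε * dx j ψ t x) ^ 2

/-- The square of `(r/ε, ∂ₜr, rn, ru)`. -/
def sourceSqDensity (ε : ℝ) (rn : ScalarField) (ru : VectorField) (r : ScalarField) : ScalarField :=
  fun t x => (ε⁻¹ * r t x) ^ 2 + dt r t x ^ 2 + rn t x ^ 2 + ∑ j, ru j t x ^ 2

lemma mul_mul_le_of_abs_le {c P a b : ℝ} (h : |c| ≤ P) : c * (a * b) ≤ P * (a ^ 2 + b ^ 2) := by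
  have h1 : |a * b| ≤ a ^ 2 + b ^ 2 := by
    rw [abs_le]; constructor <;> nlinarith [sq_nonneg (a + b), sq_nonneg (a - b), sq_nonneg a,
      sq_nonneg b]
  calc c * (a * b) ≤ |c * (a * b)| := le_abs_self _
    _ = |c| * |a * b| := abs_mul _ _
    _ ≤ P * (a ^ 2 + b ^ 2) := mul_le_mul h h1 (abs_nonneg _) ((abs_nonneg _).trans h)

/-- Young's inequality with coefficient 1 on b², whatever the size of c. Taking b to be a source
keeps the constant C₁ independent of the profiles. -/
lemma mul_le_sq_add {c P a b : ℝ} (h : c ^ 2 ≤ P) : c * (a * b) ≤ b ^ 2 + P * a ^ 2 := by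
  nlinarith [sq_nonneg (c * a - b), sq_nonneg (c * a), sq_nonneg b,
    mul_le_mul_of_nonneg_right h (sq_nonneg a)]

lemma abs_mul_le_mul_of_le {a b A B : ℝ} (ha : |a| ≤ A) (hb : |b| ≤ B) : |a * b| ≤ A * B := by
  rw [abs_mul]
  exact mul_le_mul ha hb (abs_nonneg _) ((abs_nonneg _).trans ha)

/-- Each term is bilinear. Products of two unknowns take the bound P = K⁴d on both factors; products
with a source use `mul_le_sq_add`. The source constant 3 is reached because (r/ε)² occurs once for
each component of V·∇ψ; the constant 30 is a crude count. -/
theorem energyProduction_le {Ti ε K d : ℝ} (hK : 1 ≤ K) (hd : 1 ≤ d) (hε : 0 < ε)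
    {N g ρ ψ r rn : ScalarField} {V v ua b ru : VectorField} {t : ℝ} {x : E3} (hTi : |Ti| ≤ K)
    (hα : |dt N t x + (V 0 t x * dx 0 N t x + V 1 t x * dx 1 N t x + V 2 t x * dx 2 N t x)
      + N t x * (dx 0 (V 0) t x + dx 1 (V 1) t x + dx 2 (V 2) t x)| ≤ K * d)
    (hua : ∀ j k, |dx k (ua j) t x| ≤ K) (hN : |N t x| ≤ K) (hI : |(N t x)⁻¹| ≤ K)
    (hb : ∀ j, |b j t x - dx j N t x * (N t x)⁻¹| ≤ K * d)
    (hβ : |(dt N t x + (V 0 t x * dx 0 N t x + V 1 t x * dx 1 N t x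
      + V 2 t x * dx 2 N t x)) * (N t x)⁻¹ ^ 2
      + (dx 0 (V 0) t x + dx 1 (V 1) t x + dx 2 (V 2) t x) * (N t x)⁻¹| ≤ K * d)
    (hγ : |(dt g t x + (V 0 t x * dx 0 g t x + V 1 t x * dx 1 g t x + V 2 t x * dx 2 g t x)
      + g t x * (dx 0 (V 0) t x + dx 1 (V 1) t x + dx 2 (V 2) t x))| ≤ K * d)
    (hV : ∀ j, |V j t x| ≤ K) (hVx : ∀ j k, |dx j (V k) t x| ≤ K * d) :
    energyProduction Ti ε N V g ρ v ψ r ua b rn ru t x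
      ≤ 3 * sourceSqDensity ε rn ru r t x + 30 * (K ^ 4 * d) * energySqDensity ε ρ v ψ t x := by
  set P := K ^ 4 * d with hP
  have k2 : 1 ≤ K ^ 2 := one_le_pow₀ hK
  have k3 : K ≤ K ^ 4 := by
    calc K = K ^ 1 := (pow_one K).symm
      _ ≤ K ^ 4 := pow_le_pow_right₀ hK (by norm_num)
  have k4 : K ^ 2 ≤ K ^ 4 := pow_le_pow_right₀ hK (by norm_num)
  have p1 : K * d ≤ P := mul_le_mul_of_nonneg_right k3 (by linarith)
  have p2 : K ^ 2 * d ≤ P := mul_le_mul_of_nonneg_right k4 (by linarith)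
  have p4 : K ^ 4 ≤ P := by rw [hP]; nlinarith
  have p0 : 1 ≤ P := by linarith
  have c1 := hα.trans p1
  have c2 : ∀ j k, |-(N t x * dx k (ua j) t x)| ≤ P := fun j k => by
    rw [abs_neg]
    exact (abs_mul_le_mul_of_le hN (hua j k)).trans (by nlinarith)
  have c3 : ∀ j, |Ti * (b j t x - dx j N t x * (N t x)⁻¹)| ≤ P := fun j =>
    (abs_mul_le_mul_of_le hTi (hb j)).trans (by nlinarith)
  have c4 : N t x ^ 2 ≤ P := by
    rw [← sq_abs]
    exact (pow_le_pow_left₀ (abs_nonneg _) hN 2).trans (k4.trans p4)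
  have c5 : |-(Ti * ((dt N t x + (V 0 t x * dx 0 N t x + V 1 t x * dx 1 N t x
      + V 2 t x * dx 2 N t x)) * (N t x)⁻¹ ^ 2
      + (dx 0 (V 0) t x + dx 1 (V 1) t x + dx 2 (V 2) t x) * (N t x)⁻¹))| ≤ P := by
    rw [abs_neg]
    exact (abs_mul_le_mul_of_le hTi hβ).trans (by nlinarith)
  have c6 : (Ti * (N t x)⁻¹) ^ 2 ≤ P := by
    rw [← sq_abs]
    refine (pow_le_pow_left₀ (abs_nonneg _) (abs_mul_le_mul_of_le hTi hI) 2).trans ?_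
    calc (K * K) ^ 2 = K ^ 4 := by ring
      _ ≤ P := p4
  have c9 := hγ.trans p1
  have c10 : ∀ j, (V j t x) ^ 2 ≤ P := fun j => by
    rw [← sq_abs]
    exact (pow_le_pow_left₀ (abs_nonneg _) (hV j) 2).trans (k4.trans p4)
  have c11 : ∀ j k, |dx j (V k) t x| ≤ P := fun j k => (hVx j k).trans p1
  -- the individual terms
  have t1 : ∀ j, _ := fun j => mul_mul_le_of_abs_le (a := v j t x) (b := v j t x) c1
  have t2 : ∀ j k, _ := fun j k => mul_mul_le_of_abs_le (a := v j t x) (b := v k t x) (c2 j k)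
  have t3 : ∀ j, _ := fun j => mul_mul_le_of_abs_le (a := ρ t x) (b := v j t x) (c3 j)
  have t4 : ∀ j, _ := fun j => mul_le_sq_add (a := v j t x) (b := ru j t x) c4
  have t5 := mul_mul_le_of_abs_le (a := ρ t x) (b := ρ t x) c5
  have t6 := mul_le_sq_add (a := ρ t x) (b := rn t x) c6
  have t7 := mul_le_sq_add (c := -1) (a := ψ t x) (b := rn t x) (by linarith : (-1) ^ 2 ≤ P)
  have t8 := mul_le_sq_add (c := -1) (a := ψ t x) (b := dt r t x) (by linarith : (-1) ^ 2 ≤ P)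
  have t9 := mul_mul_le_of_abs_le (a := ψ t x) (b := ψ t x)
    ((abs_neg _).trans_le c9)
  have t10 : ∀ j, _ := fun j => mul_le_sq_add (a := ε * dx j ψ t x) (b := ε⁻¹ * r t x) (c10 j)
  have t11 : ∀ j k, _ := fun j k => mul_mul_le_of_abs_le (a := ε * dx j ψ t x)
    (b := ε * dx k ψ t x) (c11 j k)
  have t12 : ∀ j k, _ := fun j k => mul_mul_le_of_abs_le (a := ε * dx k ψ t x)
    (b := ε * dx k ψ t x) ((abs_neg _).trans_le (c11 j j))
  have e10 : ∀ j, V j t x * (ε * dx j ψ t x * (ε⁻¹ * r t x)) = V j t x * dx j ψ t x * r t x := by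
    intro j; field_simp
  simp only [e10] at t10
  simp only [energyProduction, energySqDensity, sourceSqDensity, normSq, advGrad, grad,
    Fin.sum_univ_three]
  have q : ∀ y : ℝ, 0 ≤ P * y ^ 2 := fun y => by positivity
  linarith [t1 0, t1 1, t1 2, t2 0 0, t2 0 1, t2 0 2, t2 1 0, t2 1 1, t2 1 2, t2 2 0, t2 2 1,
    t2 2 2, t3 0, t3 1, t3 2, t4 0, t4 1, t4 2, t5, t6, t7, t8, t9, t10 0, t10 1, t10 2, t11 0 0,
    t11 0 1, t11 0 2, t11 1 0, t11 1 1, t11 1 2, t11 2 0, t11 2 1, t11 2 2, t12 0 0, t12 0 1,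
    t12 0 2, t12 1 0, t12 1 1, t12 1 2, t12 2 0, t12 2 1, t12 2 2, q (ρ t x), q (ψ t x),
    q (v 0 t x), q (v 1 t x), q (v 2 t x), q (ε * dx 0 ψ t x), q (ε * dx 1 ψ t x),
    q (ε * dx 2 ψ t x), sq_nonneg (rn t x), sq_nonneg (dt r t x), sq_nonneg (ru 0 t x),
    sq_nonneg (ru 1 t x), sq_nonneg (ru 2 t x), sq_nonneg (ε⁻¹ * r t x)]

/-! ### The nonlinearities `h₀`, `h₁` -/

lemma contDiff_h1 : ContDiff ℝ 1 h1 := by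
  unfold h1; fun_prop

/-- The numerator e^{-φ} − 1 + φ vanishes at 0 with its derivative, so its divided difference at 0
extends the quotient by the value 0. Smoothness at the origin then follows from analyticity. -/
lemma h0_eq_dslope : h0 = fun φ => -dslope (fun φ : ℝ => Real.exp (-φ) - 1 + φ) 0 φ := by
  funext φ
  rcases eq_or_ne φ 0 with rfl | hφ
  · have h1 : HasDerivAt (fun φ : ℝ => Real.exp (-φ) - 1 + φ) (Real.exp (-0) * (-1) + 1) 0 :=
      (((hasDerivAt_neg (0 : ℝ)).exp).sub_const 1).add (hasDerivAt_id 0)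
    simp [h0, dslope_same, h1.deriv]
  · simp [h0, dslope_of_ne _ hφ, slope_def_field]

lemma contDiff_h0 : ContDiff ℝ 1 h0 := by
  rw [h0_eq_dslope, contDiff_iff_contDiffAt]
  intro φ
  refine ContDiffAt.neg ?_
  rcases eq_or_ne φ 0 with rfl | hφ
  · have h1 : AnalyticAt ℝ (fun φ : ℝ => Real.exp (-φ) - 1 + φ) 0 := by fun_prop
    obtain ⟨p, hp⟩ := h1
    exact hp.has_fpower_series_dslope_fslope.analyticAt.contDiffAt
  · have h1 : ContDiffAt ℝ 1 (fun φ : ℝ => (φ - 0)⁻¹ * (Real.exp (-φ) - 1 + φ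
        - (Real.exp (-0) - 1 + 0))) φ := by
      have h2 : ContDiffAt ℝ 1 (fun φ : ℝ => (φ - 0)⁻¹) φ :=
        ContDiffAt.inv (by fun_prop) (by simpa using hφ)
      exact h2.mul (by fun_prop)
    refine h1.congr_of_eventuallyEq ?_
    filter_upwards [isOpen_ne.mem_nhds hφ] with y hy
    rw [dslope_of_ne _ hy]
    simp [slope, vsub_eq_sub]

lemma exists_bound_of_contDiff {h : ℝ → ℝ} (hh : ContDiff ℝ 1 h) (M : ℝ) :
    ∃ H, ∀ φ, |φ| ≤ M → |h φ| ≤ H ∧ |deriv h φ| ≤ H := by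
  obtain ⟨a, ha⟩ := (isCompact_Icc (a := -M) (b := M)).exists_bound_of_continuousOn
    hh.continuous.continuousOn
  obtain ⟨b, hb⟩ := (isCompact_Icc (a := -M) (b := M)).exists_bound_of_continuousOn
    (hh.continuous_deriv (by norm_num)).continuousOn
  refine ⟨max a b, fun φ hφ => ⟨?_, ?_⟩⟩
  · exact (ha φ (abs_le.1 hφ)).trans (le_max_left _ _)
  · exact (hb φ (abs_le.1 hφ)).trans (le_max_right _ _)

lemma HasD.comp {F : ℝ → ℝ} (hF : ContDiff ℝ 1 F) {f : ScalarField} {t : ℝ} {x : E3} {ft : ℝ}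
    {fx : Fin 3 → ℝ} (hf : HasD f t x ft fx) :
    HasD (fun t x => F (f t x)) t x (deriv F (f t x) * ft) (fun j => deriv F (f t x) * fx j) :=
  of_hasFDerivAt (hF.contDiffAt.comp (t, x) hf.reg)
    (((hF.differentiable (by norm_num) (f t x)).hasDerivAt).comp_hasFDerivAt (t, x) hf.hasFDerivAt)
    (by simp [hf.fderiv_time]) (fun j => by simp [hf.fderiv_space])

/-- The coefficient of `φ̇` in the Poisson equation. -/
def poissonCoeff (h : ℝ → ℝ) (φa φ : ScalarField) : ScalarField :=
  fun t x => Real.exp (-φa t x) * (1 + h (φ t x))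

lemma isCk_poissonCoeff {h : ℝ → ℝ} (hh : ContDiff ℝ 1 h) {φa φ : ScalarField} (ha : IsCk 1 φa)
    (hφ : IsCk 1 φ) : IsCk 1 (poissonCoeff h φa φ) := by
  have h1 : ContDiff ℝ 1 (fun p : ℝ × E3 => φa p.1 p.2) := ha
  have h2 : ContDiff ℝ 1 (fun p : ℝ × E3 => φ p.1 p.2) := hφ
  exact ContDiff.mul (Real.contDiff_exp.comp h1.neg) (contDiff_const.add (hh.comp h2))

lemma hasD_poissonCoeff {h : ℝ → ℝ} (hh : ContDiff ℝ 1 h) {φa φ : ScalarField} (ha : IsCk 1 φa)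
    (hφ : IsCk 1 φ) (t : ℝ) (x : E3) :
    HasD (poissonCoeff h φa φ) t x
      (-dt φa t x * poissonCoeff h φa φ t x
        + Real.exp (-φa t x) * (deriv h (φ t x) * dt φ t x))
      (fun j => -dx j φa t x * poissonCoeff h φa φ t x
        + Real.exp (-φa t x) * (deriv h (φ t x) * dx j φ t x)) := by
  have hE : ContDiff ℝ 1 (fun y : ℝ => Real.exp (-y)) := by fun_prop
  have hE' : ∀ y : ℝ, deriv (fun y : ℝ => Real.exp (-y)) y = -Real.exp (-y) := by
    intro y
    have := ((hasDerivAt_neg y).exp).deriv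
    rw [this]; ring
  have hH : ContDiff ℝ 1 (fun y : ℝ => 1 + h y) := contDiff_const.add hh
  have hH' : ∀ y : ℝ, deriv (fun y : ℝ => 1 + h y) y = deriv h y := by
    intro y; simp
  have := (HasD.comp hE (HasD.of_isCk ha t x)).mul (HasD.comp hH (HasD.of_isCk hφ t x))
  refine ⟨this.reg, this.dt.trans ?_, fun j => (this.dx j).trans ?_⟩
  · simp only [hE', hH', poissonCoeff]; ring
  · simp only [hE', hH', poissonCoeff]; ring

/-! ### Bounds on the perturbed background -/

/-- Bounds on the perturbation at time `t` with a constant `d` for derivatives. -/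
structure PerturbationBounds (M d ε : ℝ) (n : ScalarField) (u : VectorField) (φ : ScalarField)
    (t : ℝ) : Prop where
  n_val : ∀ x ∈ halfSpace, |n t x| ≤ M
  u_val : ∀ j, ∀ x ∈ halfSpace, |u j t x| ≤ M
  φ_val : ∀ x ∈ halfSpace, |φ t x| ≤ M
  n_eps : ∀ x ∈ halfSpace, |n t x| ≤ ε * d
  n_dt : ∀ x ∈ halfSpace, |dt n t x| ≤ d
  n_dx : ∀ j, ∀ x ∈ halfSpace, |dx j n t x| ≤ d
  u_dx : ∀ k j, ∀ x ∈ halfSpace, |dx k (u j) t x| ≤ d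
  φ_dt : ∀ x ∈ halfSpace, |dt φ t x| ≤ d
  φ_dx : ∀ j, ∀ x ∈ halfSpace, |dx j φ t x| ≤ d

/-- A velocity tangent to the boundary differentiates a layer without loss. -/
lemma LayerBounds.abs_transport_le {B ε T L d : ℝ} {a : ScalarField} (ha : LayerBounds B ε T a)
    (hL : 1 ≤ L) (hd : 1 ≤ d) (hB : B ≤ L) {t : ℝ} (ht : t ∈ Icc 0 T) {x : E3} (hx : x ∈ halfSpace)
    {V : Fin 3 → ℝ} (hV : ∀ j, |V j| ≤ 2 * L) (hV2 : |V 2| ≤ (2 * L * d) * x 2) :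
    |V 0 * dx 0 a t x + V 1 * dx 1 a t x + V 2 * dx 2 a t x| ≤ 12 * (L ^ 2 * d) := by
  have hx2 : (0 : ℝ) < x 2 := hx
  have hLd : L ^ 2 ≤ L ^ 2 * d := by nlinarith [sq_nonneg L]
  have h0 := abs_mul_le_mul_of_le (hV 0) ((ha.dx_tang 0 (by decide) t ht x hx).trans hB)
  have h1 := abs_mul_le_mul_of_le (hV 1) ((ha.dx_tang 1 (by decide) t ht x hx).trans hB)
  have h3 := ha.dx_norm t ht x hx
  have h2 : |V 2 * dx 2 a t x| ≤ 4 * (L ^ 2 * d) := by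
    rw [abs_mul]
    -- For x₃ ≥ 1 the weighted bound already controls ∂₃a and the size of V₃ suffices. For x₃ < 1
    -- the linear vanishing of V₃ supplies the weight x₃.
    rcases le_or_gt 1 (x 2) with hc | hc
    · have h4 : |dx 2 a t x| ≤ 2 * L := by
        have : 0 ≤ B := (abs_nonneg _).trans (ha.val t ht x hx)
        have h5 : x 2 * |dx 2 a t x| ≤ x 2 * (2 * L) := h3.trans (by nlinarith)
        exact le_of_mul_le_mul_left h5 hx2
      calc |V 2| * |dx 2 a t x| ≤ (2 * L) * (2 * L) :=
            mul_le_mul (hV 2) h4 (abs_nonneg _) (by linarith)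
        _ ≤ 4 * (L ^ 2 * d) := by nlinarith
    · have h4 : x 2 * |dx 2 a t x| ≤ 2 * L := by
        have : 0 ≤ B := (abs_nonneg _).trans (ha.val t ht x hx)
        exact h3.trans (by nlinarith)
      calc |V 2| * |dx 2 a t x| ≤ ((2 * L * d) * x 2) * |dx 2 a t x| :=
            mul_le_mul_of_nonneg_right hV2 (abs_nonneg _)
        _ = (2 * L * d) * (x 2 * |dx 2 a t x|) := by ring
        _ ≤ (2 * L * d) * (2 * L) := mul_le_mul_of_nonneg_left h4 (by positivity)
        _ = 4 * (L ^ 2 * d) := by ring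
  have := abs_add_three (V 0 * dx 0 a t x) (V 1 * dx 1 a t x) (V 2 * dx 2 a t x)
  nlinarith

lemma abs_dot_le {a b : Fin 3 → ℝ} {A B : ℝ} (ha : ∀ j, |a j| ≤ A) (hb : ∀ j, |b j| ≤ B) :
    |a 0 * b 0 + a 1 * b 1 + a 2 * b 2| ≤ 3 * (A * B) := by
  have := abs_add_three (a 0 * b 0) (a 1 * b 1) (a 2 * b 2)
  linarith [abs_mul_le_mul_of_le (ha 0) (hb 0), abs_mul_le_mul_of_le (ha 1) (hb 1),
    abs_mul_le_mul_of_le (ha 2) (hb 2)]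

/-- It remains to see that every coefficient is O(d) uniformly in ε. Transport of N and g loses
nothing because V is tangent to the boundary; the mismatch between ∇n_a/n_a and ∇N/N is controlled
by |n| ≤ εd; and u_a has bounded gradient. -/
theorem energyProduction_le_of_bounds {Ti ε T B M L d : ℝ} (hε : 0 < ε) (hL : 1 ≤ L) (hd : 1 ≤ d)
    (hTi : |Ti| ≤ L) (hB : B ≤ L) (hM : M ≤ L) (hexp : Real.exp B ≤ L)
    {na φa n φ ρ ψ r rn : ScalarField} {ua u v ru : VectorField} {h : ℝ → ℝ}
    (hh : ContDiff ℝ 1 h) (hhL : ∀ φ, |φ| ≤ M → |h φ| ≤ L ∧ |deriv h φ| ≤ L)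
    (hbg : BackgroundBounds B ε T na ua φa) {t : ℝ} (ht : t ∈ Icc 0 T)
    (hp : PerturbationBounds M d ε n u φ t) (hn : IsCk 1 n) (hu : ∀ j, IsCk 1 (u j))
    (hφ : IsCk 1 φ) (hu0 : ∀ x : E3, x 2 = 0 → u 2 t x = 0) {x : E3} (hx : x ∈ halfSpace)
    (hna : L⁻¹ ≤ na t x) (hN : L⁻¹ ≤ na t x + n t x) :
    energyProduction Ti ε (fun t x => na t x + n t x) (fun j t x => ua j t x + u j t x)
        (poissonCoeff h φa φ) ρ v ψ r ua (fun j t x => dx j na t x / na t x) rn ru t x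
      ≤ 3 * sourceSqDensity ε rn ru r t x
        + 30 * ((45 * L ^ 4) ^ 4 * d) * energySqDensity ε ρ v ψ t x := by
  have hL0 : 0 < L := by linarith
  have hx2 : (0 : ℝ) < x 2 := hx
  have hLd : L ≤ L * d := by nlinarith
  have l12 : L * d ≤ L ^ 2 * d := by nlinarith
  have l23 : L ^ 2 * d ≤ L ^ 3 * d := by
    have : 0 ≤ L ^ 2 * d := by positivity
    nlinarith
  have l34 : L ^ 3 * d ≤ L ^ 4 * d := by
    have : 0 ≤ L ^ 3 * d := by positivity
    nlinarith
  have l1 : L ≤ L ^ 4 := by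
    calc L = L ^ 1 := (pow_one L).symm
      _ ≤ L ^ 4 := pow_le_pow_right₀ hL (by norm_num)
  set I := (na t x + n t x)⁻¹ with hI
  have hN0 : 0 < na t x + n t x := (inv_pos.2 hL0).trans_le hN
  have hna0 : 0 < na t x := (inv_pos.2 hL0).trans_le hna
  have bI : |I| ≤ L := by
    rw [abs_of_pos (inv_pos.2 hN0)]
    exact inv_le_of_inv_le₀ hL0 hN
  have bna : |(na t x)⁻¹| ≤ L := by
    rw [abs_of_pos (inv_pos.2 hna0)]
    exact inv_le_of_inv_le₀ hL0 hna
  -- the velocity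
  have bV : ∀ j, |ua j t x + u j t x| ≤ 2 * L := fun j =>
    (abs_add_le _ _).trans (by linarith [(hbg.vel j).val t ht x hx, hp.u_val j x hx])
  have bV2 : |ua 2 t x + u 2 t x| ≤ (2 * L * d) * x 2 := by
    have e0 : ∀ f : ScalarField, (∀ z : E3, z 2 = 0 → f t z = 0) →
        f t !₂[x 0, x 1, 0] = 0 := fun f hf => hf _ (by simp)
    have h1 := abs_sub_trace_le ((hbg.vel 2).reg.slice t)
      (fun z hz => (hbg.vel 2).dx 2 t ht z hz) hx
    have h2 := abs_sub_trace_le ((hu 2).slice t) (fun z hz => hp.u_dx 2 2 z hz) hx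
    rw [e0 (ua 2) (hbg.vel_boundary t ht), sub_zero] at h1
    rw [e0 (u 2) hu0, sub_zero] at h2
    have h3 : B * x 2 ≤ L * d * x 2 := mul_le_mul_of_nonneg_right (hB.trans hLd) hx2.le
    have h4 : d * x 2 ≤ L * d * x 2 := mul_le_mul_of_nonneg_right (by nlinarith) hx2.le
    exact (abs_add_le _ _).trans (by linarith)
  have bVx : ∀ k j, |dx k (ua j) t x + dx k (u j) t x| ≤ 2 * (L * d) := fun k j =>
    (abs_add_le _ _).trans (by nlinarith [(hbg.vel j).dx k t ht x hx, hp.u_dx k j x hx])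
  have bdiv : |(dx 0 (ua 0) t x + dx 0 (u 0) t x) + (dx 1 (ua 1) t x + dx 1 (u 1) t x)
      + (dx 2 (ua 2) t x + dx 2 (u 2) t x)| ≤ 6 * (L * d) :=
    (abs_add_three _ _ _).trans (by linarith [bVx 0 0, bVx 1 1, bVx 2 2])
  -- derivatives of the density
  have bNt : |dt na t x + dt n t x| ≤ 2 * (L * d) :=
    (abs_add_le _ _).trans (by nlinarith [hbg.dens.dt t ht x hx, hp.n_dt x hx])
  have bVN : |(ua 0 t x + u 0 t x) * (dx 0 na t x + dx 0 n t x)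
      + (ua 1 t x + u 1 t x) * (dx 1 na t x + dx 1 n t x)
      + (ua 2 t x + u 2 t x) * (dx 2 na t x + dx 2 n t x)| ≤ 18 * (L ^ 2 * d) := by
    have h1 := hbg.dens.abs_transport_le hL hd hB ht hx bV bV2
    have h2 := abs_dot_le bV (fun j => hp.n_dx j x hx)
    have h3 := abs_add_le ((ua 0 t x + u 0 t x) * dx 0 na t x
      + (ua 1 t x + u 1 t x) * dx 1 na t x + (ua 2 t x + u 2 t x) * dx 2 na t x)
      ((ua 0 t x + u 0 t x) * dx 0 n t x
      + (ua 1 t x + u 1 t x) * dx 1 n t x + (ua 2 t x + u 2 t x) * dx 2 n t x)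
    refine le_trans (le_of_eq ?_) (h3.trans ?_)
    · congr 1; ring
    · linarith
  have bVφ : |(ua 0 t x + u 0 t x) * dx 0 φ t x + (ua 1 t x + u 1 t x) * dx 1 φ t x
      + (ua 2 t x + u 2 t x) * dx 2 φ t x| ≤ 6 * (L * d) :=
    (abs_dot_le bV (fun j => hp.φ_dx j x hx)).trans (by linarith)
  have bVφa := hbg.pot.abs_transport_le hL hd hB ht hx bV bV2
  -- the coefficient of the Poisson equation
  have bE : |Real.exp (-φa t x)| ≤ L := by
    rw [abs_of_pos (Real.exp_pos _)]
    refine (Real.exp_le_exp.2 ?_).trans hexp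
    linarith [(abs_le.1 (hbg.pot.val t ht x hx)).1]
  obtain ⟨bh, bh'⟩ := hhL (φ t x) (hp.φ_val x hx)
  have bg : |poissonCoeff h φa φ t x| ≤ 2 * L ^ 2 := by
    have : |1 + h (φ t x)| ≤ 2 * L := (abs_add_le _ _).trans (by
      rw [abs_one]; linarith)
    exact (abs_mul_le_mul_of_le bE this).trans (by linarith)
  have hg := hasD_poissonCoeff hh hbg.pot.reg hφ t x
  have eN : ∀ j, dx j (fun t x => na t x + n t x) t x = dx j na t x + dx j n t x :=
    fun j => dx_add hbg.dens.reg hn j t x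
  have eV : ∀ k j, dx k (fun t x => ua j t x + u j t x) t x = dx k (ua j) t x + dx k (u j) t x :=
    fun k j => dx_add (hbg.vel j).reg (hu j) k t x
  -- The value 45 = 2 + 1 + 24 + 6 + 12 adds the five contributions to ∂_t g + V·∇g + g div V, in
  -- units of L⁴d; the other coefficients need less.
  refine energyProduction_le (K := 45 * L ^ 4) (by linarith) hd hε (by linarith) ?_ ?_ ?_
    (by linarith) ?_ ?_ ?_ (fun j => (bV j).trans (by linarith)) ?_
  · simp only [eN, eV, dt_add hbg.dens.reg hn]
    have h1 : |(na t x + n t x) * ((dx 0 (ua 0) t x + dx 0 (u 0) t x)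
        + (dx 1 (ua 1) t x + dx 1 (u 1) t x) + (dx 2 (ua 2) t x + dx 2 (u 2) t x))|
        ≤ (2 * L) * (6 * (L * d)) :=
      abs_mul_le_mul_of_le ((abs_add_le _ _).trans
        (by linarith [hbg.dens.val t ht x hx, hp.n_val x hx])) bdiv
    refine (abs_add_three _ _ _).trans ?_
    linarith
  · intro j k
    linarith [(hbg.vel j).dx k t ht x hx]
  · exact (abs_add_le _ _).trans (by linarith [hbg.dens.val t ht x hx, hp.n_val x hx])
  · intro j
    rw [eN]
    -- The two logarithmic gradients nearly cancel: the singular ∇n_a is left multiplied by n, and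
    -- ε|∇n_a| and |n|/ε are both controlled.
    have e : dx j na t x / na t x - (dx j na t x + dx j n t x) * I
        = (dx j na t x * n t x) * ((na t x)⁻¹ * I) - dx j n t x * I := by
      rw [hI]; field_simp; ring
    rw [e]
    have h1 : |dx j na t x * n t x| ≤ L * d := by
      rw [abs_mul]
      have h2 := hbg.dens.dx_eps j t ht x hx
      calc |dx j na t x| * |n t x| ≤ |dx j na t x| * (ε * d) :=
            mul_le_mul_of_nonneg_left (hp.n_eps x hx) (abs_nonneg _)
        _ = (ε * |dx j na t x|) * d := by ring
        _ ≤ L * d := mul_le_mul_of_nonneg_right (h2.trans hB) (by linarith)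
    have h2 := abs_mul_le_mul_of_le h1 (abs_mul_le_mul_of_le bna bI)
    have h3 := abs_mul_le_mul_of_le (hp.n_dx j x hx) bI
    refine (abs_sub _ _).trans ?_
    linarith
  · simp only [eN, eV, dt_add hbg.dens.reg hn]
    have bI2 : |I ^ 2| ≤ L ^ 2 := by
      rw [abs_pow]; exact pow_le_pow_left₀ (abs_nonneg _) bI 2
    have h1 := abs_mul_le_mul_of_le ((abs_add_le _ _).trans (add_le_add bNt bVN)) bI2
    have h2 := abs_mul_le_mul_of_le bdiv bI
    refine (abs_add_le _ _).trans ?_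
    have : (2 * (L * d) + 18 * (L ^ 2 * d)) * L ^ 2 ≤ 20 * (L ^ 4 * d) := by
      have : L * d * L ^ 2 = L ^ 3 * d := by ring
      nlinarith
    linarith
  · simp only [eV, hg.dt, hg.dx]
    have h1 := abs_mul_le_mul_of_le (hbg.pot.dt t ht x hx |>.trans hB) bg
    have h2 := abs_mul_le_mul_of_le bE (abs_mul_le_mul_of_le bh' (hp.φ_dt x hx))
    have h3 := abs_mul_le_mul_of_le bVφa bg
    have h4 := abs_mul_le_mul_of_le (abs_mul_le_mul_of_le bE bh') bVφ
    have h5 := abs_mul_le_mul_of_le bg bdiv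
    have l0 : L ^ 3 ≤ L ^ 3 * d := by nlinarith [pow_pos hL0 3]
    rw [abs_le] at *
    constructor <;> linarith
  · intro k j
    rw [eV]
    linarith [bVx k j]

/-! ### Cutoffs -/

/-- Rescaling one fixed bump by R keeps its plateau and makes its gradient O(1/R), with a constant
independent of R. -/
lemma exists_cutoff : ∃ c : ℝ, 0 ≤ c ∧ ∀ R : ℝ, 0 < R → ∃ χ : E3 → ℝ, ContDiff ℝ 1 χ ∧
    (∀ x, 0 ≤ χ x ∧ χ x ≤ 1) ∧ (∀ x, ‖x‖ ≤ R → χ x = 1) ∧ (∀ x, 2 * R ≤ ‖x‖ → χ x = 0) ∧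
    ∀ j x, |pd j χ x| ≤ c / R := by
  let f : ContDiffBump (0 : E3) := ⟨1, 2, one_pos, one_lt_two⟩
  have hf : ContDiff ℝ 1 f := f.contDiff
  obtain ⟨c, hc⟩ := (hf.continuous_fderiv (by norm_num)).bounded_above_of_compact_support
    (f.hasCompactSupport.fderiv (𝕜 := ℝ))
  refine ⟨c, (norm_nonneg _).trans (hc 0), fun R hR => ⟨fun x => f (R⁻¹ • x),
    hf.comp (contDiff_const_smul _), fun x => ⟨f.nonneg, f.le_one⟩, fun x hx => ?_, fun x hx => ?_,
    fun j x => ?_⟩⟩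
  · apply f.one_of_mem_closedBall
    rw [mem_closedBall_zero_iff, norm_smul, Real.norm_of_nonneg (inv_nonneg.2 hR.le),
      inv_mul_le_iff₀ hR]
    simpa [f] using hx
  · apply f.zero_of_le_dist
    rw [dist_zero_right, norm_smul, Real.norm_of_nonneg (inv_nonneg.2 hR.le),
      le_inv_mul_iff₀ hR]
    simpa [f, mul_comm] using hx
  · have h1 := (hf.differentiable (by norm_num) (R⁻¹ • x)).hasFDerivAt.comp x
      ((hasFDerivAt_id x).const_smul R⁻¹)
    have h2 : fderiv ℝ (fun x => f (R⁻¹ • x)) x = _ := h1.fderiv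
    rw [pd, h2]
    simp only [ContinuousLinearMap.comp_smul, ContinuousLinearMap.comp_id,
      smul_apply, smul_eq_mul, abs_mul, abs_of_pos (inv_pos.2 hR)]
    rw [div_eq_inv_mul]
    refine mul_le_mul_of_nonneg_left ?_ (inv_nonneg.2 hR.le)
    have h3 := (fderiv ℝ f (R⁻¹ • x)).le_opNorm (EuclideanSpace.single j 1)
    simp only [PiLp.norm_single, norm_one, mul_one] at h3
    exact h3.trans (hc _)

/-! ### From a local balance law to an integral inequality -/

/-- Discarding the negative part only increases the integral, and a non-integrable function has
Bochner integral 0. No integrability of the production has to be known. -/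
lemma ofReal_integral_le_lintegral_ofReal {α : Type*} [MeasurableSpace α] {μ : Measure α}
    (f : α → ℝ) : ENNReal.ofReal (∫ x, f x ∂μ) ≤ ∫⁻ x, ENNReal.ofReal (f x) ∂μ := by
  by_cases hf : Integrable f μ
  · rw [integral_eq_lintegral_pos_part_sub_lintegral_neg_part hf]
    refine (ENNReal.ofReal_le_ofReal (sub_le_self _ ENNReal.toReal_nonneg)).trans
      ENNReal.ofReal_toReal_le
  · simp [integral_undef hf]

lemma abs_integral_le_of_lintegral_le {α : Type*} [MeasurableSpace α] {μ : Measure α}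
    {f : α → ℝ} {W : ℝ} (hW : 0 ≤ W) (h : ∫⁻ x, ‖f x‖ₑ ∂μ ≤ ENNReal.ofReal W) :
    |∫ x, f x ∂μ| ≤ W := by
  have h1 := (enorm_integral_le_lintegral_enorm f).trans h
  rw [Real.enorm_eq_ofReal_abs] at h1
  exact (ENNReal.ofReal_le_ofReal_iff hW).1 h1

/-- The error made by a cutoff in the divergence of an integrable flux. -/
lemma abs_integral_cutoff_flux_le {F : Fin 3 → E3 → ℝ} {χ : E3 → ℝ} {δ W : ℝ} (hδ : 0 ≤ δ)
    (hχ : ∀ j x, |pd j χ x| ≤ δ) (hW : 0 ≤ W)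
    (hF : ∫⁻ x, ∑ j, ‖F j x‖ₑ ∂halfVol ≤ ENNReal.ofReal W) :
    |∫ x, ∑ j, pd j χ x * F j x ∂halfVol| ≤ δ * W := by
  refine abs_integral_le_of_lintegral_le (by positivity) ?_
  calc ∫⁻ x, ‖∑ j, pd j χ x * F j x‖ₑ ∂halfVol
      ≤ ∫⁻ x, ENNReal.ofReal δ * ∑ j, ‖F j x‖ₑ ∂halfVol := by
        refine lintegral_mono fun x => ?_
        rw [Finset.mul_sum]
        refine (enorm_sum_le _ _).trans (Finset.sum_le_sum fun j _ => ?_)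
        rw [enorm_mul]
        refine mul_le_mul_left ?_ _
        rw [Real.enorm_eq_ofReal_abs]
        exact ENNReal.ofReal_le_ofReal (hχ j x)
    _ = ENNReal.ofReal δ * ∫⁻ x, ∑ j, ‖F j x‖ₑ ∂halfVol :=
        lintegral_const_mul' _ _ ENNReal.ofReal_ne_top
    _ ≤ ENNReal.ofReal (δ * W) := by
        rw [ENNReal.ofReal_mul hδ]
        gcongr

lemma C1On.slice {T : ℝ} {f : ScalarField} (h : C1On T f) {t : ℝ} (ht : t ∈ Icc 0 T) :
    ∀ x ∈ closedHalfSpace, ContDiffAt ℝ 1 (f t) x := fun x hx => contDiffAt_slice_space (h t ht x hx)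

/-- The energy inequality obtained from a local balance law with an integrable flux. -/
theorem lintegral_le_of_balance {T t : ℝ} (ht : t ∈ Icc 0 T) {e : ScalarField}
    {Fl P : VectorField} {G : ℝ → E3 → ℝ} {epos : E3 → ℝ} {S Q : ℝ → ℝ≥0∞} {I₀ : ℝ≥0∞} {W : ℝ}
    (he : C1On T e) (hFl : ∀ j, C1On T (Fl j)) (hP : ∀ j, C1On T (P j))
    (hFl0 : ∀ s ∈ Icc 0 T, ∀ x : E3, x 2 = 0 → Fl 2 s x = 0)
    (hP0 : ∀ x : E3, x 2 = 0 → P 2 t x = 0)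
    (bal : ∀ s ∈ Icc 0 T, ∀ x ∈ halfSpace, dt e s x = ∑ j, dx j (Fl j) s x + G s x)
    (hpos : ∀ x ∈ halfSpace, epos x = e t x + ∑ j, dx j (P j) t x)
    (hpos0 : ∀ x ∈ halfSpace, 0 ≤ epos x)
    (hG : ∀ s ∈ Icc 0 t, ∫⁻ x, ENNReal.ofReal (G s x) ∂halfVol ≤ S s + Q s) (hS : Measurable S)
    (hW : 0 ≤ W)
    (hFlW : ∀ s ∈ Icc 0 T, ∫⁻ x, ∑ j, ‖Fl j s x‖ₑ ∂halfVol ≤ ENNReal.ofReal W)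
    (hPW : ∫⁻ x, ∑ j, ‖P j t x‖ₑ ∂halfVol ≤ ENNReal.ofReal W)
    (h0 : ∫⁻ x, ENNReal.ofReal (e 0 x) ∂halfVol ≤ I₀) :
    ∫⁻ x, ENNReal.ofReal (epos x) ∂halfVol
      ≤ I₀ + ((∫⁻ s in Icc 0 t, S s) + ∫⁻ s in Icc 0 t, Q s) := by
  obtain ⟨c, hc, hcut⟩ := exists_cutoff
  have h0T : (0 : ℝ) ∈ Icc 0 T := ⟨le_rfl, ht.1.trans ht.2⟩
  have hIcc : ∀ s ∈ Icc 0 t, s ∈ Icc 0 T := fun s hs => ⟨hs.1, hs.2.trans ht.2⟩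
  -- The inequality is first proved on a ball of radius R; the only price is the flux through the
  -- gradient of the cutoff, of order W/R.
  have key : ∀ R : ℝ, 0 < R → ∫⁻ x in Metric.closedBall 0 R, ENNReal.ofReal (epos x) ∂halfVol
      ≤ I₀ + ((∫⁻ s in Icc 0 t, S s) + ∫⁻ s in Icc 0 t, Q s)
        + ENNReal.ofReal (c / R * W) * (ENNReal.ofReal t + 1) := by
    intro R hR
    obtain ⟨χ, hχ, hχ01, hχ1, hχ0, hχd⟩ := hcut R hR
    have hδ : 0 ≤ c / R := by positivity
    have hL : 0 < 2 * R := by positivity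
    have iχ : ∀ {f : E3 → ℝ}, ContinuousOn f closedHalfSpace →
        Integrable (fun x => χ x * f x) halfVol := fun hf =>
      integrable_halfVol_of_continuousOn (L := 2 * R) (hχ.continuous.continuousOn.mul hf)
        (fun x hx => by simp [hχ0 x hx])
    have cdiv : ∀ {F : VectorField}, (∀ j, C1On T (F j)) → ∀ s ∈ Icc 0 T,
        ContinuousOn (fun x => ∑ j, dx j (F j) s x) closedHalfSpace := fun hF s hs x hx =>
      ContinuousAt.continuousWithinAt (tendsto_finsetSum _ fun j _ =>
        pd_continuousAt ((hF j).slice hs x hx) j)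
    have ce : ∀ s ∈ Icc 0 T, ContinuousOn (e s) closedHalfSpace := fun s hs x hx =>
      (he.slice hs x hx).continuousAt.continuousWithinAt
    have cet : ∀ s ∈ Icc 0 T, ContinuousOn (dt e s) closedHalfSpace := fun s hs x hx =>
      (ContinuousAt.comp (f := fun x : E3 => (s, x)) (continuousAt_dt (he s hs x hx))
        (by fun_prop)).continuousWithinAt
    have ipos : Integrable (fun x => χ x * (e t x + ∑ j, dx j (P j) t x)) halfVol :=
      iχ ((ce t ht).add (cdiv hP t ht))
    have epos_eq : ∫ x, χ x * (e t x + ∑ j, dx j (P j) t x) ∂halfVol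
        = ∫ x, χ x * e t x ∂halfVol - ∫ x, ∑ j, pd j χ x * P j t x ∂halfVol := by
      simp only [mul_add]
      rw [integral_add (iχ (ce t ht)) (iχ (cdiv hP t ht)), sub_eq_add_neg]
      congr 1
      exact integral_cutoff_div (fun j => (hP j).slice ht) hP0 hχ hL hχ0
    have hZ : ∀ s ∈ Icc 0 t, ENNReal.ofReal (∫ x, χ x * dt e s x ∂halfVol)
        ≤ S s + (Q s + ENNReal.ofReal (c / R * W)) := by
      intro s hs
      have hs' := hIcc s hs
      have e1 : ∫ x, χ x * dt e s x ∂halfVol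
          = ∫ x, χ x * (dt e s x - ∑ j, dx j (Fl j) s x) ∂halfVol
            - ∫ x, ∑ j, pd j χ x * Fl j s x ∂halfVol := by
        simp only [mul_sub]
        rw [integral_sub (iχ (cet s hs')) (iχ (cdiv hFl s hs'))]
        have := integral_cutoff_div (fun j => (hFl j).slice hs') (hFl0 s hs') hχ hL hχ0
        simp only [dx]
        rw [this]
        ring
      have e2 := (abs_le.1 (abs_integral_cutoff_flux_le hδ hχd hW (hFlW s hs'))).1
      have e3 : ENNReal.ofReal (∫ x, χ x * (dt e s x - ∑ j, dx j (Fl j) s x) ∂halfVol)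
          ≤ ∫⁻ x, ENNReal.ofReal (G s x) ∂halfVol := by
        refine (ofReal_integral_le_lintegral_ofReal _).trans ?_
        refine setLIntegral_mono' measurableSet_halfSpace fun x hx => ?_
        rw [bal s hs' x hx, add_sub_cancel_left]
        rcases le_or_gt 0 (G s x) with hg | hg
        · exact ENNReal.ofReal_le_ofReal (mul_le_of_le_one_left hg (hχ01 x).2)
        · rw [ENNReal.ofReal_of_nonpos (mul_nonpos_of_nonneg_of_nonpos (hχ01 x).1 hg.le)]
          exact zero_le
      rw [← add_assoc]
      refine le_trans ?_ (add_le_add_left (e3.trans (hG s hs)) _)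
      refine le_trans (ENNReal.ofReal_le_ofReal ?_) ENNReal.ofReal_add_le
      rw [e1]
      linarith
    have hZint : ENNReal.ofReal (∫ s in 0..t, ∫ x, χ x * dt e s x ∂halfVol)
        ≤ (∫⁻ s in Icc 0 t, S s) + ((∫⁻ s in Icc 0 t, Q s)
          + ENNReal.ofReal (c / R * W) * ENNReal.ofReal t) := by
      rw [intervalIntegral.integral_of_le ht.1, ← integral_Icc_eq_integral_Ioc]
      refine (ofReal_integral_le_lintegral_ofReal _).trans ?_
      refine (setLIntegral_mono' measurableSet_Icc hZ).trans (le_of_eq ?_)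
      -- Splitting needs measurability of S and of the constant only, so Q, which carries the L^∞
      -- weight, may be any function of time.
      rw [lintegral_add_left hS, lintegral_add_right _ measurable_const]
      simp
    have hX := integral_cutoff_sub he hχ.continuous hχ0 ht
    have hX0 : ENNReal.ofReal (∫ x, χ x * e 0 x ∂halfVol) ≤ I₀ := by
      refine (ofReal_integral_le_lintegral_ofReal _).trans ((lintegral_mono fun x => ?_).trans h0)
      rcases le_or_gt 0 (e 0 x) with hg | hg
      · exact ENNReal.ofReal_le_ofReal (mul_le_of_le_one_left hg (hχ01 x).2)
      · rw [ENNReal.ofReal_of_nonpos (mul_nonpos_of_nonneg_of_nonpos (hχ01 x).1 hg.le)]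
        exact zero_le
    have hPe := (abs_le.1 (abs_integral_cutoff_flux_le hδ hχd hW hPW)).1
    calc ∫⁻ x in Metric.closedBall 0 R, ENNReal.ofReal (epos x) ∂halfVol
        ≤ ∫⁻ x, ENNReal.ofReal (χ x * (e t x + ∑ j, dx j (P j) t x)) ∂halfVol := by
          rw [← lintegral_indicator measurableSet_closedBall]
          refine setLIntegral_mono' measurableSet_halfSpace fun x hx => ?_
          rw [← hpos x hx]
          by_cases hxR : x ∈ Metric.closedBall (0 : E3) R
          · rw [indicator_of_mem hxR, hχ1 x (by simpa using hxR), one_mul]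
          · rw [indicator_of_notMem hxR]
            exact zero_le
      _ = ENNReal.ofReal (∫ x, χ x * (e t x + ∑ j, dx j (P j) t x) ∂halfVol) := by
          refine (ofReal_integral_eq_lintegral_ofReal ipos ?_).symm
          refine (ae_restrict_mem measurableSet_halfSpace).mono fun x hx => ?_
          change 0 ≤ χ x * (e t x + ∑ j, dx j (P j) t x)
          rw [← hpos x hx]
          exact mul_nonneg (hχ01 x).1 (hpos0 x hx)
      _ ≤ ENNReal.ofReal ((∫ x, χ x * e 0 x ∂halfVol)
            + ((∫ s in 0..t, ∫ x, χ x * dt e s x ∂halfVol) + c / R * W)) := by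
          apply ENNReal.ofReal_le_ofReal
          rw [epos_eq]
          linarith
      _ ≤ I₀ + (((∫⁻ s in Icc 0 t, S s) + ((∫⁻ s in Icc 0 t, Q s)
          + ENNReal.ofReal (c / R * W) * ENNReal.ofReal t)) + ENNReal.ofReal (c / R * W)) := by
          refine ENNReal.ofReal_add_le.trans (add_le_add hX0 ?_)
          exact ENNReal.ofReal_add_le.trans (add_le_add_left hZint _)
      _ = _ := by ring
  have hmeas : AEMeasurable (fun x => ENNReal.ofReal (epos x)) halfVol := by
    have h1 : AEMeasurable (fun x => e t x + ∑ j, dx j (P j) t x) halfVol := by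
      have : ContinuousOn (fun x => e t x + ∑ j, dx j (P j) t x) halfSpace := by
        intro x hx
        have hx' := halfSpace_subset_closedHalfSpace hx
        refine ContinuousAt.continuousWithinAt ((he.slice ht x hx').continuousAt.add ?_)
        exact tendsto_finsetSum _ fun j _ => pd_continuousAt ((hP j).slice ht x hx') j
      exact this.aemeasurable measurableSet_halfSpace
    refine (h1.congr ?_).ennreal_ofReal
    exact (ae_restrict_mem measurableSet_halfSpace).mono fun x hx => (hpos x hx).symm
  have hcov : AECover halfVol atTop (fun k : ℕ => Metric.closedBall (0 : E3) ((k : ℝ) + 1)) :=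
    aecover_closedBall (tendsto_atTop_add_const_right _ _ tendsto_natCast_atTop_atTop)
  have hlim := hcov.lintegral_tendsto_of_countably_generated hmeas
  -- As R tends to infinity the flux error disappears, whatever W is; hence W may depend on the
  -- solution.
  have hrhs : Tendsto (fun k : ℕ => I₀ + ((∫⁻ s in Icc 0 t, S s) + ∫⁻ s in Icc 0 t, Q s)
      + ENNReal.ofReal (c / ((k : ℝ) + 1) * W) * (ENNReal.ofReal t + 1)) atTop
      (𝓝 (I₀ + ((∫⁻ s in Icc 0 t, S s) + ∫⁻ s in Icc 0 t, Q s)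
        + ENNReal.ofReal (0 * W) * (ENNReal.ofReal t + 1))) := by
    refine Tendsto.const_add _ (ENNReal.Tendsto.mul_const ?_ (Or.inr (by finiteness)))
    refine ENNReal.tendsto_ofReal (Tendsto.mul_const _ ?_)
    exact tendsto_const_nhds.div_atTop
      (tendsto_atTop_add_const_right _ _ tendsto_natCast_atTop_atTop)
  have := le_of_tendsto_of_tendsto' hlim hrhs fun k => key _ (by positivity)
  simpa using this

/-! ### `L²` and `L^∞` norms at a fixed time -/

lemma enorm_sq_eq_ofReal (r : ℝ) : ‖r‖ₑ ^ 2 = ENNReal.ofReal (r ^ 2) := by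
  rw [Real.enorm_eq_ofReal_abs, ← ENNReal.ofReal_pow (abs_nonneg r), sq_abs]

lemma l2sq_eq_lintegral_ofReal (g : E3 → ℝ) :
    l2sq g = ∫⁻ x, ENNReal.ofReal (g x ^ 2) ∂halfVol := by
  simp only [l2sq_eq_lintegral, enorm_sq_eq_ofReal]

lemma sum_l2sq_eq {ι : Type*} (s : Finset ι) {f : ι → E3 → ℝ} (hf : ∀ i, Measurable (f i)) :
    ∑ i ∈ s, l2sq (f i) = ∫⁻ x, ENNReal.ofReal (∑ i ∈ s, f i x ^ 2) ∂halfVol := by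
  simp only [l2sq_eq_lintegral_ofReal]
  rw [← lintegral_finsetSum _ fun i _ => ((hf i).pow_const 2).ennreal_ofReal]
  refine lintegral_congr fun x => ?_
  rw [ENNReal.ofReal_sum_of_nonneg fun i _ => sq_nonneg _]

lemma lintegral_ofReal_add {f g : E3 → ℝ} (hf : Measurable f) (hf0 : ∀ x, 0 ≤ f x)
    (hg0 : ∀ x, 0 ≤ g x) : ∫⁻ x, ENNReal.ofReal (f x + g x) ∂halfVol
      = ∫⁻ x, ENNReal.ofReal (f x) ∂halfVol + ∫⁻ x, ENNReal.ofReal (g x) ∂halfVol := by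
  rw [← lintegral_add_left hf.ennreal_ofReal]
  exact lintegral_congr fun x => ENNReal.ofReal_add (hf0 x) (hg0 x)

lemma lintegral_ofReal_add_four {a b c d : E3 → ℝ} (ha : Measurable a) (hb : Measurable b)
    (hc : Measurable c) (ha0 : ∀ x, 0 ≤ a x) (hb0 : ∀ x, 0 ≤ b x) (hc0 : ∀ x, 0 ≤ c x)
    (hd0 : ∀ x, 0 ≤ d x) : ∫⁻ x, ENNReal.ofReal (a x + b x + c x + d x) ∂halfVol
      = ∫⁻ x, ENNReal.ofReal (a x) ∂halfVol + ∫⁻ x, ENNReal.ofReal (b x) ∂halfVol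
        + ∫⁻ x, ENNReal.ofReal (c x) ∂halfVol + ∫⁻ x, ENNReal.ofReal (d x) ∂halfVol := by
  rw [lintegral_ofReal_add (f := fun x => a x + b x + c x) ((ha.add hb).add hc)
      (fun x => add_nonneg (add_nonneg (ha0 x) (hb0 x)) (hc0 x)) hd0,
    lintegral_ofReal_add (f := fun x => a x + b x) (ha.add hb)
      (fun x => add_nonneg (ha0 x) (hb0 x)) hc0, lintegral_ofReal_add ha ha0 hb0]

lemma measurable_sum_sq {f : Fin 3 → E3 → ℝ} (hf : ∀ i, Measurable (f i)) :
    Measurable (fun x => ∑ i, f i x ^ 2) :=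
  Finset.measurable_sum _ fun i _ => (hf i).pow_const 2

lemma energySq_eq {ε : ℝ} {ρ : ScalarField} {v : VectorField} {ψ : ScalarField} (hρ : IsCk 1 ρ)
    (hv : ∀ j, IsCk 1 (v j)) (hψ : IsCk 2 ψ) (t : ℝ) :
    energySq ε ρ v ψ t = ∫⁻ x, ENNReal.ofReal (energySqDensity ε ρ v ψ t x) ∂halfVol := by
  have mρ : Measurable (ρ t) := (hρ.slice t).continuous.measurable
  have mv : ∀ j, Measurable (v j t) := fun j => ((hv j).slice t).continuous.measurable
  have mψ : Measurable (ψ t) := (hψ.slice t).continuous.measurable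
  have mp : ∀ j, Measurable (fun x => ε * dx j ψ t x) := fun j =>
    (((IsCk.dx (k := 1) hψ j).slice t).continuous.measurable).const_mul ε
  have sv := measurable_sum_sq mv
  simp only [energySq, energySqDensity]
  rw [lintegral_ofReal_add_four (mρ.pow_const 2) sv (mψ.pow_const 2) (fun x => by positivity)
      (fun x => by positivity) (fun x => by positivity) (fun x => by positivity), sum_l2sq_eq _ mv, sum_l2sq_eq _ mp, l2sq_eq_lintegral_ofReal, l2sq_eq_lintegral_ofReal]

/-- Joint measurability in time and space. -/
def MeasField (f : ScalarField) : Prop := Measurable (fun p : ℝ × E3 => f p.1 p.2)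

lemma IsCk.measField {k : ℕ} {f : ScalarField} (h : IsCk k f) : MeasField f :=
  h.continuous.measurable

lemma MeasField.slice {f : ScalarField} (h : MeasField f) (t : ℝ) : Measurable (f t) :=
  h.comp measurable_prodMk_left

lemma MeasField.measurable_l2sq {f : ScalarField} (h : MeasField f) :
    Measurable (fun s => l2sq (f s)) := by
  simp only [l2sq_eq_lintegral]
  exact (h.enorm.pow_const 2).lintegral_prod_right'

lemma sourceSq_eq {ε : ℝ} {rn : ScalarField} {ru : VectorField} {r : ScalarField}
    (hrn : MeasField rn) (hru : ∀ j, MeasField (ru j)) (hr : IsCk 1 r) (t : ℝ) :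
    sourceSq ε rn ru r t = ∫⁻ x, ENNReal.ofReal (sourceSqDensity ε rn ru r t x) ∂halfVol := by
  have m1 : Measurable (fun x => ε⁻¹ * r t x) := (hr.measField.slice t).const_mul _
  have m2 : Measurable (dt r t) := (IsCk.dt (k := 0) hr).measField.slice t
  have m3 := hrn.slice t
  have m4 := fun j => (hru j).slice t
  simp only [sourceSq, sourceSqDensity]
  rw [lintegral_ofReal_add_four (m1.pow_const 2) (m2.pow_const 2) (m3.pow_const 2)
      (fun x => by positivity) (fun x => by positivity) (fun x => by positivity)
      (fun x => by positivity),
    sum_l2sq_eq _ m4, l2sq_eq_lintegral_ofReal, l2sq_eq_lintegral_ofReal,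
    l2sq_eq_lintegral_ofReal]

lemma measurable_sourceSq {ε : ℝ} {rn : ScalarField} {ru : VectorField} {r : ScalarField}
    (hrn : MeasField rn) (hru : ∀ j, MeasField (ru j)) (hr : IsCk 1 r) :
    Measurable (sourceSq ε rn ru r) := by
  have m1 : MeasField (fun t x => ε⁻¹ * r t x) := Measurable.const_mul hr.measField _
  exact ((m1.measurable_l2sq.add (IsCk.dt (k := 0) hr).measField.measurable_l2sq).add
    hrn.measurable_l2sq).add (Finset.measurable_sum _ fun j _ => (hru j).measurable_l2sq)

/-- Nonempty open sets have positive volume. Applied to strict superlevel sets, this turns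
almost-everywhere statements about continuous functions into pointwise ones. -/
lemma eq_empty_of_ae {U : Set E3} (hU : IsOpen U) (hUH : U ⊆ halfSpace)
    (h : ∀ᵐ x ∂halfVol, x ∉ U) : U = ∅ := by
  have h1 : halfVol U = 0 := by
    have := ae_iff.1 h
    simpa using this
  rw [halfVol, Measure.restrict_apply hU.measurableSet, inter_eq_left.2 hUH] at h1
  exact (hU.measure_eq_zero_iff _).1 h1

lemma abs_le_of_linf_le {f : E3 → ℝ} (hf : Continuous f) {d : ℝ} (hd : 0 ≤ d)
    (h : linf f ≤ ENNReal.ofReal d) {x : E3} (hx : x ∈ halfSpace) : |f x| ≤ d := by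
  have h1 : ∀ᵐ x ∂halfVol, x ∉ halfSpace ∩ {x | d < |f x|} := by
    rw [linf, eLpNorm_exponent_top] at h
    filter_upwards [ae_le_eLpNormEssSup (f := f) (μ := halfVol)] with y hy hyU
    have h2 := hy.trans h
    rw [Real.enorm_eq_ofReal_abs, ENNReal.ofReal_le_ofReal_iff hd] at h2
    exact absurd hyU.2 (not_lt.2 h2)
  have h2 := eq_empty_of_ae (isOpen_halfSpace.inter (isOpen_lt continuous_const hf.abs))
    inter_subset_left h1
  by_contra hcon
  push Not at hcon
  have : x ∈ (∅ : Set E3) := h2 ▸ ⟨hx, hcon⟩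
  exact this

lemma eq_zero_of_lintegral_eq_zero {f : E3 → ℝ} (hf : Continuous f) (h0 : ∀ x, 0 ≤ f x)
    (h : ∫⁻ x, ENNReal.ofReal (f x) ∂halfVol = 0) {x : E3} (hx : x ∈ halfSpace) : f x = 0 := by
  have h1 : ∀ᵐ x ∂halfVol, x ∉ halfSpace ∩ {x | 0 < f x} := by
    rw [lintegral_eq_zero_iff hf.measurable.ennreal_ofReal] at h
    filter_upwards [h] with y hy hyU
    have : f y ≤ 0 := by simpa using hy
    exact absurd hyU.2 (not_lt.2 this)
  have h2 := eq_empty_of_ae (isOpen_halfSpace.inter (isOpen_lt continuous_const hf))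
    inter_subset_left h1
  by_contra hcon
  have : x ∈ (∅ : Set E3) := h2 ▸ ⟨hx, lt_of_le_of_ne (h0 x) (Ne.symm hcon)⟩
  exact this

lemma continuous_energySqDensity {ε : ℝ} {ρ : ScalarField} {v : VectorField} {ψ : ScalarField}
    (hρ : IsCk 1 ρ) (hv : ∀ j, IsCk 1 (v j)) (hψ : IsCk 2 ψ) (t : ℝ) :
    Continuous (energySqDensity ε ρ v ψ t) := by
  have c1 := (hρ.slice t).continuous
  have c2 : ∀ j, Continuous (v j t) := fun j => ((hv j).slice t).continuous
  have c3 := (hψ.slice t).continuous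
  have c4 : ∀ j, Continuous (dx j ψ t) := fun j => ((IsCk.dx (k := 1) hψ j).slice t).continuous
  exact (((c1.pow 2).add (continuous_finsetSum _ fun j _ => (c2 j).pow 2)).add (c3.pow 2)).add
    (continuous_finsetSum _ fun j _ => ((c4 j).const_mul ε).pow 2)

/-- The weight of the energy on the right hand side of the stability estimate. -/
def growthWeight (ε : ℝ) (n : ScalarField) (u : VectorField) (φ : ScalarField) (t : ℝ) : ℝ≥0∞ :=
  1 + gradLinfAll n u φ t + ENNReal.ofReal ε⁻¹ * linf (n t)

/-- The whole weight is taken as the single constant d: it dominates each derivative norm and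
‖n‖_{L^∞}/ε, and its summand 1 gives d ≥ 1. Continuity converts the essential bounds into pointwise
ones. -/
lemma perturbationBounds_of_growthWeight {ε M : ℝ} (hε : 0 < ε) {n : ScalarField}
    {u : VectorField} {φ : ScalarField} (hn : IsCk 1 n) (hu : ∀ j, IsCk 1 (u j)) (hφ : IsCk 1 φ)
    {t : ℝ} (bdd : ∀ x ∈ halfSpace, |n t x| + Real.sqrt (∑ j, u j t x ^ 2) + |φ t x| ≤ M)
    (hD : growthWeight ε n u φ t ≠ ⊤) :
    1 ≤ (growthWeight ε n u φ t).toReal ∧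
      PerturbationBounds M (growthWeight ε n u φ t).toReal ε n u φ t := by
  set D := growthWeight ε n u φ t with hDdef
  set d := D.toReal with hd
  have hDd : ENNReal.ofReal d = D := ENNReal.ofReal_toReal hD
  have hd0 : 0 ≤ d := ENNReal.toReal_nonneg
  have gD : gradLinfAll n u φ t ≤ D := le_add_right le_add_self
  have gn : gradLinf n t ≤ D := le_trans (le_add_right (le_add_right le_rfl)) gD
  have gu : ∀ j, gradLinf (u j) t ≤ D := fun j =>
    ((Finset.single_le_sum (f := fun j => gradLinf (u j) t) (fun _ _ => zero_le)
      (Finset.mem_univ j)).trans (le_add_right le_add_self)).trans gD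
  have gφ : gradLinf φ t ≤ D := le_trans le_add_self gD
  have hdt : ∀ {f : ScalarField}, IsCk 1 f → gradLinf f t ≤ D → ∀ x ∈ halfSpace,
      |dt f t x| ≤ d := fun hf h x hx =>
    abs_le_of_linf_le ((IsCk.dt (k := 0) hf).slice t).continuous hd0
      (((le_add_right le_rfl).trans h).trans hDd.ge) hx
  have hdx : ∀ {f : ScalarField}, IsCk 1 f → gradLinf f t ≤ D → ∀ j, ∀ x ∈ halfSpace,
      |dx j f t x| ≤ d := fun {f} hf h j x hx => by
    refine abs_le_of_linf_le ((IsCk.dx (k := 0) hf j).slice t).continuous hd0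
      (le_trans ?_ (h.trans hDd.ge)) hx
    exact (Finset.single_le_sum (f := fun j => linf (dx j f t)) (fun _ _ => zero_le)
      (Finset.mem_univ j)).trans le_add_self
  refine ⟨?_, ?_, ?_, ?_, ?_, hdt hn gn, hdx hn gn, fun k j => hdx (hu j) (gu j) k, hdt hφ gφ,
    hdx hφ gφ⟩
  · have : (1 : ℝ≥0∞) ≤ D := le_trans (le_add_right le_rfl) (le_add_right le_rfl)
    rw [← hDd] at this
    simpa using this
  · intro x hx
    linarith [bdd x hx, Real.sqrt_nonneg (∑ j, u j t x ^ 2), abs_nonneg (φ t x)]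
  · intro j x hx
    have : |u j t x| ≤ Real.sqrt (∑ j, u j t x ^ 2) := by
      apply Real.abs_le_sqrt
      exact Finset.single_le_sum (f := fun j => u j t x ^ 2) (fun _ _ => sq_nonneg _)
        (Finset.mem_univ j)
    linarith [bdd x hx, abs_nonneg (n t x), abs_nonneg (φ t x)]
  · intro x hx
    linarith [bdd x hx, Real.sqrt_nonneg (∑ j, u j t x ^ 2), abs_nonneg (n t x)]
  · intro x hx
    refine abs_le_of_linf_le (hn.slice t).continuous (by positivity) ?_ hx
    have h1 : ENNReal.ofReal ε⁻¹ * linf (n t) ≤ ENNReal.ofReal d := le_add_self.trans hDd.ge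
    rw [ENNReal.ofReal_mul hε.le]
    calc linf (n t) = ENNReal.ofReal ε * (ENNReal.ofReal ε⁻¹ * linf (n t)) := by
          rw [← mul_assoc, ← ENNReal.ofReal_mul hε.le, mul_inv_cancel₀ hε.ne']
          simp
      _ ≤ ENNReal.ofReal ε * ENNReal.ofReal d := by gcongr

/-! ### Bounds on the energy density and the fluxes -/

/-- The flux is quadratic in the energy variables and ∂_tψ, hence integrable. The constant is
irrelevant to the final estimate, since it enters only the cutoff error. -/
lemma abs_energyFlux_le {Ti ε K : ℝ} (hK : 1 ≤ K) (hε : ε ∈ Ioc (0 : ℝ) 1) {N g ρ ψ : ScalarField}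
    {V v : VectorField} {t : ℝ} {x : E3} (hTi : |Ti| ≤ K) (hN : |N t x| ≤ K)
    (hI : |(N t x)⁻¹| ≤ K) (hg : |g t x| ≤ K) (hV : ∀ j, |V j t x| ≤ K) (j : Fin 3) :
    |energyFlux Ti ε N V g ρ v ψ j t x|
      ≤ 20 * K ^ 3 * (energySqDensity ε ρ v ψ t x + dt ψ t x ^ 2) := by
  set P := K ^ 3 with hP
  have p1 : K ≤ P := by
    calc K = K ^ 1 := (pow_one K).symm
      _ ≤ K ^ 3 := pow_le_pow_right₀ hK (by norm_num)
  have p2 : K * K ≤ P := by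
    calc K * K = K ^ 2 := (sq K).symm
      _ ≤ K ^ 3 := pow_le_pow_right₀ hK (by norm_num)
  have p3 : K * (K * K) = P := by rw [hP]; ring
  have p0 : (1 : ℝ) ≤ P := hK.trans p1
  have bil : ∀ {c a b : ℝ}, |c| ≤ P → |c * (a * b)| ≤ P * (a ^ 2 + b ^ 2) := by
    intro c a b h
    rw [abs_le]
    have h1 := mul_mul_le_of_abs_le (a := a) (b := b) h
    have h2 := mul_mul_le_of_abs_le (a := a) (b := b) ((abs_neg c).trans_le h)
    constructor <;> linarith
  have hε' : |ε| ≤ P := by rw [abs_of_pos hε.1]; linarith [hε.2]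
  have t1 : ∀ k, _ := fun k => bil (a := v k t x) (b := v k t x)
    ((abs_mul_le_mul_of_le hN (hV j)).trans p2)
  have t2 := bil (a := ρ t x) (b := v j t x) (hTi.trans p1)
  have t3 := bil (a := ρ t x) (b := ρ t x)
    ((abs_mul_le_mul_of_le hTi (abs_mul_le_mul_of_le (hV j) hI)).trans p3.le)
  have t4 := bil (a := v j t x) (b := ψ t x) (hN.trans p1)
  have t5 := bil (a := ρ t x) (b := ψ t x) ((hV j).trans p1)
  have t6 : ∀ k, _ := fun k => bil (a := ε * dx j ψ t x) (b := ε * dx k ψ t x) ((hV k).trans p1)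
  have t7 : ∀ k, _ := fun k => bil (a := ε * dx k ψ t x) (b := ε * dx k ψ t x) ((hV j).trans p1)
  have t8 := bil (a := ψ t x) (b := ψ t x) ((abs_mul_le_mul_of_le hg (hV j)).trans p2)
  have t9 := bil (a := dt ψ t x) (b := ε * dx j ψ t x) hε'
  have q : ∀ y : ℝ, 0 ≤ P * y ^ 2 := fun y => by positivity
  have qs : ∀ f : Fin 3 → ℝ, P * f j ^ 2 ≤ P * f 0 ^ 2 + P * f 1 ^ 2 + P * f 2 ^ 2 := by
    intro f
    fin_cases j <;> simp <;> linarith [q (f 0), q (f 1), q (f 2)]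
  have qv := qs fun k => v k t x
  have qψ := qs fun k => ε * dx k ψ t x
  simp only [energyFlux, energySqDensity, normSq, advGrad, grad, Fin.sum_univ_three]
  have a1 := fun k => abs_le.1 (t1 k)
  have a6 := fun k => abs_le.1 (t6 k)
  have a7 := fun k => abs_le.1 (t7 k)
  have a2 := abs_le.1 t2
  have a3 := abs_le.1 t3
  have a4 := abs_le.1 t4
  have a5 := abs_le.1 t5
  have a8 := abs_le.1 t8
  have a9 := abs_le.1 t9
  rw [abs_le]
  constructor
  · linarith [(a1 0).2, (a1 1).2, (a1 2).2, a2.2, a3.2, a4.1, a5.1, (a6 0).2, (a6 1).2, (a6 2).2,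
      (a7 0).1, (a7 1).1, (a7 2).1, a8.1, a9.2, qv, qψ, q (ρ t x), q (ψ t x), q (dt ψ t x),
      q (v 0 t x), q (v 1 t x), q (v 2 t x), q (ε * dx 0 ψ t x), q (ε * dx 1 ψ t x),
      q (ε * dx 2 ψ t x)]
  · linarith [(a1 0).1, (a1 1).1, (a1 2).1, a2.1, a3.1, a4.2, a5.2, (a6 0).1, (a6 1).1, (a6 2).1,
      (a7 0).2, (a7 1).2, (a7 2).2, a8.2, a9.1, qv, qψ, q (ρ t x), q (ψ t x), q (dt ψ t x),
      q (v 0 t x), q (v 1 t x), q (v 2 t x), q (ε * dx 0 ψ t x), q (ε * dx 1 ψ t x),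
      q (ε * dx 2 ψ t x)]

lemma abs_poissonFlux_le {ε : ℝ} (hε : ε ∈ Ioc (0 : ℝ) 1) {ρ ψ : ScalarField} {v : VectorField}
    {t : ℝ} {x : E3} (j : Fin 3) :
    |poissonFlux ε ψ j t x| ≤ energySqDensity ε ρ v ψ t x := by
  have h1 : |poissonFlux ε ψ j t x| ≤ ψ t x ^ 2 + (ε * dx j ψ t x) ^ 2 := by
    have e : poissonFlux ε ψ j t x = ε * (ψ t x * (ε * dx j ψ t x)) := by
      simp only [poissonFlux, grad]; ring
    have hε' : |ε| ≤ 1 := by rw [abs_of_pos hε.1]; exact hε.2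
    rw [e, abs_le]
    have h1 := mul_mul_le_of_abs_le (a := ψ t x) (b := ε * dx j ψ t x) hε'
    have h2 := mul_mul_le_of_abs_le (a := ψ t x) (b := ε * dx j ψ t x) ((abs_neg ε).trans_le hε')
    constructor <;> linarith
  have h2 : (ε * dx j ψ t x) ^ 2 ≤ ∑ k, (ε * dx k ψ t x) ^ 2 :=
    Finset.single_le_sum (f := fun k => (ε * dx k ψ t x) ^ 2) (fun _ _ => sq_nonneg _)
      (Finset.mem_univ j)
  have h3 : 0 ≤ ∑ k, v k t x ^ 2 := Finset.sum_nonneg fun _ _ => sq_nonneg _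
  simp only [energySqDensity]
  linarith [sq_nonneg (ρ t x)]

lemma normSq_nonneg (v : VectorField) (t : ℝ) (x : E3) : 0 ≤ normSq v t x :=
  add_nonneg (add_nonneg (mul_self_nonneg _) (mul_self_nonneg _)) (mul_self_nonneg _)

/-- The lower bounds on N and g control v and ψ with factor 2M, the upper bound on N controls ρ with
2A/T^i, and ε∇ψ needs the factor 2. Thus coercivity involves no other property of the background. -/
lemma energySqDensity_le_posDensity {Ti ε A M : ℝ} (hTi : 0 < Ti) (hM : 0 < M)
    {N g ρ ψ : ScalarField} {v : VectorField} {t : ℝ} {x : E3} (hN : 1 / M ≤ N t x)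
    (hNA : N t x ≤ A) (hg : 1 / M ≤ g t x) :
    energySqDensity ε ρ v ψ t x
      ≤ (2 * M + 2 * A / Ti + 2) * posDensity Ti ε N g ρ v ψ t x := by
  have hN0 : 0 < N t x := (by positivity : (0 : ℝ) < 1 / M).trans_le hN
  have hA : 0 < A := hN0.trans_le hNA
  set k := normSq v t x with hk
  set w := ε ^ 2 / 2 * normSq (grad ψ) t x with hw
  have hk0 : 0 ≤ k := normSq_nonneg _ _ _
  have hw0 : 0 ≤ w := mul_nonneg (by positivity) (normSq_nonneg _ _ _)
  have h1 : k ≤ 2 * M * (1 / 2 * (N t x * k)) := by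
    have : 1 ≤ M * N t x := by rwa [div_le_iff₀' hM] at hN
    nlinarith
  have h2 : ψ t x ^ 2 ≤ 2 * M * (1 / 2 * (g t x * (ψ t x * ψ t x))) := by
    have : 1 ≤ M * g t x := by rwa [div_le_iff₀' hM] at hg
    nlinarith [sq_nonneg (ψ t x)]
  have h3 : ρ t x ^ 2 ≤ 2 * A / Ti * (Ti / 2 * (ρ t x * ρ t x * (N t x)⁻¹)) := by
    have e : 2 * A / Ti * (Ti / 2 * (ρ t x * ρ t x * (N t x)⁻¹))
        = ρ t x ^ 2 * (A * (N t x)⁻¹) := by field_simp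
    rw [e]
    have : 1 ≤ A * (N t x)⁻¹ := by
      rw [← div_eq_mul_inv, one_le_div hN0]; exact hNA
    nlinarith [sq_nonneg (ρ t x)]
  have e : energySqDensity ε ρ v ψ t x = ρ t x ^ 2 + k + ψ t x ^ 2 + 2 * w := by
    simp only [energySqDensity, hk, hw, normSq, Fin.sum_univ_three, grad]; ring
  have p1 : 0 ≤ 1 / 2 * (N t x * k) := by positivity
  have p2 : 0 ≤ 1 / 2 * (g t x * (ψ t x * ψ t x)) := by
    have : 0 < g t x := (by positivity : (0 : ℝ) < 1 / M).trans_le hg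
    have := mul_self_nonneg (ψ t x)
    positivity
  have p3 : 0 ≤ Ti / 2 * (ρ t x * ρ t x * (N t x)⁻¹) := by
    have := mul_self_nonneg (ρ t x)
    positivity
  rw [e, posDensity, ← hk, ← hw]
  set a := 1 / 2 * (N t x * k)
  set b := 1 / 2 * (g t x * (ψ t x * ψ t x))
  set c := Ti / 2 * (ρ t x * ρ t x * (N t x)⁻¹)
  have q : 0 ≤ 2 * A / Ti := by positivity
  nlinarith [mul_nonneg hM.le p1, mul_nonneg hM.le p2, mul_nonneg hM.le p3, mul_nonneg hM.le hw0,
    mul_nonneg q p1, mul_nonneg q p2, mul_nonneg q p3, mul_nonneg q hw0]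

/-- The initial potential must not appear on the right. Its gradient term is negative and dropped,
and the cross term −(ρ + r)ψ is absorbed into −gψ²/2 by completing the square, which leaves M(ρ² +
r²). -/
lemma energyDensity_le {Ti ε A M : ℝ} (hTi : 0 < Ti) (hM : 0 < M)
    {N g ρ ψ r : ScalarField} {v : VectorField} {t : ℝ} {x : E3} (hN : 1 / M ≤ N t x)
    (hNA : N t x ≤ A) (hg : 1 / M ≤ g t x) :
    energyDensity Ti ε N g ρ v ψ r t x
      ≤ (A + Ti * M + M) * (ρ t x ^ 2 + ∑ j, v j t x ^ 2 + r t x ^ 2) := by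
  have hN0 : 0 < N t x := (by positivity : (0 : ℝ) < 1 / M).trans_le hN
  have hA : 0 < A := hN0.trans_le hNA
  set k := normSq v t x with hk
  have hk0 : 0 ≤ k := normSq_nonneg _ _ _
  have ek : ∑ j, v j t x ^ 2 = k := by
    simp only [hk, normSq, Fin.sum_univ_three]; ring
  have hw0 : 0 ≤ ε ^ 2 / 2 * normSq (grad ψ) t x :=
    mul_nonneg (by positivity) (normSq_nonneg _ _ _)
  have hI : (N t x)⁻¹ ≤ M := by
    rw [one_div] at hN
    exact inv_le_of_inv_le₀ hM hN
  have h1 : Ti / 2 * (ρ t x * ρ t x * (N t x)⁻¹) ≤ Ti * M * ρ t x ^ 2 := by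
    have h2 : ρ t x * ρ t x * (N t x)⁻¹ ≤ ρ t x * ρ t x * M :=
      mul_le_mul_of_nonneg_left hI (mul_self_nonneg _)
    have h3 : 0 ≤ ρ t x * ρ t x * M := mul_nonneg (mul_self_nonneg _) hM.le
    nlinarith
  have h2 : 1 / 2 * (N t x * k) ≤ A * k := by nlinarith
  have h3 : -((ρ t x + r t x) * ψ t x) - 1 / 2 * (g t x * (ψ t x * ψ t x))
      ≤ M * (ρ t x ^ 2 + r t x ^ 2) := by
    have h4 : 1 / M * (ψ t x * ψ t x) ≤ g t x * (ψ t x * ψ t x) :=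
      mul_le_mul_of_nonneg_right hg (mul_self_nonneg _)
    have h5 : -((ρ t x + r t x) * ψ t x) - 1 / 2 * (1 / M * (ψ t x * ψ t x))
        = M / 2 * (ρ t x + r t x) ^ 2 - 1 / (2 * M) * (ψ t x + M * (ρ t x + r t x)) ^ 2 := by
      field_simp; ring
    have h6 : 0 ≤ 1 / (2 * M) * (ψ t x + M * (ρ t x + r t x)) ^ 2 := by positivity
    nlinarith [mul_nonneg hM.le (sq_nonneg (ρ t x - r t x))]
  rw [ek, energyDensity]
  nlinarith [mul_nonneg hA.le (sq_nonneg (ρ t x)), mul_nonneg hA.le (sq_nonneg (r t x)),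
    mul_nonneg (mul_nonneg hTi.le hM.le) hk0, mul_nonneg (mul_nonneg hTi.le hM.le)
    (sq_nonneg (r t x)), mul_nonneg hM.le hk0]

/-! ### The stability estimate -/

lemma closedHalfSpace_subset_closure : closedHalfSpace ⊆ closure halfSpace := by
  intro x hx
  have h1 : Tendsto (fun τ : ℝ => x + τ • (EuclideanSpace.single 2 1 : E3)) (𝓝[>] 0) (𝓝 x) := by
    have hc : Continuous (fun τ : ℝ => x + τ • (EuclideanSpace.single 2 1 : E3)) := by fun_prop
    have := hc.tendsto 0
    simp only [zero_smul, add_zero] at this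
    exact this.mono_left nhdsWithin_le_nhds
  refine mem_closure_of_tendsto h1 ?_
  filter_upwards [self_mem_nhdsWithin] with τ hτ
  have h2 : (0 : ℝ) ≤ x 2 := hx
  have h3 : (0 : ℝ) < τ := hτ
  simp [halfSpace]
  linarith

lemma le_on_closedHalfSpace {f : E3 → ℝ} (hf : Continuous f) {c : ℝ}
    (h : ∀ x ∈ halfSpace, c ≤ f x) {x : E3} (hx : x ∈ closedHalfSpace) : c ≤ f x :=
  closure_minimal (t := {x | c ≤ f x}) h (isClosed_le continuous_const hf)
    (closedHalfSpace_subset_closure hx)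

lemma dx_tangential_eq_zero {f : E3 → ℝ} (hf : ContDiff ℝ 1 f) (h0 : ∀ x : E3, x 2 = 0 → f x = 0)
    {j : Fin 3} (hj : j ≠ 2) {x : E3} (hx : x 2 = 0) : pd j f x = 0 := by
  have h1 := hasDerivAt_line hf j x.ofLp (x j)
  have e1 : toE3 (Function.update x.ofLp j (x j)) = x := by
    ext i; simp
  have e2 : (fun s => f (toE3 (Function.update x.ofLp j s))) = fun _ => 0 := by
    funext s
    apply h0
    simpa [Function.update_of_ne hj.symm] using hx
  rw [e1, e2] at h1
  exact h1.unique (hasDerivAt_const _ _)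

/-- At t = 0 and t = T the identity holds only on one side; uniqueness of derivatives within the
nondegenerate interval [0, T] still determines the full derivative of the extension. -/
lemma dt_eq_zero_of_eqOn {f : ScalarField} (hf : IsCk 1 f) {T : ℝ} (hT : 0 < T) {x : E3}
    (h0 : ∀ t ∈ Icc 0 T, f t x = 0) {t : ℝ} (ht : t ∈ Icc 0 T) : dt f t x = 0 := by
  have h1 := (hf.hasDerivAt_dt t x).hasDerivWithinAt (s := Icc 0 T)
  have h2 : HasDerivWithinAt (fun s => f s x) 0 (Icc 0 T) t :=
    (hasDerivWithinAt_const t (Icc 0 T) (0 : ℝ)).congr h0 (h0 t ht)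
  exact (uniqueDiffOn_Icc hT t ht).eq_deriv _ h1 h2

lemma abs_poissonCoeff_le {h : ℝ → ℝ} {B L : ℝ} (hL : 1 ≤ L) (hexp : Real.exp B ≤ L)
    {φa φ : ScalarField} {t : ℝ} {x : E3} (ha : |φa t x| ≤ B) (hh : |h (φ t x)| ≤ L) :
    |poissonCoeff h φa φ t x| ≤ 2 * L ^ 2 := by
  have h1 : |Real.exp (-φa t x)| ≤ L := by
    rw [abs_of_pos (Real.exp_pos _)]
    refine (Real.exp_le_exp.2 ?_).trans hexp
    linarith [(abs_le.1 ha).1]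
  have h2 : |1 + h (φ t x)| ≤ 2 * L := (abs_add_le _ _).trans (by rw [abs_one]; linarith)
  exact (abs_mul_le_mul_of_le h1 h2).trans (by linarith)

section Stability

variable {Ti ε T₀ T M A B L : ℝ} {h : ℝ → ℝ} {na φa n φ n' φ' rn rφ : ScalarField}
  {ua u u' ru : VectorField}

/-- The L² bound for ∂_tφ̇ is included because the energy flux contains ∂_tψ. The resulting b may
depend on the solution, as it only serves to discard the cutoff error. -/
lemma IsLinearizedSolution.exists_energySq_le
    (sol : IsLinearizedSolution Ti ε T h na ua φa n u φ n' u' φ' rn ru rφ)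
    (hε : ε ∈ Ioc (0 : ℝ) 1) :
    ∃ b : ℝ≥0, ∀ s ∈ Icc 0 T, energySq ε n' u' φ' s + l2sq (dt φ' s) ≤ b := by
  obtain ⟨b1, h1⟩ := sol.n_reg.2.1.exists_l2sq_le sol.n_reg.1
  choose b2 h2 using fun j => (sol.u_reg j).2.1.exists_l2sq_le (sol.u_reg j).1
  obtain ⟨b3, h3⟩ := sol.φ_reg.2.1.exists_l2sq_le sol.φ_reg.1
  choose b4 h4 using fun j => (sol.φ_reg.2.1.dx (k := 1) sol.φ_reg.1 j).exists_l2sq_le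
    (IsCk.dx (k := 1) sol.φ_reg.1 j)
  obtain ⟨b5, h5⟩ := sol.φ_reg.2.2.exists_l2sq_le (IsCk.dt (k := 1) sol.φ_reg.1)
  refine ⟨b1 + ∑ j, b2 j + b3 + ∑ j, b4 j + b5, fun s hs => ?_⟩
  push_cast
  simp only [energySq]
  gcongr with j _ j _
  · exact h1 s hs
  · exact h2 j s hs
  · exact h3 s hs
  · refine le_trans ?_ (h4 j s hs)
    simp only [l2sq_eq_lintegral_ofReal]
    refine lintegral_mono fun x => ENNReal.ofReal_le_ofReal ?_
    rw [mul_pow]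
    exact mul_le_of_le_one_left (sq_nonneg _) (pow_le_one₀ hε.1.le hε.2)
  · exact h5 s hs

/-- All production terms vanish where the unknowns vanish. -/
lemma energyProduction_eq_zero {N g ρ ψ r : ScalarField} {V v b : VectorField} {t : ℝ} {x : E3}
    (hε : 0 < ε) (h0 : energySqDensity ε ρ v ψ t x = 0) :
    energyProduction Ti ε N V g ρ v ψ r ua b rn ru t x = 0 := by
  have p1 := sq_nonneg (ρ t x)
  have p2 : ∀ j, 0 ≤ v j t x ^ 2 := fun j => sq_nonneg _
  have p3 := sq_nonneg (ψ t x)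
  have p4 : ∀ j, 0 ≤ (ε * dx j ψ t x) ^ 2 := fun j => sq_nonneg _
  simp only [energySqDensity, Fin.sum_univ_three] at h0
  have z1 : ρ t x = 0 := by
    have : ρ t x ^ 2 = 0 := by linarith [p2 0, p2 1, p2 2, p4 0, p4 1, p4 2]
    simpa using this
  have z2 : ∀ j, v j t x = 0 := fun j => by
    have : v j t x ^ 2 = 0 := by
      fin_cases j <;> simp <;> nlinarith [p2 0, p2 1, p2 2, p4 0, p4 1, p4 2]
    simpa using this
  have z3 : ψ t x = 0 := by
    have : ψ t x ^ 2 = 0 := by linarith [p2 0, p2 1, p2 2, p4 0, p4 1, p4 2]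
    simpa using this
  have z4 : ∀ j, grad ψ j t x = 0 := fun j => by
    have : (ε * dx j ψ t x) ^ 2 = 0 := by
      have h2 := p2 0
      have h3 := p2 1
      have h4 := p2 2
      have h5 := p4 0
      have h6 := p4 1
      have h7 := p4 2
      fin_cases j <;> simp only [Fin.zero_eta, Fin.mk_one, Fin.reduceFinMk] <;> linarith
    have h1 : ε * dx j ψ t x = 0 := by simpa using this
    exact (mul_eq_zero.1 h1).resolve_left hε.ne'
  simp [energyProduction, normSq, advGrad, z1, z2, z3, z4]

/-- The balance law is integrated over the half-space and coercivity is applied at time t, the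
initial bound at time 0. L collects all background bounds and multiplies only the energy integral,
never the data. -/
theorem energySq_le_of_solution (hTi : 0 < Ti) (hε : ε ∈ Ioc (0 : ℝ) 1) (hT : 0 < T)
    (hTT : T ≤ T₀) (hM : 0 < M) (hL : 1 ≤ L) (hTiL : Ti ≤ L) (hB : B ≤ L) (hML : M ≤ L)
    (hexp : Real.exp B ≤ L) (hh : ContDiff ℝ 1 h)
    (hhL : ∀ φ, |φ| ≤ M → |h φ| ≤ L ∧ |deriv h φ| ≤ L)
    (hbg : BackgroundBounds B ε T₀ na ua φa)
    (hna : ∀ t ∈ Icc 0 T, ∀ x ∈ halfSpace, L⁻¹ ≤ na t x)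
    (hA : ∀ t ∈ Icc 0 T, ∀ x ∈ halfSpace, na t x ≤ A)
    (adm : IsAdmissible M T h na φa n u φ)
    (sol : IsLinearizedSolution Ti ε T h na ua φa n u φ n' u' φ' rn ru rφ)
    (hrn : MeasField rn) (hru : ∀ j, MeasField (ru j)) {t : ℝ} (ht : t ∈ Icc 0 T) :
    energySq ε n' u' φ' t ≤ ENNReal.ofReal (2 * M + 2 * (|A| + M) / Ti + 2) *
      (ENNReal.ofReal (|A| + M + Ti * M + M) * (l2sq (n' 0) + ∑ j, l2sq (u' j 0) + l2sq (rφ 0))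
        + (3 * (∫⁻ s in Icc 0 t, sourceSq ε rn ru rφ s)
          + ENNReal.ofReal (30 * (45 * L ^ 4) ^ 4) *
            ∫⁻ s in Icc 0 t, growthWeight ε n u φ s * energySq ε n' u' φ' s)) := by
  have hL0 : 0 < L := by linarith
  set N : ScalarField := fun t x => na t x + n t x with hNdef
  set V : VectorField := fun j t x => ua j t x + u j t x with hVdef
  set g := poissonCoeff h φa φ with hgdef
  have hIcc : ∀ s ∈ Icc 0 T, s ∈ Icc 0 T₀ := fun s hs => ⟨hs.1, hs.2.trans hTT⟩
  have h0T : (0 : ℝ) ∈ Icc 0 T := ⟨le_rfl, hT.le⟩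
  have reg : EnergyRegular N V g n' u' φ' rφ :=
    { N := ContDiff.add hbg.dens.reg adm.n_reg
      V := fun j => ContDiff.add (hbg.vel j).reg (adm.u_reg j)
      g := isCk_poissonCoeff hh hbg.pot.reg adm.φ_reg
      ρ := sol.n_reg.1
      v := fun j => (sol.u_reg j).1
      ψ := sol.φ_reg.1
      r := sol.rφ_reg }
  -- The fluxes must be C¹ up to the boundary, so the lower bound on N is extended to the closed
  -- half-space by continuity.
  have hNc : ∀ s ∈ Icc 0 T, ∀ x ∈ closedHalfSpace, N s x ≠ 0 := fun s hs x hx =>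
    ((by positivity : (0 : ℝ) < 1 / M).trans_le
      (le_on_closedHalfSpace (reg.N.slice s).continuous (adm.n_low s hs) hx)).ne'
  have hφ1 : IsCk 1 φ' := sol.φ_reg.1.mono (by norm_num)
  have bc_dx : ∀ s ∈ Icc 0 T, ∀ x : E3, x 2 = 0 → ∀ j, j ≠ 2 → grad φ' j s x = 0 :=
    fun s hs x hx j hj => dx_tangential_eq_zero (hφ1.slice s) (sol.bc_φ s hs) hj hx
  have bc_dt : ∀ s ∈ Icc 0 T, ∀ x : E3, x 2 = 0 → dt φ' s x = 0 := fun s hs x hx =>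
    dt_eq_zero_of_eqOn hφ1 hT (fun τ hτ => sol.bc_φ τ hτ x hx) hs
  -- pointwise bounds
  have bn : ∀ s ∈ Icc 0 T, ∀ x ∈ halfSpace, |n s x| ≤ M := fun s hs x hx => by
    linarith [adm.bdd s hs x hx, Real.sqrt_nonneg (∑ j, u j s x ^ 2), abs_nonneg (φ s x)]
  have bu : ∀ s ∈ Icc 0 T, ∀ x ∈ halfSpace, ∀ j, |u j s x| ≤ M := fun s hs x hx j => by
    have : |u j s x| ≤ Real.sqrt (∑ j, u j s x ^ 2) := by
      apply Real.abs_le_sqrt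
      exact Finset.single_le_sum (f := fun j => u j s x ^ 2) (fun _ _ => sq_nonneg _)
        (Finset.mem_univ j)
    linarith [adm.bdd s hs x hx, abs_nonneg (n s x), abs_nonneg (φ s x)]
  have bφ : ∀ s ∈ Icc 0 T, ∀ x ∈ halfSpace, |φ s x| ≤ M := fun s hs x hx => by
    linarith [adm.bdd s hs x hx, Real.sqrt_nonneg (∑ j, u j s x ^ 2), abs_nonneg (n s x)]
  have bNA : ∀ s ∈ Icc 0 T, ∀ x ∈ halfSpace, N s x ≤ |A| + M := fun s hs x hx =>
    add_le_add ((hA s hs x hx).trans (le_abs_self A)) ((le_abs_self _).trans (bn s hs x hx))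
  have bNlow : ∀ s ∈ Icc 0 T, ∀ x ∈ halfSpace, L⁻¹ ≤ N s x := fun s hs x hx => by
    refine le_trans ?_ (adm.n_low s hs x hx)
    rw [one_div]
    exact inv_anti₀ hM hML
  -- energies
  obtain ⟨b, hb⟩ := sol.exists_energySq_le hε
  have hE : ∀ s, energySq ε n' u' φ' s
      = ∫⁻ x, ENNReal.ofReal (energySqDensity ε n' u' φ' s x) ∂halfVol :=
    energySq_eq sol.n_reg.1 (fun j => (sol.u_reg j).1) sol.φ_reg.1
  have wc : ∀ s, Continuous (energySqDensity ε n' u' φ' s) :=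
    continuous_energySqDensity sol.n_reg.1 (fun j => (sol.u_reg j).1) sol.φ_reg.1
  have w0 : ∀ s x, 0 ≤ energySqDensity ε n' u' φ' s x := fun s x => by
    unfold energySqDensity; positivity
  -- This bounds g = e^{-φ_a}(1 + h(φ)) by L · 2L, and it dominates the bounds 2L on N and V.
  set K := 2 * L ^ 2 with hK
  have hLK : 2 * L ≤ K := by nlinarith
  set W := 60 * K ^ 3 * (b : ℝ) with hW
  have fluxW : ∀ {F : VectorField}, ∀ s ∈ Icc 0 T, (∀ j, ∀ x ∈ halfSpace, |F j s x|
      ≤ 20 * K ^ 3 * (energySqDensity ε n' u' φ' s x + dt φ' s x ^ 2)) →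
      ∫⁻ x, ∑ j, ‖F j s x‖ₑ ∂halfVol ≤ ENNReal.ofReal W := by
    intro F s hs hF
    calc ∫⁻ x, ∑ j, ‖F j s x‖ₑ ∂halfVol
        ≤ ∫⁻ x, ENNReal.ofReal (60 * K ^ 3) *
          ENNReal.ofReal (energySqDensity ε n' u' φ' s x + dt φ' s x ^ 2) ∂halfVol := by
          refine setLIntegral_mono' measurableSet_halfSpace fun x hx => ?_
          simp only [Real.enorm_eq_ofReal_abs]
          rw [← ENNReal.ofReal_sum_of_nonneg fun _ _ => abs_nonneg _,
            ← ENNReal.ofReal_mul (by positivity)]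
          apply ENNReal.ofReal_le_ofReal
          rw [Fin.sum_univ_three]
          linarith [hF 0 x hx, hF 1 x hx, hF 2 x hx]
      _ = ENNReal.ofReal (60 * K ^ 3) * (energySq ε n' u' φ' s + l2sq (dt φ' s)) := by
          rw [lintegral_const_mul' _ _ ENNReal.ofReal_ne_top,
            lintegral_ofReal_add (wc s).measurable (w0 s) (fun x => sq_nonneg _), hE,
            l2sq_eq_lintegral_ofReal]
      _ ≤ ENNReal.ofReal (60 * K ^ 3) * b := by
          gcongr
          exact hb s hs
      _ = ENNReal.ofReal W := by
          rw [hW, ENNReal.ofReal_mul (p := 60 * K ^ 3) (by positivity), ENNReal.ofReal_coe_nnreal]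
  have main := lintegral_le_of_balance ht (e := energyDensity Ti ε N g n' u' φ' rφ)
    (Fl := energyFlux Ti ε N V g n' u' φ') (P := poissonFlux ε φ')
    (G := energyProduction Ti ε N V g n' u' φ' rφ ua (fun j t x => dx j na t x / na t x) rn ru)
    (epos := posDensity Ti ε N g n' u' φ' t)
    (S := fun s => 3 * sourceSq ε rn ru rφ s)
    (Q := fun s => ENNReal.ofReal (30 * (45 * L ^ 4) ^ 4)
      * (growthWeight ε n u φ s * energySq ε n' u' φ' s))
    (I₀ := ENNReal.ofReal (|A| + M + Ti * M + M)
      * (l2sq (n' 0) + ∑ j, l2sq (u' j 0) + l2sq (rφ 0))) (W := W)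
    (fun s hs x hx => (reg.hasD_energyDensity (hNc s hs x hx)).1)
    (fun j s hs x hx => (reg.hasD_energyFlux (hNc s hs x hx) j).1)
    (fun j s hs x hx => (reg.hasD_poissonFlux j).1)
    (by
      intro s hs x hx
      -- On the boundary V₃, v₃, ψ and ∂_tψ vanish. The term with ∂₃ψ (V·∇ψ) vanishes as well: V₃ =
      -- 0 removes the normal part, and tangential derivatives of ψ are zero.
      have z1 : V 2 s x = 0 := by
        simp only [hVdef]
        rw [hbg.vel_boundary s (hIcc s hs) x hx, adm.bc_u s hs x hx, add_zero]
      simp [energyFlux, advGrad, z1, sol.bc_u s hs x hx, sol.bc_φ s hs x hx, bc_dt s hs x hx,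
        bc_dx s hs x hx 0 (by decide), bc_dx s hs x hx 1 (by decide)])
    (fun x hx => by simp [poissonFlux, sol.bc_φ t ht x hx])
    (by
      intro s hs x hx
      refine reg.energy_balance (hNc s hs x (halfSpace_subset_closedHalfSpace hx))
        (sol.mass s hs x hx) (fun j => ?_) ?_
      · have := sol.momentum s hs x hx j
        rw [div_eq_mul_inv (dx j n' s x), div_eq_mul_inv (n' s x)] at this
        exact this
      · have := sol.poisson s hs x hx
        simp only [laplacian] at this
        simp only [grad, hgdef, poissonCoeff]
        linear_combination this)
    (by
      intro x hx
      refine reg.posDensity_eq ?_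
      have := sol.poisson t ht x hx
      simp only [laplacian] at this
      simp only [grad, hgdef, poissonCoeff]
      linear_combination this)
    (by
      intro x hx
      have h1 := energySqDensity_le_posDensity (ε := ε) (g := g) (ρ := n') (ψ := φ') (v := u') hTi hM
        (adm.n_low t ht x hx) (bNA t ht x hx) (adm.φ_low t ht x hx)
      have h2 := (w0 t x).trans h1
      exact nonneg_of_mul_nonneg_right h2 (by positivity))
    (by
      intro s hs
      have hs' : s ∈ Icc 0 T := ⟨hs.1, hs.2.trans ht.2⟩
      -- An infinite weight makes the right-hand side infinite unless the energy is zero. In that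
      -- case 0 · ∞ = 0, but the unknowns vanish identically on the half-space and so does the
      -- production.
      rcases eq_or_ne (growthWeight ε n u φ s) ⊤ with hD | hD
      · rcases eq_or_ne (energySq ε n' u' φ' s) 0 with hE0 | hE0
        · have : ∫⁻ x, ENNReal.ofReal (energyProduction Ti ε N V g n' u' φ' rφ ua
              (fun j t x => dx j na t x / na t x) rn ru s x) ∂halfVol = ∫⁻ x, 0 ∂halfVol := by
            refine setLIntegral_congr_fun measurableSet_halfSpace fun x hx => ?_
            rw [energyProduction_eq_zero hε.1
              (eq_zero_of_lintegral_eq_zero (wc s) (w0 s) ((hE s).symm.trans hE0) hx),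
              ENNReal.ofReal_zero]
          rw [this, lintegral_zero]
          exact zero_le
        · have : ENNReal.ofReal (30 * (45 * L ^ 4) ^ 4)
              * (growthWeight ε n u φ s * energySq ε n' u' φ' s) = ⊤ := by
            rw [hD, ENNReal.top_mul hE0, ENNReal.mul_top]
            rw [Ne, ENNReal.ofReal_eq_zero, not_le]
            positivity
          rw [this, add_top]
          exact le_top
      · obtain ⟨hd1, hp⟩ := perturbationBounds_of_growthWeight hε.1 adm.n_reg adm.u_reg adm.φ_reg
          (adm.bdd s hs') hD
        set d := (growthWeight ε n u φ s).toReal with hd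
        have hdD : growthWeight ε n u φ s = ENNReal.ofReal d := (ENNReal.ofReal_toReal hD).symm
        calc _ ≤ ∫⁻ x, (ENNReal.ofReal (3 * sourceSqDensity ε rn ru rφ s x)
              + ENNReal.ofReal (30 * ((45 * L ^ 4) ^ 4 * d))
                * ENNReal.ofReal (energySqDensity ε n' u' φ' s x)) ∂halfVol := by
              refine setLIntegral_mono' measurableSet_halfSpace fun x hx => ?_
              have h1 := energyProduction_le_of_bounds (ρ := n') (ψ := φ') (r := rφ) (rn := rn)
                (v := u') (ru := ru) hε.1 hL hd1
                (by rw [abs_of_pos hTi]; exact hTiL) hB hML hexp hh hhL hbg (hIcc s hs') hp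
                adm.n_reg adm.u_reg adm.φ_reg (adm.bc_u s hs') hx (hna s hs' x hx)
                (bNlow s hs' x hx)
              rw [← ENNReal.ofReal_mul (by positivity)]
              exact (ENNReal.ofReal_le_ofReal h1).trans ENNReal.ofReal_add_le
          _ = _ := by
              have m1 : Measurable (fun x => ENNReal.ofReal (30 * ((45 * L ^ 4) ^ 4 * d))
                  * ENNReal.ofReal (energySqDensity ε n' u' φ' s x)) :=
                (wc s).measurable.ennreal_ofReal.const_mul _
              rw [lintegral_add_right _ m1, lintegral_const_mul' _ _ ENNReal.ofReal_ne_top, ← hE,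
                sourceSq_eq hrn hru sol.rφ_reg, hdD]
              simp only [ENNReal.ofReal_mul (by norm_num : (0 : ℝ) ≤ 3)]
              rw [lintegral_const_mul' _ _ ENNReal.ofReal_ne_top, ← mul_assoc (30 : ℝ),
                ENNReal.ofReal_mul (p := 30 * (45 * L ^ 4) ^ 4) (by positivity)]
              simp only [ENNReal.ofReal_ofNat, mul_assoc])
    ((measurable_sourceSq hrn hru sol.rφ_reg).const_mul 3)
    (by positivity)
    (by
      intro s hs
      refine fluxW s hs fun j x hx => ?_
      have l1 : L ≤ K := by linarith
      refine abs_energyFlux_le (by linarith) hε (by rw [abs_of_pos hTi]; linarith) ?_ ?_ ?_ ?_ j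
      · exact (abs_add_le _ _).trans (by linarith [hbg.dens.val s (hIcc s hs) x hx, bn s hs x hx])
      · have h1 := bNlow s hs x hx
        have h2 : 0 < N s x := (inv_pos.2 hL0).trans_le h1
        rw [abs_of_pos (inv_pos.2 h2)]
        exact (inv_le_of_inv_le₀ hL0 h1).trans l1
      · exact abs_poissonCoeff_le hL hexp (hbg.pot.val s (hIcc s hs) x hx)
          (hhL _ (bφ s hs x hx)).1
      · intro k
        exact (abs_add_le _ _).trans
          (by linarith [(hbg.vel k).val s (hIcc s hs) x hx, bu s hs x hx k]))
    (by
      refine fluxW t ht fun j x hx => ?_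
      have h1 := abs_poissonFlux_le (ρ := n') (v := u') (ψ := φ') (t := t) (x := x) hε j
      have h2 : (1 : ℝ) ≤ 20 * K ^ 3 := by
        have : (1 : ℝ) ≤ K ^ 3 := one_le_pow₀ (by linarith)
        linarith
      have h3 := mul_le_mul_of_nonneg_right h2
        (add_nonneg (w0 t x) (sq_nonneg (dt φ' t x)))
      linarith [sq_nonneg (dt φ' t x)])
    (by
      have m1 : Measurable (fun x => n' 0 x ^ 2) := ((sol.n_reg.1.measField.slice 0).pow_const 2)
      have m2 : Measurable (fun x => ∑ j, u' j 0 x ^ 2) :=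
        measurable_sum_sq fun j => (sol.u_reg j).1.measField.slice 0
      have e1 : l2sq (n' 0) + ∑ j, l2sq (u' j 0) + l2sq (rφ 0) = ∫⁻ x, ENNReal.ofReal
          (n' 0 x ^ 2 + ∑ j, u' j 0 x ^ 2 + rφ 0 x ^ 2) ∂halfVol := by
        rw [lintegral_ofReal_add (f := fun x => n' 0 x ^ 2 + ∑ j, u' j 0 x ^ 2) (m1.add m2)
            (fun x => by positivity) (fun x => by positivity),
          lintegral_ofReal_add m1 (fun x => by positivity) (fun x => by positivity),
          sum_l2sq_eq _ fun j => (sol.u_reg j).1.measField.slice 0, l2sq_eq_lintegral_ofReal,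
          l2sq_eq_lintegral_ofReal]
      rw [e1, ← lintegral_const_mul' _ _ ENNReal.ofReal_ne_top]
      refine setLIntegral_mono' measurableSet_halfSpace fun x hx => ?_
      rw [← ENNReal.ofReal_mul (by positivity)]
      exact ENNReal.ofReal_le_ofReal (energyDensity_le (g := g) hTi hM (adm.n_low 0 h0T x hx)
        (bNA 0 h0T x hx) (adm.φ_low 0 h0T x hx)))
  rw [lintegral_const_mul' _ _ (by norm_num), lintegral_const_mul' _ _ ENNReal.ofReal_ne_top]
    at main
  refine le_trans ?_ (mul_le_mul_right main _)
  rw [hE, ← lintegral_const_mul' _ _ ENNReal.ofReal_ne_top]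
  refine setLIntegral_mono' measurableSet_halfSpace fun x hx => ?_
  rw [← ENNReal.ofReal_mul (by positivity)]
  exact ENNReal.ofReal_le_ofReal (energySqDensity_le_posDensity (g := g) hTi hM
    (adm.n_low t ht x hx) (bNA t ht x hx) (adm.φ_low t ht x hx))

/-- The sources may be replaced by measurable ones. -/
lemma IsLinearizedSolution.exists_measurable_sources
    (sol : IsLinearizedSolution Ti ε T h na ua φa n u φ n' u' φ' rn ru rφ)
    (hna : IsCk 1 na) (hua : ∀ j, IsCk 1 (ua j)) (hn : IsCk 1 n) (hu : ∀ j, IsCk 1 (u j)) :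
    ∃ (sn : ScalarField) (su : VectorField), MeasField sn ∧ (∀ j, MeasField (su j)) ∧
      IsLinearizedSolution Ti ε T h na ua φa n u φ n' u' φ' sn su rφ ∧
      ∀ s ∈ Icc 0 T, sourceSq ε sn su rφ s = sourceSq ε rn ru rφ s := by
  -- Each source is defined everywhere as the left-hand side minus the remaining terms of its
  -- equation; this is Borel in (t, x) and agrees with the given source wherever the equation holds.
  set sn : ScalarField := fun t x => dt n' t x + adv (ua + u) n' t x
    + (na t x + n t x) * div u' t x + adv u' (na + n) t x + n' t x * div (ua + u) t x with hsn
  set su : VectorField := fun j t x => dt (u' j) t x + adv (ua + u) (u' j) t x + adv u' (ua j) t x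
    + Ti * (dx j n' t x / (na t x + n t x)
      - dx j na t x / na t x * (n' t x / (na t x + n t x))) - dx j φ' t x with hsu
  have hN : IsCk 1 (na + n) := ContDiff.add hna hn
  have hV : ∀ j, IsCk 1 ((ua + u) j) := fun j => ContDiff.add (hua j) (hu j)
  have mdx : ∀ {f : ScalarField}, IsCk 1 f → ∀ j, MeasField (dx j f) := fun hf j =>
    (IsCk.dx (k := 0) hf j).measField
  have madv : ∀ {v : VectorField} {f : ScalarField}, (∀ j, IsCk 1 (v j)) → IsCk 1 f →
      MeasField (adv v f) := fun hv hf =>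
    Finset.measurable_sum _ fun j _ => Measurable.mul (hv j).measField (mdx hf j)
  have mdiv : ∀ {v : VectorField}, (∀ j, IsCk 1 (v j)) → MeasField (div v) := fun hv =>
    Finset.measurable_sum _ fun j _ => mdx (hv j) j
  have hu' := fun j => (sol.u_reg j).1
  have hn' := sol.n_reg.1
  have mN : Measurable (fun p : ℝ × E3 => na p.1 p.2 + n p.1 p.2) := hN.measField
  refine ⟨sn, su, ?_, fun j => ?_, ?_, ?_⟩
  · exact Measurable.add (Measurable.add (Measurable.add (Measurable.add
      (IsCk.dt (k := 0) hn').measField (madv hV hn')) (Measurable.mul mN (mdiv hu')))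
      (madv hu' hN)) (Measurable.mul hn'.measField (mdiv hV))
  · exact Measurable.sub (Measurable.add (Measurable.add (Measurable.add
      (IsCk.dt (k := 0) (hu' j)).measField (madv hV (hu' j))) (madv hu' (hua j)))
      (Measurable.const_mul (Measurable.sub (Measurable.div (mdx hn' j) mN)
        (Measurable.mul (Measurable.div (mdx hna j) hna.measField)
          (Measurable.div hn'.measField mN))) Ti)) (IsCk.dx (k := 1) sol.φ_reg.1 j).measField
  · exact { sol with
      mass := fun s _ x _ => rfl
      momentum := fun s _ x _ j => by simp only [hsu]; ring }
  · intro s hs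
    have e1 : l2sq (sn s) = l2sq (rn s) := by
      rw [l2sq, l2sq, eLpNorm_congr_ae]
      exact (ae_restrict_mem measurableSet_halfSpace).mono fun x hx => sol.mass s hs x hx
    have e2 : ∀ j, l2sq (su j s) = l2sq (ru j s) := fun j => by
      rw [l2sq, l2sq, eLpNorm_congr_ae]
      exact (ae_restrict_mem measurableSet_halfSpace).mono fun x hx => by
        simp only [hsu]
        rw [sol.momentum s hs x hx j]
        ring
    simp only [sourceSq, e1, e2]

end Stability

end

end QuasineutralEP

/-! ### Choice of the constants and conclusion -/

theorem mainTheorem5 (Ti : ℝ) (hTi : 0 < Ti) :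
    ∃ C₁ : ℝ → ℝ → ℝ≥0,
      ∀ (K m : ℕ) (_hK : 1 ≤ K) (_hm : 3 ≤ m) (T₀ : ℝ) (_hT₀ : 0 < T₀)
        (nref φb : E3 → ℝ) (p : Profiles), IsApproxSolution Ti K m T₀ nref φb p →
        (∃ A : ℝ, ∀ ε ∈ Ioc (0 : ℝ) 1, ∀ t ∈ Icc 0 T₀, ∀ x ∈ halfSpace, p.na K ε t x ≤ A) ∧
        ∃ ε₀ ∈ Ioc (0 : ℝ) 1, ∀ (M A : ℝ), 0 < M →
          (∀ ε ∈ Ioc (0 : ℝ) 1, ∀ t ∈ Icc 0 T₀, ∀ x ∈ halfSpace, p.na K ε t x ≤ A) →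
          ∃ C₂ : ℝ≥0, ∀ ε ∈ Ioc (0 : ℝ) 1, ∀ T ∈ Ioc 0 T₀,
            (ε ≤ ε₀ ∨ ∀ t ∈ Icc 0 T, ∀ x ∈ halfSpace, 1 / M ≤ p.na K ε t x) →
            ∀ (h : ℝ → ℝ), (h = h0 ∨ h = h1) →
            ∀ (n : ScalarField) (u : VectorField) (φ : ScalarField),
              IsAdmissible M T h (p.na K ε) (p.φa K ε) n u φ →
            ∀ (n' : ScalarField) (u' : VectorField) (φ' : ScalarField)
              (rn : ScalarField) (ru : VectorField) (rφ : ScalarField),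
              IsLinearizedSolution Ti ε T h (p.na K ε) (p.ua K ε) (p.φa K ε) n u φ
                n' u' φ' rn ru rφ →
              ∀ t ∈ Icc 0 T,
                energySq ε n' u' φ' t ≤
                  C₁ M A * (l2sq (n' 0) + ∑ j, l2sq (u' j 0) + l2sq (rφ 0)
                      + ∫⁻ s in Icc 0 t, sourceSq ε rn ru rφ s)
                  + C₂ * ∫⁻ s in Icc 0 t,
                      (1 + gradLinfAll n u φ s + ENNReal.ofReal ε⁻¹ * linf (n s))
                        * energySq ε n' u' φ' s := by
  -- The first factor is the coercivity constant with |A| + M as upper bound for N. In the second,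
  -- |A| + M + T^i M + M bounds the initial energy and 3 is the source coefficient.
  refine ⟨fun M A => Real.toNNReal ((2 * M + 2 * (|A| + M) / Ti + 2)
    * (|A| + M + Ti * M + M + 3)), ?_⟩
  intro K m _ hm T₀ hT₀ nref φb p hp
  obtain ⟨B, hB1, hB⟩ := hp.exists_bounds hT₀ hm
  obtain ⟨c, hc, ε₀, hε₀, hpos⟩ := hp.na_pos hTi hT₀ hm
  refine ⟨⟨B, fun ε hε t ht x hx => (le_abs_self _).trans ((hB ε hε).dens.val t ht x hx)⟩,
    ε₀, hε₀, ?_⟩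
  intro M A hM hA
  obtain ⟨H₀, hH₀⟩ := exists_bound_of_contDiff contDiff_h0 M
  obtain ⟨H₁, hH₁⟩ := exists_bound_of_contDiff contDiff_h1 M
  -- One number dominates every background bound: B for the profiles, c⁻¹ for the inverse density,
  -- H₀ and H₁ for the nonlinearities, e^B for e^{-φ_a}. It enters C₂ only.
  set L := 1 + B + M + c⁻¹ + Ti + |H₀| + |H₁| + Real.exp B with hL
  have hc' : 0 < c⁻¹ := inv_pos.2 hc
  have hexp := Real.exp_pos B
  have a0 := abs_nonneg H₀
  have a1 := abs_nonneg H₁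
  refine ⟨Real.toNNReal ((2 * M + 2 * (|A| + M) / Ti + 2) * (30 * (45 * L ^ 4) ^ 4)), ?_⟩
  intro ε hε T hT hlow h hh n u φ adm n' u' φ' rn ru rφ sol t ht
  have hbg := hB ε hε
  have hIcc : ∀ s ∈ Icc 0 T, s ∈ Icc 0 T₀ := fun s hs => ⟨hs.1, hs.2.trans hT.2⟩
  have hna : ∀ s ∈ Icc 0 T, ∀ x ∈ halfSpace, L⁻¹ ≤ p.na K ε s x := by
    intro s hs x hx
    -- The coefficient ∇n_a/n_a requires n_a itself, not only N, to be bounded below; this comes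
    -- from small ε or from the explicit alternative.
    rcases hlow with hlow | hlow
    · refine le_trans (inv_le_of_inv_le₀ hc ?_) (hpos ε ⟨hε.1, hlow⟩ s (hIcc s hs) x hx)
      linarith
    · refine le_trans ?_ (hlow s hs x hx)
      rw [one_div]
      exact inv_anti₀ hM (by linarith)
  have hh1 : ContDiff ℝ 1 h := by
    rcases hh with rfl | rfl
    exacts [contDiff_h0, contDiff_h1]
  have hhL : ∀ φ, |φ| ≤ M → |h φ| ≤ L ∧ |deriv h φ| ≤ L := by
    intro φ hφ
    have l0 := le_abs_self H₀
    have l1 := le_abs_self H₁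
    rcases hh with rfl | rfl
    · exact ⟨(hH₀ φ hφ).1.trans (by linarith), (hH₀ φ hφ).2.trans (by linarith)⟩
    · exact ⟨(hH₁ φ hφ).1.trans (by linarith), (hH₁ φ hφ).2.trans (by linarith)⟩
  -- Measurable sources are needed to split the time integral of sources plus energy; their norms on
  -- [0, T] are unchanged.
  obtain ⟨sn, su, hsn, hsu, sol', hsrc⟩ := sol.exists_measurable_sources hbg.dens.reg
    (fun j => (hbg.vel j).reg) adm.n_reg adm.u_reg
  have key := energySq_le_of_solution hTi hε hT.1 hT.2 hM (by linarith) (by linarith)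
    (by linarith) (by linarith) (by linarith) hh1 hhL hbg hna
    (fun s hs x hx => hA ε hε s (hIcc s hs) x hx) adm sol' hsn hsu ht
  rw [setLIntegral_congr_fun measurableSet_Icc (fun s hs => hsrc s ⟨hs.1, hs.2.trans ht.2⟩)] at key
  refine key.trans ?_
  have q1 : 0 ≤ 2 * M + 2 * (|A| + M) / Ti + 2 := by positivity
  have q2 : 0 ≤ |A| + M + Ti * M + M := by positivity
  have e1 : ((Real.toNNReal ((2 * M + 2 * (|A| + M) / Ti + 2) * (|A| + M + Ti * M + M + 3)) : ℝ≥0)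
      : ℝ≥0∞) = ENNReal.ofReal (2 * M + 2 * (|A| + M) / Ti + 2)
        * (ENNReal.ofReal (|A| + M + Ti * M + M) + 3) := by
    rw [← ENNReal.ofReal.eq_1, ENNReal.ofReal_mul q1, ENNReal.ofReal_add q2 (by norm_num)]
    simp
  have e2 : ((Real.toNNReal ((2 * M + 2 * (|A| + M) / Ti + 2) * (30 * (45 * L ^ 4) ^ 4)) : ℝ≥0)
      : ℝ≥0∞) = ENNReal.ofReal (2 * M + 2 * (|A| + M) / Ti + 2)
        * ENNReal.ofReal (30 * (45 * L ^ 4) ^ 4) := by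
    rw [← ENNReal.ofReal.eq_1, ENNReal.ofReal_mul q1]
  rw [e1, e2, mul_assoc, mul_assoc, ← mul_add]
  refine mul_le_mul_right ?_ _
  rw [← add_assoc]
  refine add_le_add_left ?_ _
  rw [add_mul]
  exact add_le_add (mul_le_mul_right le_self_add _) (mul_le_mul_right le_add_self _)
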